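/- **Hypernets.** Vertex labels are $\star$, $\diamond$ and $T^n(\star)$ ($n\in\mathbb N$). Let $\mathbb O$ be a set of operations $\phi$, each with a number $m_\phi$ of eager arguments and a list $(n_1,\dots,n_d)$ (deferred argument $i$ binds $n_i$ variables), and each either active or passive. A *hypernet* $G : I\Rightarrow O$ is a finite hypergraph with labelled vertices and edges, in which each edge has a repetition-free list of sources and a repetition-free list of targets, each vertex is a source of at most one edge and a target of at most one edge, the list $I$ of inputs enumerates the vertices that are targets of no edge, the list $O$ of outputs enumerates those that are sources of no edge, and no input is an output. Edge labels are typed as follows: operations $\phi:\star\Rightarrow\star^{m_\phi}\otimes\bigotimes_i T^{n_i}(\star)$; instances $\star\Rightarrow\diamond$; atoms $\diamond\Rightarrow\star$; weakenings $\varepsilon\Rightarrow\ell$ and contractions $\ell\otimes\ell\Rightarrow\ell$ for $\ell\in\{\star,\diamond\}$; the tokens $?$ (search), $\checkmark$ (value), $\lightning$ (rewrite) of type $\star\Rightarrow\star$; and boxes $T^b(\star)\Rightarrow\star^k\otimes\diamond^h$, whose label is itself a hypernet $\star\Rightarrow\star^{b+k}\otimes\diamond^h$ (nesting of finite depth). Edges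 of the outermost level are *shallow*. Hypernets are taken up to isomorphism. A *context* may also have edges labelled by typed hole labels, each label occurring at most once at any depth; $\mathcal C[\vec H]$ replaces the holes by hypernets (or contexts) of the same type. A hypernet or context is *focus-free* if it has no token edge at any depth, and *focussed* if it has exactly one, which is shallow, whose source and target differ, and such that it is not the case that its source is an input and its target an output; $|\dot G|$ is the focus-free hypernet obtained by deleting the token edge and identifying its source and target, and $t;G$ is $G$ with a $t$-token connected to its first input. A token of a context is *entering* if its target is a source of a hole, and *remote* if it is a search or value token or is not entering. A *state* is a focussed hypernet of type $\star\Rightarrow\varepsilon$. **The machine $\mathcal U(\mathbb O,B_{\mathbb O})$.** Each rule $G\mapsto G'$ below gives transitions $\mathcal C[G]\to\mathcal C[G']$ between states, for focus-free $\mathcal C:\star\Rightarrow\varepsilon$ with exactly one hole, which is shallow. *Search transitions*: a $?$ entering (either source of) a $\star$-contraction becomes $\lightning$; a $?$ entering an instance becomes $\checkmark$; a $?$ entering an operation edge $\phi$ with $m_\phi>0$ moves to its first target; a $\checkmark$ on the $j$-th target of $\phi$ ($j<m_\phi$) becomes $?$ on the $(j+1)$-st; a $\checkmark$ on the $m_\phi$-th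 target, as well as a $?$ entering $\phi$ with $m_\phi=0$, becomes $\lightning$ (if $\phi$ is active) or $\checkmark$ (if $\phi$ is passive) entering $\phi$. *Copy transitions*: the left-hand side is a $\lightning$ on the first input of a contraction tree $C$ (a hypernet $\star^{n+1}\Rightarrow\star$ of contractions and weakenings of type $\star$, whose output is reachable from each vertex) followed by a copyable hypernet $H:\star\Rightarrow\star^p\otimes\diamond^q$ (an instance edge, or an operation edge with a box on each deferred argument). The right-hand side is a $?$ entering a new copy of $H$, while the first input of $C$ becomes the target of a new weakening and $C$ is followed by another copy of $H$; corresponding outputs of the two copies are merged by contraction trees with two inputs and one weakening each. *Compute transitions*: given by the behaviour $B_{\mathbb O}$, a set of pairs of states such that in the first a $\lightning$ enters an active operation edge, and in the second the token is a $?$. *Rewrite transitions* are copy and compute transitions; $\to$ is the union of all transitions. A state $\dot N$ is *final* if $\dot N=\checkmark;|\dot N|$, *stuck* if it is not final and has no transition, *rooted* if $?;|\dot N|$ reaches $\dot N$ by search transitions. The machine is *deterministic* if each state has at most one transition, *refocusing* if every transition preserves rootedness. **Relations.** For $Q\subseteq\mathbb N\times\mathbb N$, $\dot G_1\mathrel{\dot\preceq_Q}\dot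 G_2$ means: whenever $\dot G_1\to^{k_1}\dot N_1$ with $\dot N_1$ final, there are $k_2$ and a final $\dot N_2$ with $k_1\mathrel Qk_2$ and $\dot G_2\to^{k_2}\dot N_2$; $\dot\simeq_Q$ is $\dot\preceq_Q$ in both directions. A triple of preorders $(Q,Q',Q'')$ on $\mathbb N$ is *reasonable* if $Q$ is closed under addition, $Q'\subseteq{\ge}$, $Q'\subseteq Q''$, and $a\mathrel{Q'}b\mathrel Qc\mathrel{Q''}d$ implies $a\mathrel Qd$. A *pre-template* is a relation $\vartriangleleft$ on focus-free hypernets that relates only hypernets of the same type. Let $\mathbb C$ be a set of contexts. * A *$\mathbb C$-specimen* of $\vartriangleleft$ is a triple $(\dot{\mathcal C};\vec{H^1};\vec{H^2})$ of a focussed context with $|\dot{\mathcal C}|\in\mathbb C$ and two lists of hypernets indexed by its holes such that $H^1_i\vartriangleleft H^2_i$ for all $i$, and $\dot{\mathcal C}[\vec{H^1}]$, $\dot{\mathcal C}[\vec{H^2}]$ are states. * States $(\dot N_1,\dot N_2)$ form a *quasi-$\mathbb C$-specimen up to* $(A,A')$ if there is a $\mathbb C$-specimen $(\dot{\mathcal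 C};\vec{H^1};\vec{H^2})$ such that $\dot{\mathcal C},\dot N_1,\dot N_2$ have the same token label and, if $\dot N_1,\dot N_2$ are rooted, then $\dot{\mathcal C}[\vec{H^1}]$, $\dot{\mathcal C}[\vec{H^2}]$ are rooted, $\dot N_1\mathrel A\dot{\mathcal C}[\vec{H^1}]$ and $\dot{\mathcal C}[\vec{H^2}]\mathrel{A'}\dot N_2$. * $\vartriangleleft$ is a *$(\mathbb C,Q,Q')$-template* if (a) whenever $H_1\vartriangleleft H_2$, at least one of $H_1,H_2$ has no path consisting of one or more operation edges from an input of type $\star$ to an output of type $\star$; and (b) for every $\mathbb C$-specimen $(\dot{\mathcal C};\vec{H^1};\vec{H^2})$ with an entering search token, one of the following holds: (I) $\dot{\mathcal C}[\vec{H^1}]$ and $\dot{\mathcal C}[\vec{H^2}]$ both reach stuck states; (II) there are a $\mathbb C$-specimen $(\dot{\mathcal C}';\vec{H'^1};\vec{H'^2})$, whose token is neither a rewrite token nor entering, and $k_1,k_2$ with $(1+k_1)\mathrel Qk_2$, $\dot{\mathcal C}[\vec{H^1}]\to^{1+k_1}\dot{\mathcal C}'[\vec{H'^1}]$, $\dot{\mathcal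 C}[\vec{H^2}]\to^{k_2}\dot{\mathcal C}'[\vec{H'^2}]$; (III) there are a quasi-$\mathbb C$-specimen $(\dot N_1,\dot N_2)$ up to $(\dot\simeq_{Q'},\dot\simeq_{Q'})$, whose token is not a rewrite token, and $k_1,k_2$ with $(1+k_1)\mathrel Q(1+k_2)$, $\dot{\mathcal C}[\vec{H^p}]\to^{1+k_p}\dot N_p$ for $p=1,2$. * $\vartriangleleft$ is *$(\mathbb C,Q,Q',Q'')$-robust* relative to a rewrite transition $\dot N\to\dot N'$ if for every $\mathbb C$-specimen $(\dot{\mathcal C};\vec{H^1};\vec{H^2})$ with $\dot{\mathcal C}[\vec{H^1}]=\dot N$, whose token is a rewrite token that is not entering, one of the following holds: (I) $\dot{\mathcal C}[\vec{H^1}]$ or $\dot{\mathcal C}[\vec{H^2}]$ is not rooted; (II) $\dot N'$ reaches a stuck state; (III) there are a quasi-$\mathbb C$-specimen $(\dot N_1,\dot N_2)$ up to $(\dot\preceq_{Q'},\dot\preceq_{Q''})$, whose token is not a rewrite token, and $k_1,k_2$ with $(1+k_1)\mathrel Qk_2$, $\dot N'\to^{k_1}\dot N_1$, $\dot{\mathcal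 C}[\vec{H^2}]\to^{k_2}\dot N_2$. * The *$\mathbb C$-contextual lifting* $\overline{\vartriangleleft}^{\mathbb C}$ relates $\dot{\mathcal C}[\vec{H^1}]$ to $\dot{\mathcal C}[\vec{H^2}]$, for each $\mathbb C$-specimen $(\dot{\mathcal C};\vec{H^1};\vec{H^2})$ of $\vartriangleleft$ whose token is remote in $\dot{\mathcal C}$ and for which both states are rooted. * A relation $R$ on states is a *$(Q,Q',Q'')$-simulation* if $\dot G_1\mathrel R\dot G_2$ implies: (A) if $\dot G_1$ is final, so is $\dot G_2$; (B) if $\dot G_1\to\dot G_1'$, then either $\dot G_1'$ reaches a stuck state, or there are states $\dot H_1,\dot H_2,\dot K_1,\dot K_2$ and $k_1,k_2\in\mathbb N$ with $\dot H_1\mathrel{\dot\preceq_{Q'}}\dot K_1\mathrel R\dot K_2\mathrel{\dot\preceq_{Q''}}\dot H_2$, $(1+k_1)\mathrel Qk_2$, $\dot G_1'\to^{k_1}\dot H_1$ and $\dot G_2\to^{k_2}\dot H_2$. **Proposition.** Suppose that the universal abstract machine $\mathcal U(\mathbb O,B_{\mathbb O})$ is deterministic and refocusing. Let $\mathbb C$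 be a set of contexts that is closed under plugging (if $\mathcal C,\mathcal C'\in\mathbb C$ and replacing one hole of $\mathcal C$ by $\mathcal C'$ is defined, the result is in $\mathbb C$), let $(Q,Q',Q'')$ be a reasonable triple, and let $\vartriangleleft$ be a pre-template. 1. If $\vartriangleleft$ is a $(\mathbb C,Q,Q')$-template and $(\mathbb C,Q,Q',Q'')$-robust relative to all rewrite transitions, then $\overline{\vartriangleleft}^{\mathbb C}$ is a $(Q,Q',Q'')$-simulation. 2. If $\vartriangleleft$ is a $(\mathbb C,Q^{-1},Q')$-template and the converse $\vartriangleleft^{-1}$ is $(\mathbb C,Q,Q',Q'')$-robust relative to all rewrite transitions, then $\overline{\vartriangleleft^{-1}}^{\mathbb C}$ is a $(Q,Q',Q'')$-simulation. -/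

import Mathlib

universe u w

namespace Spartan

/-! ### Labels -/

/-- Vertex labels: `star` is `⋆`, `diamond` is `⋄`, and `thunk n` is `T^n(⋆)`. -/
inductive VLab : Type
  | star
  | diamond
  | thunk (n : ℕ)

/-- The two vertex labels that contractions and weakenings exist for. -/
inductive CLab : Type
  | star
  | diamond

/-- A contraction type as a vertex label. -/
def CLab.toV : CLab → VLab
  | .star => .star
  | .diamond => .diamond

/-- Token labels: search `?`, value `✓`, rewrite `⚡`. -/
inductive Tok : Type
  | search
  | value
  | rewrite

/-- A set of operations, each with its arity (number of eager arguments; list of the numbers of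
variables bound by the deferred arguments), partitioned into active and passive operations. -/
structure OpSet where
  Op : Type u
  eager : Op → ℕ
  deferred : Op → List ℕ
  active : Op → Bool

/-- Hole labels are typed; there are countably many of each type. -/
structure HoleLab where
  name : ℕ
  dom : List VLab
  cod : List VLab

/-! ### Hypergraphs and hypernets -/

/-- The data of an interfaced labelled monoidal hypergraph with edge labels in `M`. The axioms are
in `HGraph.Proper`. -/
structure HGraph (M : Type w) where
  V : Type
  E : Type
  vertexLabel : V → VLab
  edgeLabel : E → M
  src : E → List V
  tgt : E → List V
  ins : List V
  outs : List V

/-- Edge labels. A label `box b k h G` is the hypernet `G : ⋆ ⇒ ⋆^(b+k) ⊗ ⋄^h`, used as a box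
label of type `T^b(⋆) ⇒ ⋆^k ⊗ ⋄^h`. As an inductive type, it allows nesting to any finite depth. -/
inductive Lab (𝕆 : OpSet.{u}) : Type (max 1 u)
  | op (φ : 𝕆.Op)
  | inst
  | atom
  | weak (l : CLab)
  | contr (l : CLab)
  | token (t : Tok)
  | hole (χ : HoleLab)
  | box (b k h : ℕ) (G : HGraph (Lab 𝕆))

/-- Raw (possibly holed) hypernets: nested hypergraphs. -/
abbrev Net (𝕆 : OpSet.{u}) := HGraph (Lab 𝕆)

variable {𝕆 : OpSet.{u}}

/-- The type of the targets of an operation edge. -/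
def OpSet.cod (𝕆 : OpSet.{u}) (φ : 𝕆.Op) : List VLab :=
  List.replicate (𝕆.eager φ) .star ++ (𝕆.deferred φ).map .thunk

/-- Source type of an edge label. -/
def Lab.dom : Lab 𝕆 → List VLab
  | .op _ => [.star]
  | .inst => [.star]
  | .atom => [.diamond]
  | .weak _ => []
  | .contr l => [l.toV, l.toV]
  | .token _ => [.star]
  | .hole χ => χ.dom
  | .box b _ _ _ => [.thunk b]

/-- Target type of an edge label. -/
def Lab.cod : Lab 𝕆 → List VLab
  | .op φ => 𝕆.cod φ
  | .inst => [.diamond]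
  | .atom => [.star]
  | .weak l => [l.toV]
  | .contr l => [l.toV]
  | .token _ => [.star]
  | .hole χ => χ.cod
  | .box _ k h _ => List.replicate k .star ++ List.replicate h .diamond

/-- `G : I ⇒ O`. -/
def HGraph.HasType {M : Type w} (G : HGraph M) (I O : List VLab) : Prop :=
  G.ins.map G.vertexLabel = I ∧ G.outs.map G.vertexLabel = O

/-- The axioms of an interfaced labelled monoidal hypergraph (at the outermost level). -/
structure HGraph.Proper (G : Net 𝕆) : Prop where
  finite_V : Finite G.V
  finite_E : Finite G.E
  src_nodup : ∀ e, (G.src e).Nodup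
  tgt_nodup : ∀ e, (G.tgt e).Nodup
  src_unique : ∀ v e e', v ∈ G.src e → v ∈ G.src e' → e = e'
  tgt_unique : ∀ v e e', v ∈ G.tgt e → v ∈ G.tgt e' → e = e'
  src_typed : ∀ e, (G.src e).map G.vertexLabel = (G.edgeLabel e).dom
  tgt_typed : ∀ e, (G.tgt e).map G.vertexLabel = (G.edgeLabel e).cod
  ins_nodup : G.ins.Nodup
  outs_nodup : G.outs.Nodup
  mem_ins : ∀ v, v ∈ G.ins ↔ ∀ e, v ∉ G.tgt e
  mem_outs : ∀ v, v ∈ G.outs ↔ ∀ e, v ∉ G.src e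
  ins_outs : ∀ v, v ∈ G.ins → v ∉ G.outs

/-- A label is well formed if the content of a box is recursively a well-formed hypernet of the
right type. -/
inductive Lab.WF : Lab 𝕆 → Prop
  | op (φ : 𝕆.Op) : Lab.WF (.op φ)
  | inst : Lab.WF .inst
  | atom : Lab.WF .atom
  | weak (l : CLab) : Lab.WF (.weak l)
  | contr (l : CLab) : Lab.WF (.contr l)
  | token (t : Tok) : Lab.WF (.token t)
  | hole (χ : HoleLab) : Lab.WF (.hole χ)
  | box (b k h : ℕ) (G : Net 𝕆) (proper : G.Proper)
      (type : G.HasType [.star]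
        (List.replicate (b + k) .star ++ List.replicate h .diamond))
      (deep : ∀ e, Lab.WF (G.edgeLabel e)) : Lab.WF (.box b k h G)

/-- Well-formed hypernets, possibly with holes: the elements of `H_ω(L, M_𝕆 ∪ 𝕄)`. -/
def HGraph.WF (G : Net 𝕆) : Prop :=
  G.Proper ∧ ∀ e, (G.edgeLabel e).WF

/-- Occurrences, at any depth, of labels satisfying `P` in a label. -/
inductive Lab.Occ (P : Lab 𝕆 → Prop) : Lab 𝕆 → Type (max 1 u)
  | here {l : Lab 𝕆} (h : P l) : Lab.Occ P l
  | deep {b k h : ℕ} {G : Net 𝕆} (e : G.E) (o : Lab.Occ P (G.edgeLabel e)) :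
      Lab.Occ P (.box b k h G)

/-- Edges of `G`, at any depth, whose label satisfies `P`. -/
def HGraph.Occ (P : Lab 𝕆 → Prop) (G : Net 𝕆) : Type (max 1 u) :=
  Σ e : G.E, (G.edgeLabel e).Occ P

/-- Token labels. -/
def Lab.IsToken (l : Lab 𝕆) : Prop := ∃ t, l = .token t

/-- Hole labels. -/
def Lab.IsHole (l : Lab 𝕆) : Prop := ∃ χ, l = .hole χ

/-- Operation labels. -/
def Lab.IsOp (l : Lab 𝕆) : Prop := ∃ φ, l = .op φ

/-- No token edge at any depth. -/
def HGraph.FocusFree (G : Net 𝕆) : Prop := IsEmpty (G.Occ Lab.IsToken)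

/-- No hole edge at any depth. -/
def HGraph.HoleFree (G : Net 𝕆) : Prop := IsEmpty (G.Occ Lab.IsHole)

/-- The hole label `χ` appears in `G`, at some depth. -/
def HGraph.HasHole (G : Net 𝕆) (χ : HoleLab) : Prop := Nonempty (G.Occ (· = .hole χ))

/-- A context is a holed hypernet in which each hole label appears at most once, at any depth. -/
def HGraph.IsContext (G : Net 𝕆) : Prop :=
  G.WF ∧ ∀ χ, Subsingleton (G.Occ (· = .hole χ))

/-- `w` is a target, and `v` a source, of the same edge, whose label satisfies `P`. -/
def HGraph.Adj (P : Lab 𝕆 → Prop) (G : Net 𝕆) (v w : G.V) : Prop :=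
  ∃ e, P (G.edgeLabel e) ∧ v ∈ G.src e ∧ w ∈ G.tgt e

/-- Reachability along (possibly empty) paths. -/
def HGraph.Reachable (G : Net 𝕆) : G.V → G.V → Prop :=
  Relation.ReflTransGen (G.Adj fun _ => True)

/-- There is an operation path (a non-empty path, all of whose edges are operations). -/
def HGraph.OpPath (G : Net 𝕆) : G.V → G.V → Prop :=
  Relation.TransGen (G.Adj Lab.IsOp)

/-- One-way hypernets: no operation path from an input to an output, both of type `⋆`. -/
def HGraph.OneWay (G : Net 𝕆) : Prop :=
  ∀ v ∈ G.ins, ∀ w ∈ G.outs, G.vertexLabel v = .star → G.vertexLabel w = .star → ¬ G.OpPath v w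

/-! ### Isomorphism; hypernets as isomorphism classes -/

/-- Isomorphisms of hypergraphs, disregarding edge labels. -/
structure HGraph.ShapeIso {M : Type w} (G G' : HGraph M) where
  onV : G.V ≃ G'.V
  onE : G.E ≃ G'.E
  vertexLabel : ∀ v, G'.vertexLabel (onV v) = G.vertexLabel v
  src : ∀ e, G'.src (onE e) = (G.src e).map onV
  tgt : ∀ e, G'.tgt (onE e) = (G.tgt e).map onV
  ins : G'.ins = G.ins.map onV
  outs : G'.outs = G.outs.map onV

/-- Labels are identified up to isomorphism of the contents of boxes. -/
inductive Lab.Iso : Lab 𝕆 → Lab 𝕆 → Prop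
  | refl (l : Lab 𝕆) : Lab.Iso l l
  | box {b k h : ℕ} {G G' : Net 𝕆} (i : G.ShapeIso G')
      (deep : ∀ e, Lab.Iso (G.edgeLabel e) (G'.edgeLabel (i.onE e))) :
      Lab.Iso (.box b k h G) (.box b k h G')

/-- Isomorphism of hypernets. -/
def HGraph.Iso (G G' : Net 𝕆) : Prop :=
  ∃ i : G.ShapeIso G', ∀ e, (G.edgeLabel e).Iso (G'.edgeLabel (i.onE e))

/-- The identity. -/
def HGraph.ShapeIso.refl {M : Type w} (G : HGraph M) : G.ShapeIso G where
  onV := Equiv.refl _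
  onE := Equiv.refl _
  vertexLabel _ := rfl
  src e := by simp
  tgt e := by simp
  ins := by simp
  outs := by simp

/-- The inverse. -/
def HGraph.ShapeIso.symm {M : Type w} {G G' : HGraph M} (i : G.ShapeIso G') : G'.ShapeIso G where
  onV := i.onV.symm
  onE := i.onE.symm
  vertexLabel v := by simpa using (i.vertexLabel (i.onV.symm v)).symm
  src e := by
    have h := i.src (i.onE.symm e)
    rw [Equiv.apply_symm_apply] at h
    simp [h]
  tgt e := by
    have h := i.tgt (i.onE.symm e)
    rw [Equiv.apply_symm_apply] at h
    simp [h]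
  ins := by simp [i.ins]
  outs := by simp [i.outs]

/-- The composite. -/
def HGraph.ShapeIso.trans {M : Type w} {G G' G'' : HGraph M} (i : G.ShapeIso G')
    (j : G'.ShapeIso G'') : G.ShapeIso G'' where
  onV := i.onV.trans j.onV
  onE := i.onE.trans j.onE
  vertexLabel v := by simp [j.vertexLabel, i.vertexLabel]
  src e := by simp [j.src, i.src]
  tgt e := by simp [j.tgt, i.tgt]
  ins := by simp [j.ins, i.ins]
  outs := by simp [j.outs, i.outs]

theorem Lab.Iso.symm {l l' : Lab 𝕆} (h : l.Iso l') : l'.Iso l := by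
  induction h with
  | refl l => exact .refl l
  | @box b k h G G' i _ ih =>
    refine .box i.symm fun e => ?_
    have := ih (i.onE.symm e)
    rw [Equiv.apply_symm_apply] at this
    exact this

theorem Lab.Iso.trans {l l' l'' : Lab 𝕆} (h : l.Iso l') (h' : l'.Iso l'') : l.Iso l'' := by
  induction h generalizing l'' with
  | refl l => exact h'
  | box i deep ih =>
    cases h' with
    | refl => exact .box i deep
    | box j deep' => exact .box (i.trans j) fun e => ih e (deep' (i.onE e))

instance netSetoid (𝕆 : OpSet.{u}) : Setoid (Net 𝕆) where
  r := HGraph.Iso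
  iseqv :=
    { refl := fun G => ⟨.refl G, fun _ => .refl _⟩
      symm := by
        rintro G G' ⟨i, h⟩
        refine ⟨i.symm, fun e => ?_⟩
        have := (h (i.onE.symm e)).symm
        rw [Equiv.apply_symm_apply] at this
        exact this
      trans := by
        rintro G G' G'' ⟨i, h⟩ ⟨j, h'⟩
        exact ⟨i.trans j, fun e => (h e).trans (h' (i.onE e))⟩ }

/-- (Raw) hypernets up to isomorphism. -/
abbrev Hypernet (𝕆 : OpSet.{u}) := Quotient (netSetoid 𝕆)

/-- The isomorphism class of a net. -/
abbrev HGraph.cls (G : Net 𝕆) : Hypernet 𝕆 := Quotient.mk (netSetoid 𝕆) G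

/-! ### Plugging -/

section Plugging

open Classical in
/-- The vertex of `G` that a vertex `v` of `H` is identified with when `H` replaces an edge of `G`
with source list `s` and target list `t`: the `i`-th input (resp. output) of `H` is identified
with the `i`-th source (resp. target), other vertices are kept apart. -/
noncomputable def HGraph.glue {M : Type w} {V : Type} (H : HGraph M) (s t : List V) (v : H.V) :
    Option V :=
  if v ∈ H.ins then s[H.ins.idxOf v]?
  else if v ∈ H.outs then t[H.outs.idxOf v]?
  else none

/-- The edges of `G` that are replaced according to `p`. -/
abbrev HGraph.Slot {M : Type w} (G : HGraph M) (p : G.E → Option (HGraph M)) : Type :=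
  { e : G.E // (p e).isSome }

/-- The hypergraph that replaces an edge. -/
abbrev HGraph.Slot.net {M : Type w} {G : HGraph M} {p : G.E → Option (HGraph M)} (x : G.Slot p) :
    HGraph M :=
  (p x.1).get x.2

/-- The vertices after the replacement of edges according to `p`. -/
abbrev HGraph.PlugV {M : Type w} (G : HGraph M) (p : G.E → Option (HGraph M)) : Type :=
  G.V ⊕ Σ x : G.Slot p, { v : x.net.V // x.net.glue (G.src x.1) (G.tgt x.1) v = none }

/-- Where a vertex of a replacing hypergraph goes. -/
noncomputable def HGraph.plugMap {M : Type w} (G : HGraph M) (p : G.E → Option (HGraph M))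
    (x : G.Slot p) (v : x.net.V) : G.PlugV p :=
  match h : x.net.glue (G.src x.1) (G.tgt x.1) v with
  | some a => .inl a
  | none => .inr ⟨x, v, h⟩

/-- Replace simultaneously each edge `e` of `G` with `p e = some H` by the hypergraph `H`,
identifying the inputs (outputs) of `H` with the sources (targets) of `e`. -/
noncomputable def HGraph.plug {M : Type w} (G : HGraph M) (p : G.E → Option (HGraph M)) :
    HGraph M where
  V := G.PlugV p
  E := { e : G.E // p e = none } ⊕ Σ x : G.Slot p, x.net.E
  vertexLabel := Sum.elim G.vertexLabel fun y => y.1.net.vertexLabel y.2.1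
  edgeLabel := Sum.elim (fun e => G.edgeLabel e.1) fun y => y.1.net.edgeLabel y.2
  src := Sum.elim (fun e => (G.src e.1).map .inl) fun y => (y.1.net.src y.2).map (G.plugMap p y.1)
  tgt := Sum.elim (fun e => (G.tgt e.1).map .inl) fun y => (y.1.net.tgt y.2).map (G.plugMap p y.1)
  ins := G.ins.map .inl
  outs := G.outs.map .inl

/-- What replaces an edge with a given label: holes in the domain of `σ` are replaced. -/
def Lab.slot (σ : HoleLab → Option (Net 𝕆)) : Lab 𝕆 → Option (Net 𝕆)
  | .hole χ => σ χ
  | _ => none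

/-- Plugging inside a label, i.e. inside the content of a box, at any depth. -/
noncomputable def Lab.fill (σ : HoleLab → Option (Net 𝕆)) : Lab 𝕆 → Lab 𝕆
  | .box b k h ⟨V, E, vl, el, s, t, i, o⟩ =>
    .box b k h (HGraph.plug ⟨V, E, vl, fun e => Lab.fill σ (el e), s, t, i, o⟩
      fun e => (el e).slot σ)
  | l => l

/-- Plugging: replace simultaneously each hole `χ` of `C`, at any depth, by `σ χ` (if defined). -/
noncomputable def HGraph.fill (C : Net 𝕆) (σ : HoleLab → Option (Net 𝕆)) : Net 𝕆 :=
  HGraph.plug { C with edgeLabel := fun e => (C.edgeLabel e).fill σ }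
    fun e => (C.edgeLabel e).slot σ

end Plugging

/-! ### Tokens, focussed hypernets and states -/

/-- The unique token edge of a focussed (possibly holed) hypernet: it is shallow, self-acyclic and
not exposed. Its label is `lab`, its source `s`, its target `t`. -/
structure Token (G : Net 𝕆) where
  edge : G.E
  lab : Tok
  s : G.V
  t : G.V
  edgeLabel_eq : G.edgeLabel edge = .token lab
  src_eq : G.src edge = [s]
  tgt_eq : G.tgt edge = [t]
  unique : ∀ e, e ≠ edge → IsEmpty ((G.edgeLabel e).Occ Lab.IsToken)
  acyclic : s ≠ t
  not_exposed : ¬ (s ∈ G.ins ∧ t ∈ G.outs)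

open Classical in
/-- Identify the target of the token with its source. -/
noncomputable def Token.merge {G : Net 𝕆} (τ : Token G) (v : G.V) : { v : G.V // v ≠ τ.t } :=
  if h : v = τ.t then ⟨τ.s, τ.acyclic⟩ else ⟨v, h⟩

/-- The underlying focus-free hypernet `|G|`: remove the token edge, and identify its source and
target. -/
noncomputable def Token.underlying {G : Net 𝕆} (τ : Token G) : Net 𝕆 where
  V := { v : G.V // v ≠ τ.t }
  E := { e : G.E // e ≠ τ.edge }
  vertexLabel v := G.vertexLabel v.1
  edgeLabel e := G.edgeLabel e.1
  src e := (G.src e.1).map τ.merge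
  tgt e := (G.tgt e.1).map τ.merge
  ins := G.ins.map τ.merge
  outs := G.outs.map τ.merge

/-- The token is an incoming edge of a hole. -/
def Token.Entering {G : Net 𝕆} (τ : Token G) : Prop :=
  ∃ e, (G.edgeLabel e).IsHole ∧ τ.t ∈ G.src e

/-- The token is a search token, a value token, or not entering. -/
def Token.Remote {G : Net 𝕆} (τ : Token G) : Prop :=
  τ.lab = .search ∨ τ.lab = .value ∨ ¬ τ.Entering

/-- `t ; G`: connect a `t`-token to the first input of `G`. -/
def HGraph.attach (t : Tok) (G : Net 𝕆) : Net 𝕆 where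
  V := Option G.V
  E := Option G.E
  vertexLabel v := v.elim .star G.vertexLabel
  edgeLabel e := e.elim (.token t) G.edgeLabel
  src e := e.elim [none] fun e => (G.src e).map some
  tgt e := e.elim (G.ins.head?.toList.map some) fun e => (G.tgt e).map some
  ins := none :: G.ins.tail.map some
  outs := G.outs.map some

/-- States: focussed hypernets (without holes) of type `⋆ ⇒ ε`. -/
def IsState (N : Hypernet 𝕆) : Prop :=
  ∃ G : Net 𝕆, G.cls = N ∧ G.WF ∧ G.HoleFree ∧ Nonempty (Token G) ∧ G.HasType [.star] []

/-- The type of states. -/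
abbrev State (𝕆 : OpSet.{u}) := { N : Hypernet 𝕆 // IsState N }

/-- The token of the state `N` has label `t`. -/
def State.HasToken (t : Tok) (N : State 𝕆) : Prop :=
  ∃ (G : Net 𝕆) (τ : Token G), G.cls = N.1 ∧ τ.lab = t

/-- `M = t ; |N|`. -/
def State.IsRestart (t : Tok) (N M : State 𝕆) : Prop :=
  ∃ (G : Net 𝕆) (τ : Token G), G.cls = N.1 ∧ M.1 = (HGraph.attach t τ.underlying).cls

/-- Final states: `N = ✓ ; |N|`. -/
def State.IsFinal (N : State 𝕆) : Prop := State.IsRestart .value N N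

/-! ### Interaction rules and search transitions -/

/-- The vertices of the interaction rules: the input `a`, an internal vertex `b`, and the other
interface vertices. -/
inductive RuleV (n : ℕ) : Type
  | a
  | b
  | y (i : Fin n)

/-- The edges of the interaction rules: the token, and the edge that it interacts with. -/
inductive RuleE : Type
  | tok
  | act

/-- A `t`-token followed by an operation edge. -/
def tokOp (φ : 𝕆.Op) (t : Tok) : Net 𝕆 where
  V := RuleV (𝕆.cod φ).length
  E := RuleE
  vertexLabel
    | .y i => (𝕆.cod φ).get i
    | _ => .star
  edgeLabel
    | .tok => .token t
    | .act => .op φ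
  src
    | .tok => [.a]
    | .act => [.b]
  tgt
    | .tok => [.b]
    | .act => (List.finRange _).map .y
  ins := [.a]
  outs := (List.finRange _).map .y

/-- An operation edge, with a `t`-token connected to its target number `j` (counted from `0`). -/
def opTok (φ : 𝕆.Op) (j : Fin (𝕆.cod φ).length) (t : Tok) : Net 𝕆 where
  V := RuleV (𝕆.cod φ).length
  E := RuleE
  vertexLabel
    | .y i => (𝕆.cod φ).get i
    | _ => .star
  edgeLabel
    | .tok => .token t
    | .act => .op φ
  src
    | .tok => [.b]
    | .act => [.a]
  tgt
    | .tok => [.y j]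
    | .act => (List.finRange _).map fun i => if i = j then .b else .y i
  ins := [.a]
  outs := (List.finRange _).map .y

/-- A `t`-token followed by a contraction edge of type `⋆`, entered from the left (`left = true`)
or from the right. -/
def tokContr (left : Bool) (t : Tok) : Net 𝕆 where
  V := RuleV 2
  E := RuleE
  vertexLabel _ := .star
  edgeLabel
    | .tok => .token t
    | .act => .contr .star
  src
    | .tok => [.a]
    | .act => if left then [.b, .y 0] else [.y 0, .b]
  tgt
    | .tok => [.b]
    | .act => [.y 1]
  ins := if left then [.a, .y 0] else [.y 0, .a]
  outs := [.y 1]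

/-- A `t`-token followed by an instance edge. -/
def tokInst (t : Tok) : Net 𝕆 where
  V := RuleV 1
  E := RuleE
  vertexLabel
    | .y _ => .diamond
    | _ => .star
  edgeLabel
    | .tok => .token t
    | .act => .inst
  src
    | .tok => [.a]
    | .act => [.b]
  tgt
    | .tok => [.b]
    | .act => [.y 0]
  ins := [.a]
  outs := [.y 0]

/-- The token that results from the evaluation of all eager arguments of an operation. -/
def OpSet.result (𝕆 : OpSet.{u}) (φ : 𝕆.Op) : Tok :=
  if 𝕆.active φ then .rewrite else .value

/-- The interaction rules. -/
inductive Interaction : Net 𝕆 → Net 𝕆 → Prop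
  | contr (left : Bool) : Interaction (tokContr left .search) (tokContr left .rewrite)
  | inst : Interaction (tokInst .search) (tokInst .value)
  | first (φ : 𝕆.Op) (j : Fin (𝕆.cod φ).length) (h0 : j.val = 0) (h : 0 < 𝕆.eager φ) :
      Interaction (tokOp φ .search) (opTok φ j .search)
  | next (φ : 𝕆.Op) (j j' : Fin (𝕆.cod φ).length) (h : j'.val = j.val + 1)
      (h' : j'.val < 𝕆.eager φ) :
      Interaction (opTok φ j .value) (opTok φ j' .search)
  | last (φ : 𝕆.Op) (j : Fin (𝕆.cod φ).length) (h : j.val + 1 = 𝕆.eager φ) :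
      Interaction (opTok φ j .value) (tokOp φ (𝕆.result φ))
  | nullary (φ : 𝕆.Op) (h : 𝕆.eager φ = 0) :
      Interaction (tokOp φ .search) (tokOp φ (𝕆.result φ))

/-- Simple contexts: the single hole (at any depth) is the shallow edge `e`, labelled by `χ`. -/
structure IsSimpleContext (C : Net 𝕆) (e : C.E) (χ : HoleLab) : Prop where
  isContext : C.IsContext
  edgeLabel_eq : C.edgeLabel e = .hole χ
  single : Subsingleton (C.Occ Lab.IsHole)

/-- The transitions given by a set `r` of local rules: `C[G] → C[G']` for each rule `G ↦ G'` and
each focus-free simple context `C : ⋆ ⇒ ε` such that `C[G]` and `C[G']` are states. -/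
def LocalStep (r : Net 𝕆 → Net 𝕆 → Prop) (N N' : State 𝕆) : Prop :=
  ∃ (G G' C : Net 𝕆) (e : C.E) (χ : HoleLab), r G G' ∧ IsSimpleContext C e χ ∧
    C.FocusFree ∧ C.HasType [.star] [] ∧ G.HasType χ.dom χ.cod ∧ G'.HasType χ.dom χ.cod ∧
    N.1 = (C.fill fun _ => some G).cls ∧ N'.1 = (C.fill fun _ => some G').cls

/-- Search transitions. -/
def SearchStep : State 𝕆 → State 𝕆 → Prop := LocalStep Interaction

/-- Rooted states: `? ; |N| →* N` by search transitions. -/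
def State.Rooted (N : State 𝕆) : Prop :=
  ∃ M, State.IsRestart .search N M ∧ Relation.ReflTransGen SearchStep M N

/-! ### Contraction rules and copy transitions -/

/-- Contraction trees `C : ℓ^k ⇒ ℓ`. -/
structure IsContractionTree (l : CLab) (k : ℕ) (C : Net 𝕆) : Prop where
  wf : C.WF
  vertexLabel_eq : ∀ v, C.vertexLabel v = l.toV
  edgeLabel_eq : ∀ e, C.edgeLabel e = .weak l ∨ C.edgeLabel e = .contr l
  type : C.HasType (List.replicate k l.toV) [l.toV]
  reachable : ∀ v, ∀ o ∈ C.outs, C.Reachable v o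

/-- Vertices of a distributor: the leaf number `i` of the tree number `j`, and the node number `i`
on the spine of the tree number `j`; the node number `0` is the root. -/
inductive DistV (k m : ℕ) : Type
  | leaf (j : Fin k) (i : Fin m)
  | node (j : Fin k) (i : Fin (m + 1))

/-- Edges of a distributor: each tree has `m` contractions and one weakening. -/
inductive DistE (k m : ℕ) : Type
  | contr (j : Fin k) (i : Fin m)
  | weak (j : Fin k)

/-- The distributor `D_{k,m} : ℓ^(km) ⇒ ℓ^k`: a family of `k` contraction trees with `m` leaves and
one weakening each. The inputs are `m` bunches of `k`; the element number `j` of each bunch belongs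
to the tree number `j`. -/
def distributor (l : CLab) (k m : ℕ) : Net 𝕆 where
  V := DistV k m
  E := DistE k m
  vertexLabel _ := l.toV
  edgeLabel
    | .contr _ _ => .contr l
    | .weak _ => .weak l
  src
    | .contr j i => [.leaf j i, .node j i.succ]
    | .weak _ => []
  tgt
    | .contr j i => [.node j i.castSucc]
    | .weak j => [.node j (Fin.last m)]
  ins := (List.finRange m).flatMap fun i => (List.finRange k).map fun j => .leaf j i
  outs := (List.finRange k).map fun j => .node j 0

/-- A single instance edge. -/
def instNet : Net 𝕆 where
  V := Bool
  E := Unit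
  vertexLabel v := if v then .diamond else .star
  edgeLabel _ := .inst
  src _ := [false]
  tgt _ := [true]
  ins := [false]
  outs := [true]

/-- Vertices of a copyable hypernet that consists of an operation edge with `m` eager and `d`
deferred arguments, and a box for each deferred argument. -/
inductive BoxedV (m d : ℕ) (k h : Fin d → ℕ) : Type
  | root
  | eager (i : Fin m)
  | thunk (i : Fin d)
  | boxS (i : Fin d) (j : Fin (k i))
  | boxD (i : Fin d) (j : Fin (h i))

/-- An operation edge, each of whose deferred arguments is a box; the box number `i` has content
`B i` and type `T^(n_i)(⋆) ⇒ ⋆^(k i) ⊗ ⋄^(h i)`. The outputs of type `⋆` come first. -/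
def boxedOp (φ : 𝕆.Op) (k h : Fin (𝕆.deferred φ).length → ℕ)
    (B : Fin (𝕆.deferred φ).length → Net 𝕆) : Net 𝕆 where
  V := BoxedV (𝕆.eager φ) (𝕆.deferred φ).length k h
  E := Option (Fin (𝕆.deferred φ).length)
  vertexLabel
    | .root => .star
    | .eager _ => .star
    | .thunk i => .thunk ((𝕆.deferred φ).get i)
    | .boxS _ _ => .star
    | .boxD _ _ => .diamond
  edgeLabel
    | none => .op φ
    | some i => .box ((𝕆.deferred φ).get i) (k i) (h i) (B i)
  src
    | none => [.root]
    | some i => [.thunk i]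
  tgt
    | none => (List.finRange _).map .eager ++ (List.finRange _).map .thunk
    | some i => (List.finRange _).map (.boxS i) ++ (List.finRange _).map (.boxD i)
  ins := [.root]
  outs := (List.finRange _).map .eager
    ++ ((List.finRange _).flatMap fun i => (List.finRange _).map (.boxS i))
    ++ ((List.finRange _).flatMap fun i => (List.finRange _).map (.boxD i))

/-- Copyable hypernets `H : ⋆ ⇒ ⋆^p ⊗ ⋄^q`. -/
inductive IsCopyable : Net 𝕆 → Prop
  | inst : IsCopyable instNet
  | op (φ : 𝕆.Op) (k h : Fin (𝕆.deferred φ).length → ℕ)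
      (B : Fin (𝕆.deferred φ).length → Net 𝕆) : IsCopyable (boxedOp φ k h B)

/-- Vertices of the left-hand side of a contraction rule. -/
inductive CopyLV (n p q : ℕ) : Type
  | tokS
  | tokT
  | root
  | inp (i : Fin n)
  | outS (i : Fin p)
  | outD (i : Fin q)

/-- Edges of the left-hand side of a contraction rule, before plugging. -/
inductive CopyLE : Type
  | tok
  | tree
  | body

/-- Left-hand side of a contraction rule: a rewrite token on the first input of the contraction
tree `C`, whose output is the input of the copyable hypernet `H : ⋆ ⇒ ⋆^p ⊗ ⋄^q`. -/
noncomputable def copyLhs (n p q : ℕ) (C H : Net 𝕆) : Net 𝕆 :=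
  HGraph.plug (M := Lab 𝕆)
    { V := CopyLV n p q
      E := CopyLE
      vertexLabel
        | .outD _ => .diamond
        | _ => .star
      edgeLabel _ := .token .rewrite
      src
        | .tok => [.tokS]
        | .tree => .tokT :: (List.finRange n).map .inp
        | .body => [.root]
      tgt
        | .tok => [.tokT]
        | .tree => [.root]
        | .body => (List.finRange p).map .outS ++ (List.finRange q).map .outD
      ins := .tokS :: (List.finRange n).map .inp
      outs := (List.finRange p).map .outS ++ (List.finRange q).map .outD }
    fun
      | .tok => none
      | .tree => some C
      | .body => some H

/-- Vertices of the right-hand side of a contraction rule. -/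
inductive CopyRV (n p q : ℕ) : Type
  | tokS
  | tokT
  | weak
  | root
  | inp (i : Fin n)
  | copyS (second : Bool) (i : Fin p)
  | copyD (second : Bool) (i : Fin q)
  | outS (i : Fin p)
  | outD (i : Fin q)

/-- Edges of the right-hand side of a contraction rule, before plugging. -/
inductive CopyRE : Type
  | tok
  | weak
  | tree
  | body (second : Bool)
  | distS
  | distD

/-- Right-hand side of a contraction rule: a search token on the input of a first copy of `H`; the
first input of the contraction tree `C` is the target of a weakening, and its output is the input
of a second copy of `H`; the outputs of the two copies are merged by distributors. -/
noncomputable def copyRhs (n p q : ℕ) (C H : Net 𝕆) : Net 𝕆 :=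
  HGraph.plug (M := Lab 𝕆)
    { V := CopyRV n p q
      E := CopyRE
      vertexLabel
        | .copyD _ _ => .diamond
        | .outD _ => .diamond
        | _ => .star
      edgeLabel
        | .weak => .weak .star
        | _ => .token .search
      src
        | .tok => [.tokS]
        | .weak => []
        | .tree => .weak :: (List.finRange n).map .inp
        | .body false => [.tokT]
        | .body true => [.root]
        | .distS =>
          (List.finRange p).map (.copyS false) ++ (List.finRange p).map (.copyS true)
        | .distD =>
          (List.finRange q).map (.copyD false) ++ (List.finRange q).map (.copyD true)
      tgt
        | .tok => [.tokT]
        | .weak => [.weak]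
        | .tree => [.root]
        | .body c => (List.finRange p).map (.copyS c) ++ (List.finRange q).map (.copyD c)
        | .distS => (List.finRange p).map .outS
        | .distD => (List.finRange q).map .outD
      ins := .tokS :: (List.finRange n).map .inp
      outs := (List.finRange p).map .outS ++ (List.finRange q).map .outD }
    fun
      | .tok => none
      | .weak => none
      | .tree => some C
      | .body _ => some H
      | .distS => some (distributor .star p 2)
      | .distD => some (distributor .diamond q 2)

/-- The contraction rules. -/
inductive Contraction : Net 𝕆 → Net 𝕆 → Prop
  | mk (n p q : ℕ) (C H : Net 𝕆) (hC : IsContractionTree .star (n + 1) C) (hH : IsCopyable H)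
      (type : H.HasType [.star] (List.replicate p .star ++ List.replicate q .diamond)) :
      Contraction (copyLhs n p q C H) (copyRhs n p q C H)

/-- Copy transitions. -/
def CopyStep : State 𝕆 → State 𝕆 → Prop := LocalStep Contraction

/-! ### The universal abstract machine -/

/-- A behaviour of the operations: a set of compute transitions. Each of them goes from a state
with a rewrite token that is an incoming edge of an active operation edge, to a state with a search
token. -/
structure Behaviour (𝕆 : OpSet.{u}) where
  step : State 𝕆 → State 𝕆 → Prop
  source : ∀ N N', step N N' → ∃ (G : Net 𝕆) (τ : Token G) (e : G.E) (φ : 𝕆.Op),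
    G.cls = N.1 ∧ τ.lab = .rewrite ∧ τ.t ∈ G.src e ∧ G.edgeLabel e = .op φ ∧ 𝕆.active φ = true
  target : ∀ N N', step N N' → N'.HasToken .search

/-- Rewrite transitions: copy or compute transitions. -/
def RewriteStep (B : Behaviour 𝕆) (N N' : State 𝕆) : Prop := CopyStep N N' ∨ B.step N N'

/-- Transitions of the machine. -/
def Step (B : Behaviour 𝕆) (N N' : State 𝕆) : Prop := SearchStep N N' ∨ RewriteStep B N N'

/-- `N →^k N'`. -/
def StepN (B : Behaviour 𝕆) : ℕ → State 𝕆 → State 𝕆 → Prop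
  | 0 => fun N N' => N = N'
  | k + 1 => fun N N' => ∃ M, Step B N M ∧ StepN B k M N'

/-- `N →* N'`. -/
def Steps (B : Behaviour 𝕆) (N N' : State 𝕆) : Prop := ∃ k, StepN B k N N'

/-- Stuck states: not final, and without transitions. -/
def State.IsStuck (B : Behaviour 𝕆) (N : State 𝕆) : Prop := ¬ N.IsFinal ∧ ∀ N', ¬ Step B N N'

/-- The machine is deterministic. -/
def Deterministic (B : Behaviour 𝕆) : Prop :=
  ∀ N N₁ N₂, Step B N N₁ → Step B N N₂ → N₁ = N₂

/-- The machine is refocusing: every transition preserves the rooted property. -/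
def Refocusing (B : Behaviour 𝕆) : Prop := ∀ N N', Step B N N' → N.Rooted → N'.Rooted

/-- State refinement up to `Q`. -/
def StateRefines (B : Behaviour 𝕆) (Q : ℕ → ℕ → Prop) (N₁ N₂ : State 𝕆) : Prop :=
  ∀ k₁ M₁, M₁.IsFinal → StepN B k₁ N₁ M₁ →
    ∃ k₂ M₂, M₂.IsFinal ∧ Q k₁ k₂ ∧ StepN B k₂ N₂ M₂

/-- State equivalence up to `Q`. -/
def StateEquiv (B : Behaviour 𝕆) (Q : ℕ → ℕ → Prop) (N₁ N₂ : State 𝕆) : Prop :=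
  StateRefines B Q N₁ N₂ ∧ StateRefines B Q N₂ N₁

/-! ### Sets of contexts, templates, robustness -/

/-- A set of contexts. -/
def IsContextSet (𝒞 : Set (Hypernet 𝕆)) : Prop := ∀ C : Net 𝕆, C.cls ∈ 𝒞 → C.IsContext

open Classical in
/-- Closure under plugging `C'` for a hole `χ` of `C`, whenever they have the same type, and no
hole label of `C'` is one of the other hole labels of `C`. -/
def ClosedUnderPlugging (𝒞 : Set (Hypernet 𝕆)) : Prop :=
  ∀ (C C' : Net 𝕆) (χ : HoleLab), C.cls ∈ 𝒞 → C'.cls ∈ 𝒞 → C.HasHole χ →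
    C'.HasType χ.dom χ.cod → (∀ χ', χ' ≠ χ → C.HasHole χ' → ¬ C'.HasHole χ') →
    (C.fill fun χ' => if χ' = χ then some C' else none).cls ∈ 𝒞

/-- Pre-templates: relations between focus-free hypernets (without holes) of the same type. -/
def IsPreTemplate (R : Hypernet 𝕆 → Hypernet 𝕆 → Prop) : Prop :=
  ∀ G₁ G₂ : Net 𝕆, R G₁.cls G₂.cls →
    (G₁.WF ∧ G₁.HoleFree ∧ G₁.FocusFree) ∧ (G₂.WF ∧ G₂.HoleFree ∧ G₂.FocusFree) ∧
      ∃ I O, G₁.HasType I O ∧ G₂.HasType I O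

/-- `𝒞`-specimens of `R`. Only the values of `H₁` and `H₂` at the hole labels that appear in the
focussed context `ctx` matter: they are the hypernets to be plugged. -/
structure Specimen (𝒞 : Set (Hypernet 𝕆)) (R : Hypernet 𝕆 → Hypernet 𝕆 → Prop) where
  ctx : Net 𝕆
  H₁ : HoleLab → Net 𝕆
  H₂ : HoleLab → Net 𝕆
  isContext : ctx.IsContext
  tok : Token ctx
  mem : tok.underlying.cls ∈ 𝒞
  type₁ : ∀ χ, ctx.HasHole χ → (H₁ χ).HasType χ.dom χ.cod
  type₂ : ∀ χ, ctx.HasHole χ → (H₂ χ).HasType χ.dom χ.cod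
  rel : ∀ χ, ctx.HasHole χ → R (H₁ χ).cls (H₂ χ).cls
  isState₁ : IsState (ctx.fill fun χ => some (H₁ χ)).cls
  isState₂ : IsState (ctx.fill fun χ => some (H₂ χ)).cls

/-- The state `C[H¹]` of a specimen. -/
noncomputable def Specimen.state₁ {𝒞 : Set (Hypernet 𝕆)} {R : Hypernet 𝕆 → Hypernet 𝕆 → Prop}
    (S : Specimen 𝒞 R) : State 𝕆 := ⟨_, S.isState₁⟩

/-- The state `C[H²]` of a specimen. -/
noncomputable def Specimen.state₂ {𝒞 : Set (Hypernet 𝕆)} {R : Hypernet 𝕆 → Hypernet 𝕆 → Prop}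
    (S : Specimen 𝒞 R) : State 𝕆 := ⟨_, S.isState₂⟩

/-- `(N₁, N₂)` is a quasi-`𝒞`-specimen of `R` up to `(A, A')`, whose token has label `t`. -/
def QuasiSpecimen (𝒞 : Set (Hypernet 𝕆)) (R : Hypernet 𝕆 → Hypernet 𝕆 → Prop)
    (A A' : State 𝕆 → State 𝕆 → Prop) (t : Tok) (N₁ N₂ : State 𝕆) : Prop :=
  ∃ S : Specimen 𝒞 R, S.tok.lab = t ∧ N₁.HasToken t ∧ N₂.HasToken t ∧
    (N₁.Rooted → N₂.Rooted →
      S.state₁.Rooted ∧ S.state₂.Rooted ∧ A N₁ S.state₁ ∧ A' S.state₂ N₂)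

/-- Input-safety. -/
def InputSafe (B : Behaviour 𝕆) (𝒞 : Set (Hypernet 𝕆)) (Q Q' : ℕ → ℕ → Prop)
    (R : Hypernet 𝕆 → Hypernet 𝕆 → Prop) : Prop :=
  ∀ S : Specimen 𝒞 R, S.tok.lab = .search → S.tok.Entering →
    (∃ N₁ N₂ : State 𝕆, N₁.IsStuck B ∧ N₂.IsStuck B ∧ Steps B S.state₁ N₁ ∧ Steps B S.state₂ N₂) ∨
    (∃ (S' : Specimen 𝒞 R) (k₁ k₂ : ℕ), S'.tok.lab ≠ .rewrite ∧ ¬ S'.tok.Entering ∧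
      Q (1 + k₁) k₂ ∧ StepN B (1 + k₁) S.state₁ S'.state₁ ∧ StepN B k₂ S.state₂ S'.state₂) ∨
    (∃ (N₁ N₂ : State 𝕆) (t : Tok) (k₁ k₂ : ℕ), t ≠ .rewrite ∧
      QuasiSpecimen 𝒞 R (StateEquiv B Q') (StateEquiv B Q') t N₁ N₂ ∧
      Q (1 + k₁) (1 + k₂) ∧ StepN B (1 + k₁) S.state₁ N₁ ∧ StepN B (1 + k₂) S.state₂ N₂)

/-- Output-closure. -/
def OutputClosed (R : Hypernet 𝕆 → Hypernet 𝕆 → Prop) : Prop :=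
  ∀ G₁ G₂ : Net 𝕆, R G₁.cls G₂.cls → G₁.OneWay ∨ G₂.OneWay

/-- `(𝒞, Q, Q')`-templates. -/
def IsTemplate (B : Behaviour 𝕆) (𝒞 : Set (Hypernet 𝕆)) (Q Q' : ℕ → ℕ → Prop)
    (R : Hypernet 𝕆 → Hypernet 𝕆 → Prop) : Prop :=
  InputSafe B 𝒞 Q Q' R ∧ OutputClosed R

/-- Robustness relative to the rewrite transition `N → N'`. -/
def RobustAt (B : Behaviour 𝕆) (𝒞 : Set (Hypernet 𝕆)) (Q Q' Q'' : ℕ → ℕ → Prop)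
    (R : Hypernet 𝕆 → Hypernet 𝕆 → Prop) (N N' : State 𝕆) : Prop :=
  ∀ S : Specimen 𝒞 R, S.state₁ = N → S.tok.lab = .rewrite → ¬ S.tok.Entering →
    (¬ S.state₁.Rooted ∨ ¬ S.state₂.Rooted) ∨
    (∃ M : State 𝕆, M.IsStuck B ∧ Steps B N' M) ∨
    (∃ (N₁ N₂ : State 𝕆) (t : Tok) (k₁ k₂ : ℕ), t ≠ .rewrite ∧
      QuasiSpecimen 𝒞 R (StateRefines B Q') (StateRefines B Q'') t N₁ N₂ ∧
      Q (1 + k₁) k₂ ∧ StepN B k₁ N' N₁ ∧ StepN B k₂ S.state₂ N₂)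

/-- Robustness relative to all rewrite transitions. -/
def Robust (B : Behaviour 𝕆) (𝒞 : Set (Hypernet 𝕆)) (Q Q' Q'' : ℕ → ℕ → Prop)
    (R : Hypernet 𝕆 → Hypernet 𝕆 → Prop) : Prop :=
  ∀ N N', RewriteStep B N N' → RobustAt B 𝒞 Q Q' Q'' R N N'

/-- Preorders on natural numbers. -/
def IsPreorderRel (Q : ℕ → ℕ → Prop) : Prop :=
  (∀ a, Q a a) ∧ ∀ a b c, Q a b → Q b c → Q a c

/-- Reasonable triples of preorders. -/
structure Reasonable (Q Q' Q'' : ℕ → ℕ → Prop) : Prop where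
  preorder : IsPreorderRel Q
  preorder' : IsPreorderRel Q'
  preorder'' : IsPreorderRel Q''
  add : ∀ a b a' b', Q a b → Q a' b' → Q (a + a') (b + b')
  le_ge : ∀ a b, Q' a b → a ≥ b
  le_snd : ∀ a b, Q' a b → Q'' a b
  comp : ∀ a b c d, Q' a b → Q b c → Q'' c d → Q a d

/-- `(Q, Q', Q'')`-simulations. -/
def IsSimulation (B : Behaviour 𝕆) (Q Q' Q'' : ℕ → ℕ → Prop)
    (R : State 𝕆 → State 𝕆 → Prop) : Prop :=
  ∀ G₁ G₂, R G₁ G₂ →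
    (G₁.IsFinal → G₂.IsFinal) ∧
    ∀ G₁', Step B G₁ G₁' →
      (∃ M : State 𝕆, M.IsStuck B ∧ Steps B G₁' M) ∨
      ∃ (H₁ H₂ : State 𝕆) (k₁ k₂ : ℕ),
        (∃ K₁ K₂, StateRefines B Q' H₁ K₁ ∧ R K₁ K₂ ∧ StateRefines B Q'' K₂ H₂) ∧
        Q (1 + k₁) k₂ ∧ StepN B k₁ G₁' H₁ ∧ StepN B k₂ G₂ H₂

/-- The `𝒞`-contextual lifting of `R`. -/
def Lifting (𝒞 : Set (Hypernet 𝕆)) (R : Hypernet 𝕆 → Hypernet 𝕆 → Prop) (G₁ G₂ : State 𝕆) : Prop :=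
  ∃ S : Specimen 𝒞 R, S.tok.Remote ∧ G₁ = S.state₁ ∧ G₂ = S.state₂ ∧
    S.state₁.Rooted ∧ S.state₂.Rooted

end Spartan

namespace Spartan

variable {𝕆 : OpSet.{u}}

/-! ### Invariance under isomorphism -/

/-! Up to isomorphism, a state is a focus-free net `W` with a marked vertex and a token label,
`W.insertToken v t`. The inserted edge is its only token, so this presentation is unique up to
isomorphisms of `W` (`HGraph.insertToken_cancel`). In these terms a search transition keeps `W`
fixed and moves the token across one edge of it (`SearchStep.exists_move`, with converse
`Move.searchStep`). Inserting a token commutes with plugging (`HGraph.fill_insertToken_iso`), so the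
two states of a specimen carry the token at the same vertex of the same context, and a move across
an edge of the context is made by both at once (`Specimen.exists_step`).

What matters is how the token can meet a hole. A value token could meet it from an output. But in a
rooted state an operation path joins the input of the net to the token (`State.Rooted.opPath`), and
a path that arrives at an output of a plugged net must have crossed it from one of its inputs
(`HGraph.not_oneWay_of_opPath`). If both states are rooted, neither plugged net is then one-way,
against output-closure. A search token could meet a hole from a source: this is the case that
input-safety describes. A rewrite token in the lifting is not entering, and its transitions are
those that robustness describes.

The rest is bookkeeping. Refocusing keeps rooted all states that are reached. Determinism identifies
the given first transition with the first transition of the runs that input-safety provides, so that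
`1 + k₁` steps become one step and `k₁` more. For the converse relation the two sides of the
template are exchanged; the run of the side to be simulated may then be empty, and the specimen that
has been reached makes the missing step itself, because its token does not enter a hole. -/

/-- Isomorphisms only alter the contents of boxes. Tokens, holes and operations are therefore rigid,
which is how they are tracked along isomorphisms below. -/
theorem Lab.Iso.eq_of_forall_ne_box {l l' : Lab 𝕆} (h : l.Iso l')
    (hl : ∀ b k h G, l ≠ .box b k h G) : l' = l := by
  cases h with
  | refl => rfl
  | box => exact absurd rfl (hl _ _ _ _)

theorem Lab.Iso.dom_eq {l l' : Lab 𝕆} (h : l.Iso l') : l'.dom = l.dom := by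
  cases h <;> rfl

theorem Lab.Iso.cod_eq {l l' : Lab 𝕆} (h : l.Iso l') : l'.cod = l.cod := by
  cases h <;> rfl

theorem HGraph.Proper.of_iso {G G' : Net 𝕆} (h : G.Proper) (i : G.ShapeIso G')
    (hi : ∀ e, (G.edgeLabel e).Iso (G'.edgeLabel (i.onE e))) : G'.Proper := by
  have hs : ∀ v e, i.onV v ∈ G'.src (i.onE e) ↔ v ∈ G.src e := fun v e => by
    rw [i.src, List.mem_map_of_injective i.onV.injective]
  have ht : ∀ v e, i.onV v ∈ G'.tgt (i.onE e) ↔ v ∈ G.tgt e := fun v e => by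
    rw [i.tgt, List.mem_map_of_injective i.onV.injective]
  have hin : ∀ v, i.onV v ∈ G'.ins ↔ v ∈ G.ins := fun v => by
    rw [i.ins, List.mem_map_of_injective i.onV.injective]
  have hout : ∀ v, i.onV v ∈ G'.outs ↔ v ∈ G.outs := fun v => by
    rw [i.outs, List.mem_map_of_injective i.onV.injective]
  have hlab : G'.vertexLabel ∘ i.onV = G.vertexLabel := funext i.vertexLabel
  have := h.finite_V
  have := h.finite_E
  refine ⟨Finite.of_equiv _ i.onV, Finite.of_equiv _ i.onE, ?_, ?_, ?_, ?_, ?_, ?_, ?_, ?_,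
    ?_, ?_, ?_⟩
  · simp only [i.onE.surjective.forall, i.src]
    exact fun e => (h.src_nodup e).map i.onV.injective
  · simp only [i.onE.surjective.forall, i.tgt]
    exact fun e => (h.tgt_nodup e).map i.onV.injective
  · simp only [i.onE.surjective.forall, i.onV.surjective.forall, hs]
    exact fun v e e' hv hv' => congrArg _ (h.src_unique v e e' hv hv')
  · simp only [i.onE.surjective.forall, i.onV.surjective.forall, ht]
    exact fun v e e' hv hv' => congrArg _ (h.tgt_unique v e e' hv hv')
  · simp only [i.onE.surjective.forall]
    intro e
    rw [i.src, List.map_map, hlab, h.src_typed, (hi e).dom_eq]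
  · simp only [i.onE.surjective.forall]
    intro e
    rw [i.tgt, List.map_map, hlab, h.tgt_typed, (hi e).cod_eq]
  · rw [i.ins]
    exact h.ins_nodup.map i.onV.injective
  · rw [i.outs]
    exact h.outs_nodup.map i.onV.injective
  · simp only [i.onE.surjective.forall, i.onV.surjective.forall, ht, hin]
    exact h.mem_ins
  · simp only [i.onE.surjective.forall, i.onV.surjective.forall, hs, hout]
    exact h.mem_outs
  · simp only [i.onV.surjective.forall, hin, hout]
    exact h.ins_outs

theorem HGraph.HasType.of_shapeIso {M : Type w} {G G' : HGraph M} {I O : List VLab}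
    (h : G.HasType I O) (i : G.ShapeIso G') : G'.HasType I O := by
  have hlab : G'.vertexLabel ∘ i.onV = G.vertexLabel := funext i.vertexLabel
  constructor
  · rw [i.ins, List.map_map, hlab, h.1]
  · rw [i.outs, List.map_map, hlab, h.2]

theorem Lab.WF.of_iso {l l' : Lab 𝕆} (h : l.WF) (hi : l.Iso l') : l'.WF := by
  induction hi with
  | refl => exact h
  | box i deep ih =>
    cases h with
    | box _ _ _ _ proper type hd =>
      refine .box _ _ _ _ (proper.of_iso i deep) (type.of_shapeIso i) ?_
      simp only [i.onE.surjective.forall]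
      exact fun e => ih e (hd e)

theorem HGraph.WF.of_iso {G G' : Net 𝕆} (h : G.WF) (hi : G.Iso G') : G'.WF := by
  obtain ⟨i, hi⟩ := hi
  refine ⟨h.1.of_iso i hi, ?_⟩
  simp only [i.onE.surjective.forall]
  exact fun e => (h.2 e).of_iso (hi e)

theorem Lab.Iso.nonempty_occ {P : Lab 𝕆 → Prop} (hP : ∀ l l', Lab.Iso l l' → P l → P l')
    {l l' : Lab 𝕆} (h : l.Iso l') (o : Nonempty (l.Occ P)) : Nonempty (l'.Occ P) := by
  induction h with
  | refl => exact o
  | box i deep ih =>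
    obtain ⟨o⟩ := o
    cases o with
    | here hp => exact ⟨.here (hP _ _ (.box i deep) hp)⟩
    | deep e o =>
      obtain ⟨o'⟩ := ih e ⟨o⟩
      exact ⟨.deep _ o'⟩

theorem Lab.IsToken.of_iso (l l' : Lab 𝕆) (h : l.Iso l') (hl : l.IsToken) : l'.IsToken := by
  obtain ⟨t, rfl⟩ := hl
  exact ⟨t, h.eq_of_forall_ne_box (by simp)⟩

theorem Lab.IsHole.of_iso (l l' : Lab 𝕆) (h : l.Iso l') (hl : l.IsHole) : l'.IsHole := by
  obtain ⟨t, rfl⟩ := hl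
  exact ⟨t, h.eq_of_forall_ne_box (by simp)⟩

theorem Lab.Iso.isEmpty_occ {P : Lab 𝕆 → Prop} (hP : ∀ l l', Lab.Iso l l' → P l → P l')
    {l l' : Lab 𝕆} (h : l.Iso l') (o : IsEmpty (l.Occ P)) : IsEmpty (l'.Occ P) := by
  rw [← not_nonempty_iff] at o ⊢
  exact fun o' => o (h.symm.nonempty_occ hP o')

theorem HGraph.isEmpty_occ_iff {P : Lab 𝕆 → Prop} {G : Net 𝕆} :
    IsEmpty (G.Occ P) ↔ ∀ e, IsEmpty ((G.edgeLabel e).Occ P) :=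
  isEmpty_sigma

theorem HGraph.Iso.isEmpty_occ {P : Lab 𝕆 → Prop} (hP : ∀ l l', Lab.Iso l l' → P l → P l')
    {G G' : Net 𝕆} (h : G.Iso G') (o : IsEmpty (G.Occ P)) : IsEmpty (G'.Occ P) := by
  obtain ⟨i, hi⟩ := h
  rw [HGraph.isEmpty_occ_iff] at o ⊢
  simp only [i.onE.surjective.forall]
  exact fun e => (hi e).isEmpty_occ hP (o e)

theorem HGraph.FocusFree.edgeLabel_ne {G : Net 𝕆} (h : G.FocusFree) (e : G.E) (t : Tok) :
    G.edgeLabel e ≠ .token t :=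
  fun he => h.elim ⟨e, .here ⟨t, he⟩⟩

theorem HGraph.cls_eq_iff {G G' : Net 𝕆} : G.cls = G'.cls ↔ G.Iso G' :=
  Quotient.eq

theorem HGraph.Iso.symm {G G' : Net 𝕆} (h : G.Iso G') : G'.Iso G :=
  (netSetoid 𝕆).symm h

theorem HGraph.Iso.trans {G G' G'' : Net 𝕆} (h : G.Iso G') (h' : G'.Iso G'') : G.Iso G'' :=
  (netSetoid 𝕆).trans h h'

/-! ### Inserting a token at a vertex -/

open Classical in
/-- Send `v` to the new vertex `none`, and keep the other vertices. -/
noncomputable def splitAt {V : Type} (v x : V) : Option V := if x = v then none else some x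

@[simp]
theorem splitAt_self {V : Type} (v : V) : splitAt v v = none := if_pos rfl

theorem splitAt_of_ne {V : Type} {v x : V} (h : x ≠ v) : splitAt v x = some x := if_neg h

theorem splitAt_injective {V : Type} (v : V) : Function.Injective (splitAt v) := by
  intro x y h
  by_cases hx : x = v <;> by_cases hy : y = v <;> simp_all [splitAt]

theorem map_splitAt_of_notMem {V : Type} {v : V} {l : List V} (h : v ∉ l) :
    l.map (splitAt v) = l.map some :=
  List.map_congr_left fun _ hx => splitAt_of_ne fun e => h (e ▸ hx)

theorem some_mem_map_splitAt {V : Type} {v x : V} {l : List V} :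
    some x ∈ l.map (splitAt v) ↔ x ∈ l ∧ x ≠ v := by
  rw [List.mem_map]
  constructor
  · rintro ⟨y, hy, h⟩
    by_cases hv : y = v
    · simp [hv] at h
    · rw [splitAt_of_ne hv] at h
      cases h
      exact ⟨hy, hv⟩
  · exact fun ⟨h, hv⟩ => ⟨x, h, splitAt_of_ne hv⟩

theorem none_mem_map_splitAt {V : Type} {v : V} {l : List V} :
    none ∈ l.map (splitAt v) ↔ v ∈ l := by
  rw [← splitAt_self v, List.mem_map_of_injective (splitAt_injective v)]

/-- Insert a `t`-token at the vertex `v`, which becomes the source of the token; its target is the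
new vertex `none`. -/
@[reducible]
noncomputable def HGraph.insertToken (U : Net 𝕆) (v : U.V) (t : Tok) : Net 𝕆 where
  V := Option U.V
  E := Option U.E
  vertexLabel x := x.elim .star U.vertexLabel
  edgeLabel e := e.elim (.token t) U.edgeLabel
  src e := e.elim [some v] fun e => (U.src e).map (splitAt v)
  tgt e := e.elim [none] fun e => (U.tgt e).map some
  ins := U.ins.map some
  outs := U.outs.map (splitAt v)

theorem HGraph.insertToken_congr {U U' : Net 𝕆} (i : U.ShapeIso U')
    (hi : ∀ e, (U.edgeLabel e).Iso (U'.edgeLabel (i.onE e))) (v : U.V) (t : Tok) :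
    (U.insertToken v t).Iso (U'.insertToken (i.onV v) t) := by
  have hs : ∀ l : List U.V, (l.map i.onV).map (splitAt (i.onV v)) =
      (l.map (splitAt v)).map (Equiv.optionCongr i.onV) := by
    intro l
    simp only [List.map_map]
    refine List.map_congr_left fun x _ => ?_
    by_cases hx : x = v
    · simp [hx]
    · simp [splitAt_of_ne hx, splitAt_of_ne (i.onV.injective.ne hx)]
  refine ⟨⟨Equiv.optionCongr i.onV, Equiv.optionCongr i.onE, ?_, ?_, ?_, ?_, ?_⟩, ?_⟩
  · rintro (_ | x)
    · rfl
    · exact i.vertexLabel x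
  · rintro (_ | e)
    · rfl
    · exact (congrArg (List.map _) (i.src e)).trans (hs _)
  · rintro (_ | e)
    · rfl
    · refine (congrArg (List.map _) (i.tgt e)).trans ?_
      simp [HGraph.insertToken]
  · refine (congrArg (List.map _) i.ins).trans ?_
    simp [HGraph.insertToken]
  · exact (congrArg (List.map _) i.outs).trans (hs _)
  · rintro (_ | e)
    · exact .refl _
    · exact hi e

/-- `U'` has no token, so the isomorphism must match the two inserted edges; their ends are then
matched too, `v` with `v'` and `none` with `none`. Removing `none` everywhere leaves an isomorphism
of the nets without tokens. This makes the net and the position of the token well defined for a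
state given as an isomorphism class. -/
theorem HGraph.insertToken_cancel {U U' : Net 𝕆} {v : U.V} {v' : U'.V} {t t' : Tok}
    (h : (U.insertToken v t).Iso (U'.insertToken v' t')) (hU' : U'.FocusFree) :
    t = t' ∧ ∃ i : U.ShapeIso U', (∀ e, (U.edgeLabel e).Iso (U'.edgeLabel (i.onE e))) ∧
      i.onV v = v' := by
  obtain ⟨⟨f, g, hl, hs, ht, hin, hout⟩, hi⟩ := h
  have hg : g none = none := by
    have h0 : (U'.insertToken v' t').edgeLabel (g none) = .token t :=
      (hi none).eq_of_forall_ne_box (by simp)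
    rcases h1 : g none with _ | e
    · rfl
    · rw [h1] at h0
      exact absurd h0 (hU'.edgeLabel_ne e t)
  have htt : t = t' := by
    have h0 : (U'.insertToken v' t').edgeLabel (g none) = .token t :=
      (hi none).eq_of_forall_ne_box (by simp)
    rw [hg] at h0
    exact (Lab.token.inj h0).symm
  have hfv : f (some v) = some v' := by
    have := hs none
    rw [hg] at this
    simpa [HGraph.insertToken] using this.symm
  have hfn : f none = none := by
    have := ht none
    rw [hg] at this
    simpa [HGraph.insertToken] using this.symm
  have hf : ∀ x, f (some x) = some (Equiv.removeNone f x) := fun x =>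
    (Equiv.removeNone_some f (by
      rcases h : f (some x) with _ | y
      · exact absurd (f.injective (h.trans hfn.symm)) (by simp)
      · exact ⟨y, rfl⟩)).symm
  have hge : ∀ x, g (some x) = some (Equiv.removeNone g x) := fun x =>
    (Equiv.removeNone_some g (by
      rcases h : g (some x) with _ | y
      · exact absurd (g.injective (h.trans hg.symm)) (by simp)
      · exact ⟨y, rfl⟩)).symm
  have hv : Equiv.removeNone f v = v' := by
    have := hf v
    rw [hfv] at this
    exact (Option.some.inj this).symm
  have hsp : ∀ l : List U.V, (l.map (splitAt v)).map f =
      (l.map (Equiv.removeNone f)).map (splitAt v') := by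
    intro l
    simp only [List.map_map]
    refine List.map_congr_left fun x _ => ?_
    by_cases hx : x = v
    · simp [hx, hfn, hv]
    · have : Equiv.removeNone f x ≠ v' := hv ▸ (Equiv.removeNone f).injective.ne hx
      simp [splitAt_of_ne hx, splitAt_of_ne this, hf]
  have hso : ∀ l : List U.V, (l.map some).map f = (l.map (Equiv.removeNone f)).map some := by
    intro l
    simp only [List.map_map]
    exact List.map_congr_left fun x _ => hf x
  have hinj := List.map_injective_iff.2 (splitAt_injective v')
  have hinj' := List.map_injective_iff.2 (Option.some_injective U'.V)
  refine ⟨htt, ⟨Equiv.removeNone f, Equiv.removeNone g, ?_, ?_, ?_, ?_, ?_⟩, ?_, hv⟩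
  · intro x
    have := hl (some x)
    rwa [hf] at this
  · intro e
    have := hs (some e)
    rw [hge] at this
    exact hinj (this.trans (hsp _))
  · intro e
    have := ht (some e)
    rw [hge] at this
    exact hinj' (this.trans (hso _))
  · exact hinj' (hin.trans (hso _))
  · exact hinj (hout.trans (hsp _))
  · intro e
    have := hi (some e)
    rwa [hge] at this

/-- A focussed net is its underlying net, with the token inserted at the source of the token. The
isomorphism preserves edge labels strictly. -/
theorem Token.exists_shapeIso {G : Net 𝕆} (τ : Token G) (hG : G.Proper) :
    ∃ i : G.ShapeIso (τ.underlying.insertToken ⟨τ.s, τ.acyclic⟩ τ.lab),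
      ∀ e, (τ.underlying.insertToken ⟨τ.s, τ.acyclic⟩ τ.lab).edgeLabel (i.onE e) =
        G.edgeLabel e := by
  classical
  unfold Token.underlying
  let s' : { v : G.V // v ≠ τ.t } := ⟨τ.s, τ.acyclic⟩
  let f : G.V ≃ Option { v : G.V // v ≠ τ.t } :=
    { toFun := fun x => if h : x = τ.t then none else some ⟨x, h⟩
      invFun := fun y => y.elim τ.t Subtype.val
      left_inv := fun x => by by_cases h : x = τ.t <;> simp [h]
      right_inv := by
        rintro (_ | ⟨y, hy⟩)
        · simp
        · simp [hy] }
  let g : G.E ≃ Option { e : G.E // e ≠ τ.edge } :=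
    { toFun := fun x => if h : x = τ.edge then none else some ⟨x, h⟩
      invFun := fun y => y.elim τ.edge Subtype.val
      left_inv := fun x => by by_cases h : x = τ.edge <;> simp [h]
      right_inv := by
        rintro (_ | ⟨y, hy⟩)
        · simp
        · simp [hy] }
  have hft : f τ.t = none := dif_pos rfl
  have hf : ∀ x (h : x ≠ τ.t), f x = some ⟨x, h⟩ := fun x h => dif_neg h
  have hgt : g τ.edge = none := dif_pos rfl
  have hg : ∀ x (h : x ≠ τ.edge), g x = some ⟨x, h⟩ := fun x h => dif_neg h
  have hm : ∀ x (h : x ≠ τ.t), τ.merge x = ⟨x, h⟩ := fun x h => dif_neg h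
  have hmt : τ.merge τ.t = s' := dif_pos rfl
  -- In the underlying net both ends of the token have become `s'`. Splitting at `s'` reads it as
  -- the target `τ.t`, which is right for lists without `τ.s`: sources of other edges, and outputs.
  -- Keeping it reads it as `τ.s`, right for lists without `τ.t`: targets of other edges, and
  -- inputs.
  have hsplit : ∀ l : List G.V, τ.s ∉ l → (l.map τ.merge).map (splitAt s') = l.map f := by
    intro l hl
    rw [List.map_map]
    refine List.map_congr_left fun x hx => ?_
    by_cases h : x = τ.t
    · subst h
      simp [hmt, hft]
    · have : (⟨x, h⟩ : { v : G.V // v ≠ τ.t }) ≠ s' := fun e =>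
        hl ((show x = τ.s from congrArg Subtype.val e) ▸ hx)
      simp only [Function.comp_apply, hm x h, hf x h]
      exact splitAt_of_ne this
  have hsome : ∀ l : List G.V, τ.t ∉ l → (l.map τ.merge).map some = l.map f := by
    intro l hl
    rw [List.map_map]
    refine List.map_congr_left fun x hx => ?_
    have h : x ≠ τ.t := fun e => hl (e ▸ hx)
    simp [hm x h, hf x h]
  have hs : τ.s ∈ G.src τ.edge := by simp [τ.src_eq]
  have ht : τ.t ∈ G.tgt τ.edge := by simp [τ.tgt_eq]
  refine ⟨⟨f, g, ?_, ?_, ?_, ?_, ?_⟩, ?_⟩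
  · intro x
    by_cases h : x = τ.t
    · subst h
      rw [hft]
      have := hG.tgt_typed τ.edge
      rw [τ.tgt_eq, τ.edgeLabel_eq] at this
      simpa [Lab.cod, HGraph.insertToken] using this.symm
    · rw [hf x h]
      rfl
  · intro e
    by_cases h : e = τ.edge
    · subst h
      rw [hgt, τ.src_eq]
      simp [hf _ τ.acyclic, HGraph.insertToken]
    · rw [hg e h]
      exact hsplit _ fun h' => h (hG.src_unique _ _ _ h' hs)
  · intro e
    by_cases h : e = τ.edge
    · subst h
      rw [hgt, τ.tgt_eq]
      simp [hft, HGraph.insertToken]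
    · rw [hg e h]
      exact hsome _ fun h' => h (hG.tgt_unique _ _ _ h' ht)
  · exact hsome _ fun h' => (hG.mem_ins _).1 h' _ ht
  · exact hsplit _ fun h' => (hG.mem_outs _).1 h' _ hs
  · intro e
    by_cases h : e = τ.edge
    · subst h
      simp [hgt, τ.edgeLabel_eq, HGraph.insertToken]
    · rw [hg e h]
      rfl

theorem Token.iso_insertToken {G : Net 𝕆} (τ : Token G) (hG : G.Proper) :
    G.Iso (τ.underlying.insertToken ⟨τ.s, τ.acyclic⟩ τ.lab) := by
  obtain ⟨i, hi⟩ := τ.exists_shapeIso hG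
  exact ⟨i, fun e => hi e ▸ .refl _⟩

/-- The two constructions differ in which end of the token is the new vertex: the target for
`insertToken`, the source for `attach`. Exchanging `none` and `some r` turns one into the other. -/
theorem HGraph.attach_iso_insertToken {X : Net 𝕆} {r : X.V} (hr : X.ins = [r])
    (hs : ∀ e, r ∉ X.tgt e) (hl : X.vertexLabel r = .star) (t : Tok) :
    (X.insertToken r t).Iso (X.attach t) := by
  classical
  unfold HGraph.attach
  let f : Option X.V ≃ Option X.V := Equiv.swap none (some r)
  have hfr : f (some r) = none := Equiv.swap_apply_right _ _
  have hfn : f none = some r := Equiv.swap_apply_left _ _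
  have hf : ∀ x, x ≠ r → f (some x) = some x := fun x hx =>
    Equiv.swap_apply_of_ne_of_ne (by simp) (by simpa using hx)
  have hsplit : ∀ x, f (splitAt r x) = some x := by
    intro x
    by_cases h : x = r
    · simp [h, hfn]
    · rw [splitAt_of_ne h, hf x h]
  have hsome : ∀ l : List X.V, r ∉ l → (l.map some).map f = l.map some := by
    intro l hl
    rw [List.map_map]
    exact List.map_congr_left fun x hx => hf x fun e => hl (e ▸ hx)
  refine ⟨⟨f, Equiv.refl _, ?_, ?_, ?_, ?_, ?_⟩, ?_⟩
  · rintro (_ | x)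
    · rw [hfn]
      exact hl
    · by_cases h : x = r
      · subst h
        rw [hfr]
        exact hl.symm
      · rw [hf x h]
  · rintro (_ | e)
    · simp [HGraph.insertToken, hfr]
    · simp [HGraph.insertToken, hsplit]
  · rintro (_ | e)
    · simp [HGraph.insertToken, hfn, hr]
    · exact (hsome _ (hs e)).symm
  · simp [HGraph.insertToken, hfr, hr]
  · simp [HGraph.insertToken, hsplit]
  · rintro (_ | e)
    · exact .refl _
    · exact .refl _

/-! ### Plugging and isomorphisms -/

theorem HGraph.glue_eq_none {M : Type w} {V : Type} {H : HGraph M} {s t : List V} {v : H.V}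
    (hi : v ∉ H.ins) (ho : v ∉ H.outs) : H.glue s t v = none := by
  simp [HGraph.glue, hi, ho]

theorem HGraph.map_glue_ins {M : Type w} {V : Type} {H : HGraph M} {s t : List V}
    (hn : H.ins.Nodup) (hs : s.length = H.ins.length) :
    H.ins.map (H.glue s t) = s.map some := by
  classical
  refine List.ext_getElem (by simp [hs]) fun i h₁ h₂ => ?_
  simp only [List.length_map] at h₁ h₂
  have : H.ins.idxOf H.ins[i] = i := hn.idxOf_getElem i h₁
  simp only [List.getElem_map, HGraph.glue, List.getElem_mem, if_true]
  convert List.getElem?_eq_getElem h₂ using 2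

theorem HGraph.map_glue_outs {M : Type w} {V : Type} {H : HGraph M} {s t : List V}
    (hn : H.outs.Nodup) (hd : ∀ v ∈ H.outs, v ∉ H.ins) (ht : t.length = H.outs.length) :
    H.outs.map (H.glue s t) = t.map some := by
  classical
  refine List.ext_getElem (by simp [ht]) fun i h₁ h₂ => ?_
  simp only [List.length_map] at h₁ h₂
  have : H.outs.idxOf H.outs[i] = i := hn.idxOf_getElem i h₁
  simp only [List.getElem_map, HGraph.glue, List.getElem_mem, if_true,
    hd _ (List.getElem_mem h₁), if_false]
  convert List.getElem?_eq_getElem h₂ using 2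

theorem HGraph.glue_map {M : Type w} {V W : Type} (H : HGraph M) (f : V → W) (s t : List V)
    (v : H.V) : H.glue (s.map f) (t.map f) v = (H.glue s t v).map f := by
  unfold HGraph.glue
  split_ifs <;> simp

/-- Whether a vertex is glued depends only on the lengths of the two lists. Different maps are
allowed on sources and targets since inserting a token applies `splitAt v` to the former and `some`
to the latter. -/
theorem HGraph.glue_map_eq_none_iff {M : Type w} {V W : Type} (H : HGraph M) (f g : V → W)
    (s t : List V) (v : H.V) : H.glue (s.map f) (t.map g) v = none ↔ H.glue s t v = none := by
  unfold HGraph.glue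
  split_ifs <;> simp

theorem HGraph.plugMap_of_some {M : Type w} {G : HGraph M} {p : G.E → Option (HGraph M)}
    {x : G.Slot p} {v : x.net.V} {a : G.V}
    (h : x.net.glue (G.src x.1) (G.tgt x.1) v = some a) : G.plugMap p x v = .inl a := by
  unfold HGraph.plugMap
  split <;> simp_all

theorem HGraph.plugMap_of_none {M : Type w} {G : HGraph M} {p : G.E → Option (HGraph M)}
    {x : G.Slot p} {v : x.net.V} (h : x.net.glue (G.src x.1) (G.tgt x.1) v = none) :
    G.plugMap p x v = .inr ⟨x, v, h⟩ := by
  unfold HGraph.plugMap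
  split <;> simp_all

theorem List.map_map_congr_left {α β β' γ : Type} {l : List α} {f : α → β} {g : β → γ}
    {f' : α → β'} {g' : β' → γ} (h : ∀ x ∈ l, g (f x) = g' (f' x)) :
    (l.map f).map g = (l.map f').map g' := by
  rw [List.map_map, List.map_map]
  exact List.map_congr_left h

/-- Labels enter only as a condition on `j`, because `HGraph.fill` also alters the labels of the
edges that stay; the shape can be treated before them. -/
theorem HGraph.exists_plug_shapeIso {M : Type w} {G G' : HGraph M} (i : G.ShapeIso G')
    (p' : G'.E → Option (HGraph M)) :
    ∃ j : (G.plug fun e => p' (i.onE e)).ShapeIso (G'.plug p'),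
      (∀ e, G'.edgeLabel (i.onE e) = G.edgeLabel e) →
        ∀ e, (G'.plug p').edgeLabel (j.onE e) = (G.plug fun e => p' (i.onE e)).edgeLabel e := by
  let p : G.E → Option (HGraph M) := fun e => p' (i.onE e)
  let k : G.Slot p → G'.Slot p' := fun x => ⟨i.onE x.1, x.2⟩
  have hk : Function.Injective k := fun x y h => Subtype.ext (i.onE.injective
    (congrArg Subtype.val h))
  have hk' : Function.Surjective k := fun ⟨e, he⟩ => by
    obtain ⟨e, rfl⟩ := i.onE.surjective e
    exact ⟨⟨e, he⟩, rfl⟩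
  have hglue : ∀ (x : G.Slot p) (v : x.net.V),
      x.net.glue (G'.src (k x).1) (G'.tgt (k x).1) v =
        (x.net.glue (G.src x.1) (G.tgt x.1) v).map i.onV := by
    intro x v
    rw [← HGraph.glue_map, ← i.src, ← i.tgt]
  let f : G.PlugV p → G'.PlugV p' := Sum.map i.onV fun y =>
    ⟨k y.1, y.2.1, by rw [hglue, y.2.2]; rfl⟩
  have hf : Function.Bijective f := by
    constructor
    · rintro (x | ⟨x, v, hv⟩) (y | ⟨y, v', hv'⟩) h
      · exact congrArg _ (i.onV.injective (Sum.inl.inj h))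
      · cases h
      · cases h
      · obtain ⟨h₁, h₂⟩ := Sigma.mk.inj (Sum.inr.inj h)
        obtain rfl := hk h₁
        obtain rfl : v = v' := congrArg Subtype.val (eq_of_heq h₂)
        rfl
    · rintro (x | ⟨x, v, hv⟩)
      · exact ⟨.inl (i.onV.symm x), congrArg Sum.inl (i.onV.apply_symm_apply x)⟩
      · obtain ⟨x, rfl⟩ := hk' x
        refine ⟨.inr ⟨x, v, ?_⟩, rfl⟩
        have : (x.net.glue (G.src x.1) (G.tgt x.1) v).map i.onV = none := by rw [← hglue]; exact hv
        simpa using this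
  let g : (G.plug p).E → (G'.plug p').E := Sum.map (fun e => ⟨i.onE e.1, e.2⟩) fun y => ⟨k y.1, y.2⟩
  have hg : Function.Bijective g := by
    constructor
    · rintro (x | ⟨x, v⟩) (y | ⟨y, v'⟩) h
      · exact congrArg _ (Subtype.ext (i.onE.injective (congrArg Subtype.val (Sum.inl.inj h))))
      · cases h
      · cases h
      · obtain ⟨h₁, h₂⟩ := Sigma.mk.inj (Sum.inr.inj h)
        obtain rfl := hk h₁
        obtain rfl : v = v' := eq_of_heq h₂
        rfl
    · rintro (⟨x, hx⟩ | ⟨x, v⟩)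
      · obtain ⟨x, rfl⟩ := i.onE.surjective x
        exact ⟨.inl ⟨x, hx⟩, rfl⟩
      · obtain ⟨x, rfl⟩ := hk' x
        exact ⟨.inr ⟨x, v⟩, rfl⟩
  have hmap : ∀ (x : G.Slot p) (v : x.net.V), G'.plugMap p' (k x) v = f (G.plugMap p x v) := by
    intro x v
    rcases h : x.net.glue (G.src x.1) (G.tgt x.1) v with _ | a
    · rw [HGraph.plugMap_of_none h]
      exact HGraph.plugMap_of_none (x := k x) ((hglue x v).trans (by rw [h]; rfl))
    · rw [HGraph.plugMap_of_some h]
      refine HGraph.plugMap_of_some ?_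
      exact (hglue x v).trans (by rw [h]; rfl)
  have hinl : ∀ l : List G.V, (l.map i.onV).map (Sum.inl : G'.V → G'.PlugV p') =
      (l.map Sum.inl).map f := fun l => by simp [f]
  refine ⟨⟨Equiv.ofBijective f hf, Equiv.ofBijective g hg, ?_, ?_, ?_, ?_, ?_⟩, ?_⟩
  · rintro (x | y)
    · exact i.vertexLabel x
    · rfl
  · rintro (e | ⟨x, e⟩)
    · exact (congrArg (List.map Sum.inl) (i.src e.1)).trans (hinl _)
    · refine Eq.trans ?_ List.map_map.symm
      exact List.map_congr_left fun v _ => hmap x v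
  · rintro (e | ⟨x, e⟩)
    · exact (congrArg (List.map Sum.inl) (i.tgt e.1)).trans (hinl _)
    · refine Eq.trans ?_ List.map_map.symm
      exact List.map_congr_left fun v _ => hmap x v
  · exact (congrArg (List.map Sum.inl) i.ins).trans (hinl _)
  · exact (congrArg (List.map Sum.inl) i.outs).trans (hinl _)
  · rintro h (e | ⟨x, e⟩)
    · exact h e.1
    · rfl

/-- Plugging respects isomorphisms that preserve labels strictly. -/
theorem HGraph.fill_iso_fill {C C' : Net 𝕆} (i : C.ShapeIso C')
    (hi : ∀ e, C'.edgeLabel (i.onE e) = C.edgeLabel e) (σ : HoleLab → Option (Net 𝕆)) :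
    (C.fill σ).Iso (C'.fill σ) := by
  let D : Net 𝕆 := { C with edgeLabel := fun e => (C.edgeLabel e).fill σ }
  let D' : Net 𝕆 := { C' with edgeLabel := fun e => (C'.edgeLabel e).fill σ }
  let i' : D.ShapeIso D' := ⟨i.onV, i.onE, i.vertexLabel, i.src, i.tgt, i.ins, i.outs⟩
  obtain ⟨j, hj⟩ := HGraph.exists_plug_shapeIso i' fun e => (C'.edgeLabel e).slot σ
  have h := hj fun e => congrArg (Lab.fill σ) (hi e)
  have hp : (fun e => (C.edgeLabel e).slot σ) = fun e => (C'.edgeLabel (i.onE e)).slot σ :=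
    funext fun e => congrArg (Lab.slot σ) (hi e).symm
  unfold HGraph.fill
  rw [hp]
  exact ⟨j, fun e => h e ▸ .refl _⟩

/-- Inserting a token commutes with plugging. -/
theorem HGraph.fill_insertToken_iso (U : Net 𝕆) (v : U.V) (t : Tok)
    (σ : HoleLab → Option (Net 𝕆))
    (hσ : ∀ e H, (U.edgeLabel e).slot σ = some H → H.Proper) :
    ((U.insertToken v t).fill σ).Iso ((U.fill σ).insertToken (.inl v) t) := by
  let p : Option U.E → Option (Net 𝕆) := fun e => ((U.insertToken v t).edgeLabel e).slot σ
  let p' : U.E → Option (Net 𝕆) := fun e => (U.edgeLabel e).slot σ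
  let D : Net 𝕆 := { U with edgeLabel := fun e => (U.edgeLabel e).fill σ }
  let G : Net 𝕆 := { U.insertToken v t with
    edgeLabel := fun e => ((U.insertToken v t).edgeLabel e).fill σ }
  let f : G.PlugV p ≃ Option (D.PlugV p') :=
    { toFun := fun
        | .inl none => none
        | .inl (some x) => some (.inl x)
        | .inr ⟨⟨some e, he⟩, w, hw⟩ =>
          some (.inr ⟨⟨e, he⟩, w, (HGraph.glue_map_eq_none_iff _ _ _ _ _ _).1 hw⟩)
      invFun := fun
        | none => .inl none
        | some (.inl x) => .inl (some x)
        | some (.inr ⟨⟨e, he⟩, w, hw⟩) =>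
          .inr ⟨⟨some e, he⟩, w, (HGraph.glue_map_eq_none_iff _ _ _ _ _ _).2 hw⟩
      left_inv := by
        rintro ((_ | x) | ⟨⟨_ | e, he⟩, w, hw⟩)
        · rfl
        · rfl
        · exact absurd he (by simp [p, Lab.slot])
        · rfl
      right_inv := by
        rintro (_ | x | ⟨⟨e, he⟩, w, hw⟩) <;> rfl }
  let g : (G.plug p).E ≃ Option (D.plug p').E :=
    { toFun := fun
        | .inl ⟨none, _⟩ => none
        | .inl ⟨some e, he⟩ => some (.inl ⟨e, he⟩)
        | .inr ⟨⟨some e, he⟩, k⟩ => some (.inr ⟨⟨e, he⟩, k⟩)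
      invFun := fun
        | none => .inl ⟨none, rfl⟩
        | some (.inl ⟨e, he⟩) => .inl ⟨some e, he⟩
        | some (.inr ⟨⟨e, he⟩, k⟩) => .inr ⟨⟨some e, he⟩, k⟩
      left_inv := by
        rintro (⟨_ | x, h⟩ | ⟨⟨_ | e, he⟩, k⟩)
        · rfl
        · rfl
        · exact absurd he (by simp [p, Lab.slot])
        · rfl
      right_inv := by
        rintro (_ | ⟨x, h⟩ | ⟨⟨e, he⟩, k⟩) <;> rfl }
  have hinl : ∀ x : U.V, f (.inl (splitAt v x)) = splitAt (.inl v) (.inl x) := by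
    intro x
    by_cases h : x = v
    · subst h
      simp [f]
    · rw [splitAt_of_ne h, splitAt_of_ne (Sum.inl_injective.ne h)]
      rfl
  -- A source of an edge of a plugged net is not an output of it, so it can only be glued to a
  -- source of the hole, to which `splitAt v` is applied. Dually, in `htgt`, a target of such an
  -- edge is not an input and can only be glued to a target of the hole, to which `some` is applied.
  have hsrc : ∀ (e : U.E) (he : (p' e).isSome) (w : ((p' e).get he).V),
      w ∉ ((p' e).get he).outs →
      splitAt (.inl v) (D.plugMap p' ⟨e, he⟩ w) = f (G.plugMap p ⟨some e, he⟩ w) := by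
    intro e he w hw
    rcases h : ((p' e).get he).glue (U.src e) (U.tgt e) w with _ | a
    · have h' : ((p' e).get he).glue (G.src (some e)) (G.tgt (some e)) w = none :=
        (HGraph.glue_map_eq_none_iff _ _ _ _ _ _).2 h
      rw [HGraph.plugMap_of_none (x := (⟨e, he⟩ : D.Slot p')) h,
        HGraph.plugMap_of_none (x := (⟨some e, he⟩ : G.Slot p)) h']
      exact splitAt_of_ne (by simp)
    · have h' : ((p' e).get he).glue (G.src (some e)) (G.tgt (some e)) w = some (splitAt v a) := by
        unfold HGraph.glue at h ⊢
        split_ifs at h ⊢ with h1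
        simp [G, HGraph.insertToken, h]
      rw [HGraph.plugMap_of_some (x := (⟨e, he⟩ : D.Slot p')) h,
        HGraph.plugMap_of_some (x := (⟨some e, he⟩ : G.Slot p)) h', hinl]
  have htgt : ∀ (e : U.E) (he : (p' e).isSome) (w : ((p' e).get he).V),
      w ∉ ((p' e).get he).ins →
      some (D.plugMap p' ⟨e, he⟩ w) = f (G.plugMap p ⟨some e, he⟩ w) := by
    intro e he w hw
    rcases h : ((p' e).get he).glue (U.src e) (U.tgt e) w with _ | a
    · have h' : ((p' e).get he).glue (G.src (some e)) (G.tgt (some e)) w = none :=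
        (HGraph.glue_map_eq_none_iff _ _ _ _ _ _).2 h
      rw [HGraph.plugMap_of_none (x := (⟨e, he⟩ : D.Slot p')) h,
        HGraph.plugMap_of_none (x := (⟨some e, he⟩ : G.Slot p)) h']
      rfl
    · have h' : ((p' e).get he).glue (G.src (some e)) (G.tgt (some e)) w = some (some a) := by
        unfold HGraph.glue at h ⊢
        split_ifs at h ⊢ with h1
        simp [G, HGraph.insertToken, h]
      rw [HGraph.plugMap_of_some (x := (⟨e, he⟩ : D.Slot p')) h,
        HGraph.plugMap_of_some (x := (⟨some e, he⟩ : G.Slot p)) h']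
      rfl
  refine ⟨⟨f, g, ?_, ?_, ?_, ?_, ?_⟩, ?_⟩
  · rintro ((_ | x) | ⟨⟨_ | e, he⟩, w, hw⟩)
    · rfl
    · rfl
    · exact absurd he (by simp [Lab.slot])
    · rfl
  · rintro (⟨_ | e, he⟩ | ⟨⟨_ | e, he⟩, k⟩)
    · rfl
    · change ((U.src e).map _).map _ = (((U.src e).map _).map _).map f
      rw [List.map_map (f := splitAt v)]
      exact List.map_map_congr_left fun x _ => (hinl x).symm
    · exact absurd he (by simp [Lab.slot])
    · change ((((p' e).get he).src k).map _).map _ = ((((p' e).get he).src k).map _).map f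
      exact List.map_map_congr_left fun w hw => hsrc e he w fun ho =>
        ((hσ e _ (Option.some_get he).symm).mem_outs w).1 ho k hw
  · rintro (⟨_ | e, he⟩ | ⟨⟨_ | e, he⟩, k⟩)
    · rfl
    · change ((U.tgt e).map _).map _ = (((U.tgt e).map _).map _).map f
      rw [List.map_map (f := some)]
      exact List.map_map_congr_left fun x _ => rfl
    · exact absurd he (by simp [Lab.slot])
    · change ((((p' e).get he).tgt k).map _).map _ = ((((p' e).get he).tgt k).map _).map f
      exact List.map_map_congr_left fun w hw => htgt e he w fun ho =>
        ((hσ e _ (Option.some_get he).symm).mem_ins w).1 ho k hw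
  · change (U.ins.map _).map _ = ((U.ins.map _).map _).map f
    rw [List.map_map (f := some)]
    exact List.map_map_congr_left fun x _ => rfl
  · change (U.outs.map _).map _ = ((U.outs.map _).map _).map f
    rw [List.map_map (f := splitAt v)]
    exact List.map_map_congr_left fun x _ => (hinl x).symm
  · rintro (⟨_ | e, he⟩ | ⟨⟨_ | e, he⟩, k⟩)
    · exact .refl _
    · exact .refl _
    · exact absurd he (by simp [Lab.slot])
    · exact .refl _

/-- Without holes nothing is replaced, yet `Lab.fill` still rebuilds the contents of boxes on sum
types whose right summand is empty. Hence an isomorphism rather than an equality. -/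
theorem Lab.iso_fill {l : Lab 𝕆} (hl : l.WF) (h : IsEmpty (l.Occ Lab.IsHole))
    (σ : HoleLab → Option (Net 𝕆)) : l.Iso (l.fill σ) := by
  induction hl with
  | op | inst | atom | weak | contr | token => exact .refl _
  | hole χ => exact (h.elim (.here ⟨χ, rfl⟩))
  | box b k n G proper type deep ih =>
    have hd : ∀ e, IsEmpty ((G.edgeLabel e).Occ Lab.IsHole) := fun e => ⟨fun o => h.elim (.deep e o)⟩
    obtain ⟨V, E, vl, el, s, t, i, o⟩ := G
    let D : Net 𝕆 := ⟨V, E, vl, fun e => Lab.fill σ (el e), s, t, i, o⟩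
    have hp : ∀ e, (el e).slot σ = none := by
      intro e
      rcases h : el e with _ | _ | _ | _ | _ | _ | χ | _ <;> try rfl
      exact (hd e).elim (.here ⟨χ, h⟩)
    have hno : ∀ x : D.Slot fun e => (el e).slot σ, False := fun x => by
      have := x.2
      simp [hp] at this
    let j : HGraph.ShapeIso ⟨V, E, vl, el, s, t, i, o⟩ (D.plug fun e => (el e).slot σ) :=
      { onV := ⟨.inl, fun | .inl x => x | .inr y => (hno y.1).elim, fun _ => rfl, by
          rintro (x | y)
          · rfl
          · exact (hno y.1).elim⟩
        onE := ⟨fun e => .inl ⟨e, hp e⟩, fun | .inl x => x.1 | .inr y => (hno y.1).elim,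
          fun _ => rfl, by
          rintro (x | y)
          · rfl
          · exact (hno y.1).elim⟩
        vertexLabel := fun _ => rfl
        src := fun _ => rfl
        tgt := fun _ => rfl
        ins := rfl
        outs := rfl }
    exact .box j fun e => ih e (hd e)

/-! ### Interaction rules in terms of inserted tokens -/

/-- Replace the label of an edge. -/
@[reducible]
noncomputable def HGraph.relabel (C : Net 𝕆) (e : C.E) (l : Lab 𝕆) : Net 𝕆 :=
  { C with edgeLabel := open Classical in Function.update C.edgeLabel e l }

@[simp]
theorem HGraph.relabel_edgeLabel_self (C : Net 𝕆) (e : C.E) (l : Lab 𝕆) :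
    (C.relabel e l).edgeLabel e = l := by
  simp

theorem HGraph.relabel_edgeLabel_of_ne (C : Net 𝕆) {e e' : C.E} (l : Lab 𝕆) (h : e' ≠ e) :
    (C.relabel e l).edgeLabel e' = C.edgeLabel e' := by
  simp [h]

theorem HGraph.relabel_cases (C : Net 𝕆) (e : C.E) (l : Lab 𝕆) {P : C.E → Lab 𝕆 → Prop}
    (h : P e l) (h' : ∀ e', e' ≠ e → P e' (C.edgeLabel e')) (e' : C.E) :
    P e' ((C.relabel e l).edgeLabel e') := by
  by_cases he : e' = e
  · subst he
    rwa [HGraph.relabel_edgeLabel_self]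
  · rw [HGraph.relabel_edgeLabel_of_ne C l he]
    exact h' e' he

/-- `K` has a `t`-token edge, another edge, labelled `l`, and a single internal vertex. If the
vertices of `C` are mapped by `f`, and the internal vertex to `y`, the sources and targets of these
edges become those obtained by the insertion of a `t`-token at the vertex `v` of `C`, where `l`
labels `e`. -/
structure FillsWithToken (C : Net 𝕆) (e : C.E) (v : C.V) (t : Tok) (l : Lab 𝕆)
    (f : C.V → Option C.V) (y : Option C.V) (K : Net 𝕆) (tk ac : K.E) (b : K.V) : Prop where
  edge : ∀ k, k = tk ∨ k = ac
  ne : tk ≠ ac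
  internal : ∀ w, K.glue (C.src e) (C.tgt e) w = none ↔ w = b
  vertexLabel : y.elim .star C.vertexLabel = K.vertexLabel b
  token : K.edgeLabel tk = .token t
  label : K.edgeLabel ac = l
  src_token : (K.src tk).map (fun w => (K.glue (C.src e) (C.tgt e) w).elim y f) = [some v]
  tgt_token : (K.tgt tk).map (fun w => (K.glue (C.src e) (C.tgt e) w).elim y f) = [none]
  src_edge : (K.src ac).map (fun w => (K.glue (C.src e) (C.tgt e) w).elim y f) =
    (C.src e).map (splitAt v)
  tgt_edge : (K.tgt ac).map (fun w => (K.glue (C.src e) (C.tgt e) w).elim y f) =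
    (C.tgt e).map some

/-- The plugged net has one vertex more than `C`, the internal vertex of the rule. The hypotheses on
`f` and `y` make these vertices correspond bijectively to those of `Option C.V`, and ask `f` to act
like an insertion at `v` away from `e`. Leaving `f` and `y` free covers both kinds of rules: the
internal vertex may be the target of the token or its source. -/
theorem HGraph.fill_iso_relabel_insertToken {C K : Net 𝕆} {e : C.E} {χ : HoleLab}
    (hC : IsSimpleContext C e χ) {v : C.V} {t : Tok} {l : Lab 𝕆}
    {f : C.V → Option C.V} {y : Option C.V}
    (hK : ∃ tk ac b, FillsWithToken C e v t l f y K tk ac b)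
    (hf : Function.Injective f) (hy : ∀ x, f x ≠ y)
    (hsurj : ∀ z, z = y ∨ ∃ x, f x = z)
    (hlab : ∀ x, (f x).elim .star C.vertexLabel = C.vertexLabel x)
    (hsrc : ∀ e', e' ≠ e → (C.src e').map f = (C.src e').map (splitAt v))
    (htgt : ∀ e', e' ≠ e → (C.tgt e').map f = (C.tgt e').map some)
    (hins : C.ins.map f = C.ins.map some) (houts : C.outs.map f = C.outs.map (splitAt v)) :
    (C.fill fun _ => some K).Iso ((C.relabel e l).insertToken v t) := by
  classical
  let D : Net 𝕆 := { C with edgeLabel := fun e => (C.edgeLabel e).fill fun _ => some K }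
  let p : C.E → Option (Net 𝕆) := fun e => (C.edgeLabel e).slot fun _ => some K
  have hnh : ∀ e', e' ≠ e → IsEmpty ((C.edgeLabel e').Occ Lab.IsHole) := by
    intro e' he'
    refine ⟨fun o => he' ?_⟩
    exact congrArg Sigma.fst (hC.single.elim (⟨e', o⟩ : C.Occ Lab.IsHole)
      ⟨e, .here ⟨χ, hC.edgeLabel_eq⟩⟩)
  have hpe : p e = some K := by simp [p, hC.edgeLabel_eq, Lab.slot]
  have hpn : ∀ e', e' ≠ e → p e' = none := by
    intro e' he'
    rcases h : C.edgeLabel e' with _ | _ | _ | _ | _ | _ | χ | _ <;> simp only [p, h, Lab.slot]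
    exact (hnh e' he').elim (.here ⟨χ, h⟩)
  have hslot : ∀ x : D.Slot p, x.1 = e := by
    rintro ⟨x, hx⟩
    by_contra h
    simp [hpn x h] at hx
  let x₀ : D.Slot p := ⟨e, by rw [hpe]; rfl⟩
  have hx₀ : ∀ x : D.Slot p, x = x₀ := fun x => Subtype.ext (hslot x)
  have hnet : x₀.net = K := by simp [x₀, HGraph.Slot.net, hpe]
  -- `x₀.net` is only propositionally equal to `K`. Transporting the existential statement first
  -- gives edges and vertices that live in `x₀.net` itself, without casts.
  rw [← hnet] at hK
  obtain ⟨tk, ac, b, hE, hne, hb, hlaby, htk, hac, hstk, httk, hsac, htac⟩ := hK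
  let gl : x₀.net.V → Option C.V := fun w => x₀.net.glue (C.src e) (C.tgt e) w
  let F : D.PlugV p → Option C.V := fun
    | .inl x => f x
    | .inr _ => y
  have hF : Function.Bijective F := by
    constructor
    · rintro (x | ⟨x, w, hw⟩) (x' | ⟨x', w', hw'⟩) h
      · exact congrArg _ (hf h)
      · exact (hy _ h).elim
      · exact (hy _ h.symm).elim
      · obtain rfl := hx₀ x
        obtain rfl := hx₀ x'
        obtain rfl := (hb w).1 hw
        obtain rfl := (hb w').1 hw'
        rfl
    · intro z
      rcases hsurj z with rfl | ⟨x, rfl⟩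
      · exact ⟨.inr ⟨x₀, b, (hb b).2 rfl⟩, rfl⟩
      · exact ⟨.inl x, rfl⟩
  have hmap : ∀ w : x₀.net.V, F (D.plugMap p x₀ w) = (gl w).elim y f := by
    intro w
    rcases h : gl w with _ | a
    · rw [HGraph.plugMap_of_none h]
      rfl
    · rw [HGraph.plugMap_of_some h]
      rfl
  let gE : x₀.net.E → Option C.E := fun k => if k = tk then none else some e
  have hgtk : gE tk = none := if_pos rfl
  have hgac : gE ac = some e := if_neg hne.symm
  let g : (D.plug p).E → Option C.E := fun
    | .inl e' => some e'.1
    | .inr ⟨x, k⟩ => gE (hx₀ x ▸ k)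
  have hg₀ : ∀ k, g (.inr ⟨x₀, k⟩) = gE k := fun k => rfl
  have hg : Function.Bijective g := by
    constructor
    · rintro (⟨z, hz⟩ | ⟨x, k⟩) (⟨z', hz'⟩ | ⟨x', k'⟩) h
      · obtain rfl : z = z' := Option.some.inj h
        rfl
      · obtain rfl := hx₀ x'
        rw [hg₀] at h
        rcases hE k' with rfl | rfl
        · rw [hgtk] at h
          cases h
        · rw [hgac] at h
          obtain rfl : z = e := Option.some.inj h
          rw [hpe] at hz
          cases hz
      · obtain rfl := hx₀ x
        rw [hg₀] at h
        rcases hE k with rfl | rfl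
        · rw [hgtk] at h
          cases h
        · rw [hgac] at h
          obtain rfl : e = z' := Option.some.inj h
          rw [hpe] at hz'
          cases hz'
      · obtain rfl := hx₀ x
        obtain rfl := hx₀ x'
        rw [hg₀, hg₀] at h
        rcases hE k with rfl | rfl <;> rcases hE k' with rfl | rfl
        · rfl
        · rw [hgtk, hgac] at h
          cases h
        · rw [hgtk, hgac] at h
          cases h
        · rfl
    · rintro (_ | e')
      · exact ⟨.inr ⟨x₀, tk⟩, hgtk⟩
      · by_cases h : e' = e
        · subst h
          exact ⟨.inr ⟨x₀, ac⟩, hgac⟩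
        · exact ⟨.inl ⟨e', hpn e' h⟩, rfl⟩
  have hne' : ∀ e' : { e' : D.E // p e' = none }, e'.1 ≠ e := by
    rintro ⟨e', he'⟩ rfl
    rw [hpe] at he'
    cases he'
  refine ⟨⟨Equiv.ofBijective F hF, Equiv.ofBijective g hg, ?_, ?_, ?_, ?_, ?_⟩, ?_⟩
  · rintro (x | ⟨x, w, hw⟩)
    · exact hlab x
    · obtain rfl := hx₀ x
      obtain rfl := (hb w).1 hw
      exact hlaby
  · rintro (e' | ⟨x, k⟩)
    · refine Eq.trans ?_ List.map_map.symm
      exact (hsrc e'.1 (hne' e')).symm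
    · obtain rfl := hx₀ x
      refine Eq.trans ?_ List.map_map.symm
      refine Eq.trans ?_ (List.map_congr_left fun w _ => (hmap w).symm)
      change ((C.relabel e l).insertToken v t).src (gE k) = _
      rcases hE k with rfl | rfl
      · rw [hgtk]
        exact hstk.symm
      · rw [hgac]
        exact hsac.symm
  · rintro (e' | ⟨x, k⟩)
    · refine Eq.trans ?_ List.map_map.symm
      exact (htgt e'.1 (hne' e')).symm
    · obtain rfl := hx₀ x
      refine Eq.trans ?_ List.map_map.symm
      refine Eq.trans ?_ (List.map_congr_left fun w _ => (hmap w).symm)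
      change ((C.relabel e l).insertToken v t).tgt (gE k) = _
      rcases hE k with rfl | rfl
      · rw [hgtk]
        exact httk.symm
      · rw [hgac]
        exact htac.symm
  · refine Eq.trans ?_ List.map_map.symm
    exact hins.symm
  · refine Eq.trans ?_ List.map_map.symm
    exact houts.symm
  · rintro (e' | ⟨x, k⟩)
    · change Lab.Iso ((C.edgeLabel e'.1).fill _) ((C.relabel e l).edgeLabel e'.1)
      rw [HGraph.relabel_edgeLabel_of_ne C l (hne' e')]
      exact (Lab.iso_fill (hC.isContext.1.2 _) (hnh _ (hne' e')) _).symm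
    · obtain rfl := hx₀ x
      change Lab.Iso (x₀.net.edgeLabel k) (((C.relabel e l).insertToken v t).edgeLabel (gE k))
      rcases hE k with rfl | rfl
      · rw [hgtk, htk]
        exact .refl _
      · rw [hgac, hac]
        change Lab.Iso _ ((C.relabel e l).edgeLabel e)
        rw [HGraph.relabel_edgeLabel_self]
        exact .refl _

/-- The token precedes the edge, so the internal vertex is the target of the token, that is, the new
vertex `none`. -/
theorem HGraph.fill_iso_of_mem_src {C K : Net 𝕆} {e : C.E} {χ : HoleLab}
    (hC : IsSimpleContext C e χ) {v : C.V} {t : Tok} {l : Lab 𝕆} (hv : v ∈ C.src e)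
    (hK : ∃ tk ac b, FillsWithToken C e v t l some none K tk ac b) :
    (C.fill fun _ => some K).Iso ((C.relabel e l).insertToken v t) := by
  have hP := hC.isContext.1.1
  refine HGraph.fill_iso_relabel_insertToken hC hK (Option.some_injective _) (by simp) ?_ ?_ ?_ ?_
    rfl ?_
  · rintro (_ | x) <;> simp
  · exact fun _ => rfl
  · exact fun e' he' => (map_splitAt_of_notMem fun h => he' (hP.src_unique _ _ _ h hv)).symm
  · exact fun _ _ => rfl
  · exact (map_splitAt_of_notMem fun h => (hP.mem_outs _).1 h _ hv).symm

/-- The token follows the edge, so the internal vertex is the source of the token and takes over the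
name `some v`, while the vertex `v` of the context becomes the target `none`. -/
theorem HGraph.fill_iso_of_mem_tgt {C K : Net 𝕆} {e : C.E} {χ : HoleLab}
    (hC : IsSimpleContext C e χ) {v : C.V} {t : Tok} {l : Lab 𝕆} (hv : v ∈ C.tgt e)
    (hl : C.vertexLabel v = .star)
    (hK : ∃ tk ac b, FillsWithToken C e v t l (splitAt v) (some v) K tk ac b) :
    (C.fill fun _ => some K).Iso ((C.relabel e l).insertToken v t) := by
  have hP := hC.isContext.1.1
  refine HGraph.fill_iso_relabel_insertToken hC hK (splitAt_injective v) ?_ ?_ ?_ ?_ ?_ ?_ rfl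
  · intro x h
    by_cases hx : x = v
    · simp [hx] at h
    · rw [splitAt_of_ne hx] at h
      exact hx (Option.some.inj h)
  · rintro (_ | x)
    · exact .inr ⟨v, splitAt_self v⟩
    · by_cases hx : x = v
      · exact .inl (by rw [hx])
      · exact .inr ⟨x, splitAt_of_ne hx⟩
  · intro x
    by_cases hx : x = v
    · simp [hx, hl]
    · simp [splitAt_of_ne hx]
  · exact fun _ _ => rfl
  · exact fun e' he' => map_splitAt_of_notMem fun h => he' (hP.tgt_unique _ _ _ h hv)
  · exact map_splitAt_of_notMem fun h => (hP.mem_ins _).1 h _ hv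

theorem IsSimpleContext.length_src {C K : Net 𝕆} {e : C.E} {χ : HoleLab}
    (hC : IsSimpleContext C e χ) (hK : K.HasType χ.dom χ.cod) :
    (C.src e).length = K.ins.length := by
  have h := hC.isContext.1.1.src_typed e
  rw [hC.edgeLabel_eq] at h
  simpa using congrArg List.length (h.trans hK.1.symm)

theorem IsSimpleContext.length_tgt {C K : Net 𝕆} {e : C.E} {χ : HoleLab}
    (hC : IsSimpleContext C e χ) (hK : K.HasType χ.dom χ.cod) :
    (C.tgt e).length = K.outs.length := by
  have h := hC.isContext.1.1.tgt_typed e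
  rw [hC.edgeLabel_eq] at h
  simpa using congrArg List.length (h.trans hK.2.symm)

/-- In a list without repetitions `v` occurs at `i` only, so changing this single entry is the same
as splitting at `v` throughout. -/
theorem set_none_map_some {V : Type} {s : List V} {i : ℕ} {v : V} (hs : s.Nodup)
    (hv : s[i]? = some v) : (s.map some).set i none = s.map (splitAt v) := by
  obtain ⟨hi, rfl⟩ := List.getElem?_eq_some_iff.1 hv
  refine List.ext_getElem (by simp) fun k h₁ h₂ => ?_
  simp only [List.length_map] at h₂
  simp only [List.getElem_set, List.getElem_map]
  split_ifs with h
  · subst h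
    simp
  · exact (splitAt_of_ne fun h' => h ((hs.getElem_inj_iff.1 h').symm)).symm

theorem set_some_map_splitAt {V : Type} {s : List V} {i : ℕ} {v : V} (hs : s.Nodup)
    (hv : s[i]? = some v) : (s.map (splitAt v)).set i (some v) = s.map some := by
  obtain ⟨hi, rfl⟩ := List.getElem?_eq_some_iff.1 hv
  refine List.ext_getElem (by simp) fun k h₁ h₂ => ?_
  simp only [List.length_map] at h₂
  simp only [List.getElem_set, List.getElem_map]
  split_ifs with h
  · subst h
    rfl
  · exact splitAt_of_ne fun h' => h ((hs.getElem_inj_iff.1 h').symm)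

/-- The shape shared by all interaction rules: an edge `tk` (the token), another edge `ac`, and an
internal vertex `b`. -/
structure IsRuleNet (K : Net 𝕆) (t : Tok) (l : Lab 𝕆) (tk ac : K.E) (b : K.V) : Prop where
  edge : ∀ k, k = tk ∨ k = ac
  ne : tk ≠ ac
  ins_nodup : K.ins.Nodup
  outs_nodup : K.outs.Nodup
  disjoint : ∀ w ∈ K.outs, w ∉ K.ins
  not_ins : b ∉ K.ins
  not_outs : b ∉ K.outs
  vertex : ∀ w, w ∈ K.ins ∨ w ∈ K.outs ∨ w = b
  vertexLabel : K.vertexLabel b = .star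
  token : K.edgeLabel tk = .token t
  label : K.edgeLabel ac = l

theorem IsRuleNet.glue_eq_none_iff {K : Net 𝕆} {t : Tok} {l : Lab 𝕆} {tk ac : K.E} {b : K.V}
    (hK : IsRuleNet K t l tk ac b) {V : Type} {s s' : List V} (hs : s.length = K.ins.length)
    (hs' : s'.length = K.outs.length) (w : K.V) : K.glue s s' w = none ↔ w = b := by
  constructor
  · intro h
    rcases hK.vertex w with hw | hw | hw
    · have := List.mem_map_of_mem (f := K.glue s s') hw
      rw [HGraph.map_glue_ins hK.ins_nodup hs, h] at this
      simp at this
    · have := List.mem_map_of_mem (f := K.glue s s') hw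
      rw [HGraph.map_glue_outs hK.outs_nodup hK.disjoint hs', h] at this
      simp at this
    · exact hw
  · rintro rfl
    exact HGraph.glue_eq_none hK.not_ins hK.not_outs

/-- Rules in which the token precedes the other edge. -/
theorem HGraph.fill_iso_of_token_before {C K : Net 𝕆} {e : C.E} {χ : HoleLab}
    (hC : IsSimpleContext C e χ) (hT : K.HasType χ.dom χ.cod) {v : C.V} {t : Tok} {l : Lab 𝕆}
    {tk ac : K.E} {a b : K.V} {i : ℕ} (hK : IsRuleNet K t l tk ac b)
    (hst : K.src tk = [a]) (htt : K.tgt tk = [b]) (ha : K.ins[i]? = some a)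
    (hsa : K.src ac = K.ins.set i b) (hta : K.tgt ac = K.outs) (hv : (C.src e)[i]? = some v) :
    (C.fill fun _ => some K).Iso ((C.relabel e l).insertToken v t) := by
  have hin := HGraph.map_glue_ins (H := K) (t := C.tgt e) hK.ins_nodup (hC.length_src hT)
  have hout := HGraph.map_glue_outs (H := K) (s := C.src e) hK.outs_nodup hK.disjoint
    (hC.length_tgt hT)
  have hb : K.glue (C.src e) (C.tgt e) b = none := HGraph.glue_eq_none hK.not_ins hK.not_outs
  have hga : K.glue (C.src e) (C.tgt e) a = some v := by
    have := congrArg (fun l => l[i]?) hin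
    simpa [ha, hv] using this
  have hcomp : (fun w => (K.glue (C.src e) (C.tgt e) w).elim none some) =
      (fun w : Option C.V => w.elim none some) ∘ K.glue (C.src e) (C.tgt e) := rfl
  have hid : (fun w : Option C.V => w.elim none some) ∘ some = some := rfl
  refine HGraph.fill_iso_of_mem_src hC (List.mem_of_getElem? hv) ⟨tk, ac, b, hK.edge, hK.ne,
    hK.glue_eq_none_iff (hC.length_src hT) (hC.length_tgt hT), hK.vertexLabel.symm, hK.token,
    hK.label, ?_, ?_, ?_, ?_⟩
  · simp [hst, hga]
  · simp [htt, hb]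
  · rw [hsa, List.map_set, hcomp, ← List.map_map, hin, List.map_map, hid, hb]
    exact set_none_map_some (hC.isContext.1.1.src_nodup e) hv
  · rw [hta, hcomp, ← List.map_map, hout, List.map_map, hid]

/-- Rules in which the token follows the other edge. -/
theorem HGraph.fill_iso_of_token_after {C K : Net 𝕆} {e : C.E} {χ : HoleLab}
    (hC : IsSimpleContext C e χ) (hT : K.HasType χ.dom χ.cod) {v : C.V} {t : Tok} {l : Lab 𝕆}
    {tk ac : K.E} {a b : K.V} {i : ℕ} (hK : IsRuleNet K t l tk ac b)
    (hst : K.src tk = [b]) (htt : K.tgt tk = [a]) (ha : K.outs[i]? = some a)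
    (hsa : K.src ac = K.ins) (hta : K.tgt ac = K.outs.set i b) (hv : (C.tgt e)[i]? = some v)
    (hl : C.vertexLabel v = .star) :
    (C.fill fun _ => some K).Iso ((C.relabel e l).insertToken v t) := by
  have hin := HGraph.map_glue_ins (H := K) (t := C.tgt e) hK.ins_nodup (hC.length_src hT)
  have hout := HGraph.map_glue_outs (H := K) (s := C.src e) hK.outs_nodup hK.disjoint
    (hC.length_tgt hT)
  have hb : K.glue (C.src e) (C.tgt e) b = none := HGraph.glue_eq_none hK.not_ins hK.not_outs
  have hga : K.glue (C.src e) (C.tgt e) a = some v := by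
    have := congrArg (fun l => l[i]?) hout
    simpa [ha, hv] using this
  have hcomp : (fun w => (K.glue (C.src e) (C.tgt e) w).elim (some v) (splitAt v)) =
      (fun w : Option C.V => w.elim (some v) (splitAt v)) ∘ K.glue (C.src e) (C.tgt e) := rfl
  have hid : (fun w : Option C.V => w.elim (some v) (splitAt v)) ∘ some = splitAt v := rfl
  refine HGraph.fill_iso_of_mem_tgt hC (List.mem_of_getElem? hv) hl ⟨tk, ac, b, hK.edge, hK.ne,
    hK.glue_eq_none_iff (hC.length_src hT) (hC.length_tgt hT), ?_, hK.token,
    hK.label, ?_, ?_, ?_, ?_⟩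
  · simp [hK.vertexLabel, hl]
  · simp [hst, hb]
  · simp [htt, hga]
  · rw [hsa, hcomp, ← List.map_map, hin, List.map_map, hid]
  · rw [hta, List.map_set, hcomp, ← List.map_map, hout, List.map_map, hid, hb]
    exact set_some_map_splitAt (hC.isContext.1.1.tgt_nodup e) hv

/-! ### The nets of the interaction rules, plugged into simple contexts -/

theorem RuleV.y_injective (n : ℕ) : Function.Injective (RuleV.y : Fin n → RuleV n) :=
  fun _ _ h => RuleV.y.inj h

theorem tokOp_isRuleNet (φ : 𝕆.Op) (t : Tok) :
    IsRuleNet (tokOp φ t) t (.op φ) RuleE.tok RuleE.act RuleV.b := by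
  unfold tokOp
  refine ⟨?_, by simp, List.nodup_singleton _, (List.nodup_finRange _).map (RuleV.y_injective _),
    ?_, by simp, by simp, ?_, rfl, rfl, rfl⟩
  · rintro (_ | _) <;> simp
  · simp
  · rintro (_ | _ | _) <;> simp

theorem opTok_isRuleNet (φ : 𝕆.Op) (j : Fin (𝕆.cod φ).length) (t : Tok) :
    IsRuleNet (opTok φ j t) t (.op φ) RuleE.tok RuleE.act RuleV.b := by
  unfold opTok
  refine ⟨?_, by simp, List.nodup_singleton _, (List.nodup_finRange _).map (RuleV.y_injective _),
    ?_, by simp, by simp, ?_, rfl, rfl, rfl⟩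
  · rintro (_ | _) <;> simp
  · simp
  · rintro (_ | _ | _) <;> simp

theorem tokInst_isRuleNet (t : Tok) :
    IsRuleNet (tokInst t : Net 𝕆) t .inst RuleE.tok RuleE.act RuleV.b := by
  unfold tokInst
  refine ⟨?_, by simp, List.nodup_singleton _, List.nodup_singleton _,
    by simp, by simp, by simp, ?_, rfl, rfl, rfl⟩
  · rintro (_ | _) <;> simp
  · rintro (_ | _ | i) <;> simp [Subsingleton.elim _ (0 : Fin 1)]

theorem tokContr_isRuleNet (left : Bool) (t : Tok) :
    IsRuleNet (tokContr left t : Net 𝕆) t (.contr .star) RuleE.tok RuleE.act RuleV.b := by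
  unfold tokContr
  cases left
  all_goals
    refine ⟨?_, by simp, by simp, List.nodup_singleton _,
      by simp, by simp, by simp, ?_, rfl, rfl, rfl⟩
    · rintro (_ | _) <;> simp
    · rintro (_ | _ | i)
      · simp
      · simp
      · fin_cases i <;> simp

theorem HGraph.fill_tokOp_iso {C : Net 𝕆} {e : C.E} {χ : HoleLab} (hC : IsSimpleContext C e χ)
    {φ : 𝕆.Op} {t : Tok} (hT : (tokOp φ t).HasType χ.dom χ.cod) {v : C.V}
    (hv : (C.src e)[0]? = some v) :
    (C.fill fun _ => some (tokOp φ t)).Iso ((C.relabel e (.op φ)).insertToken v t) :=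
  HGraph.fill_iso_of_token_before hC hT (tokOp_isRuleNet φ t) (a := RuleV.a) rfl rfl rfl rfl rfl hv

theorem HGraph.fill_tokInst_iso {C : Net 𝕆} {e : C.E} {χ : HoleLab} (hC : IsSimpleContext C e χ)
    {t : Tok} (hT : (tokInst t : Net 𝕆).HasType χ.dom χ.cod) {v : C.V}
    (hv : (C.src e)[0]? = some v) :
    (C.fill fun _ => some (tokInst t)).Iso ((C.relabel e .inst).insertToken v t) :=
  HGraph.fill_iso_of_token_before hC hT (tokInst_isRuleNet t) (a := RuleV.a) rfl rfl rfl rfl rfl hv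

theorem HGraph.fill_tokContr_iso {C : Net 𝕆} {e : C.E} {χ : HoleLab} (hC : IsSimpleContext C e χ)
    {t : Tok} {left : Bool} (hT : (tokContr left t : Net 𝕆).HasType χ.dom χ.cod) {v : C.V}
    (hv : (C.src e)[if left then 0 else 1]? = some v) :
    (C.fill fun _ => some (tokContr left t)).Iso
      ((C.relabel e (.contr .star)).insertToken v t) := by
  cases left
  all_goals
    exact HGraph.fill_iso_of_token_before hC hT (tokContr_isRuleNet _ t) (a := RuleV.a) rfl rfl rfl
      rfl rfl hv

theorem HGraph.fill_opTok_iso {C : Net 𝕆} {e : C.E} {χ : HoleLab} (hC : IsSimpleContext C e χ)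
    {φ : 𝕆.Op} {j : Fin (𝕆.cod φ).length} {t : Tok} (hT : (opTok φ j t).HasType χ.dom χ.cod)
    {v : C.V} (hv : (C.tgt e)[j.1]? = some v) (hl : C.vertexLabel v = .star) :
    (C.fill fun _ => some (opTok φ j t)).Iso ((C.relabel e (.op φ)).insertToken v t) := by
  refine HGraph.fill_iso_of_token_after hC hT (opTok_isRuleNet φ j t) (a := RuleV.y j) rfl rfl ?_
    rfl ?_ hv hl
  · unfold opTok
    simp
  · unfold opTok
    refine List.ext_getElem (by simp) fun k h₁ h₂ => ?_
    simp only [List.getElem_set, List.getElem_map, List.getElem_finRange, Fin.ext_iff, Fin.val_cast]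
    by_cases h : k = j.1 <;> simp [h, eq_comm]

/-! ### States as nets with an inserted token -/

theorem elim_comp_splitAt {V L : Type} {f : V → L} {v : V} {a : L} (h : f v = a) :
    (fun x : Option V => x.elim a f) ∘ splitAt v = f := by
  funext x
  by_cases hx : x = v
  · simp [hx, h]
  · simp [splitAt_of_ne hx]

theorem HGraph.Proper.insertToken {U : Net 𝕆} (h : U.Proper) {v : U.V}
    (hl : U.vertexLabel v = .star) (t : Tok) : (U.insertToken v t).Proper := by
  have := h.finite_V
  have := h.finite_E
  have hlab := elim_comp_splitAt hl
  have hlab' : (fun x : Option U.V => x.elim VLab.star U.vertexLabel) ∘ some = U.vertexLabel := rfl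
  refine ⟨inferInstanceAs (Finite (Option U.V)), inferInstanceAs (Finite (Option U.E)),
    ?_, ?_, ?_, ?_, ?_, ?_, ?_, ?_, ?_, ?_, ?_⟩
  · rintro (_ | e)
    · exact List.nodup_singleton _
    · exact (h.src_nodup e).map (splitAt_injective v)
  · rintro (_ | e)
    · exact List.nodup_singleton _
    · exact (h.tgt_nodup e).map (Option.some_injective _)
  · rintro (_ | x) (_ | e) (_ | e') he he'
    all_goals
      simp only [Option.elim_none, Option.elim_some, none_mem_map_splitAt,
        some_mem_map_splitAt] at he he'
    · rfl
    · simp at he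
    · simp at he'
    · exact congrArg _ (h.src_unique _ _ _ he he')
    · rfl
    · exact absurd (by simpa using he) he'.2
    · exact absurd (by simpa using he') he.2
    · exact congrArg _ (h.src_unique _ _ _ he.1 he'.1)
  · rintro (_ | x) (_ | e) (_ | e') he he' <;> simp at he he'
    · rfl
    · exact congrArg _ (h.tgt_unique _ _ _ he he')
  · rintro (_ | e)
    · simp [hl, Lab.dom]
    · simp only [Option.elim_some, List.map_map, hlab, h.src_typed]
  · rintro (_ | e)
    · simp [Lab.cod]
    · simp only [Option.elim_some, List.map_map, hlab', h.tgt_typed]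
  · exact h.ins_nodup.map (Option.some_injective _)
  · exact h.outs_nodup.map (splitAt_injective v)
  · rintro (_ | x)
    · simp only [Option.forall]
      simp
    · simp only [Option.forall]
      simp [h.mem_ins]
  · rintro (_ | x)
    · simp only [Option.forall, Option.elim_none, Option.elim_some, none_mem_map_splitAt,
        h.mem_outs]
      simp
    · simp only [Option.forall, Option.elim_none, Option.elim_some, some_mem_map_splitAt,
        h.mem_outs, List.mem_singleton, Option.some.injEq, not_and, not_not]
      constructor
      · exact fun ⟨h₁, h₂⟩ => ⟨h₂, fun e he => absurd he (h₁ e)⟩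
      · exact fun ⟨h₁, h₂⟩ => ⟨fun e he => h₁ (h₂ e he), h₁⟩
  · rintro (_ | x)
    · simp
    · simp only [some_mem_map_splitAt]
      intro hx hx'
      exact h.ins_outs x (by simpa using hx) hx'.1

/-- The hypothesis `hx` is what `Token.not_exposed` provides. A vertex that is both an input and an
output is forbidden in `U`, but inserting a token there separates the input from the output and
hides the defect. -/
theorem HGraph.Proper.of_insertToken {U : Net 𝕆} {v : U.V} {t : Tok}
    (h : (U.insertToken v t).Proper) (hx : ¬ (v ∈ U.ins ∧ v ∈ U.outs)) :
    U.Proper ∧ U.vertexLabel v = .star := by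
  have h₁ := h.finite_V
  have h₂ := h.finite_E
  have hl : U.vertexLabel v = .star := by
    simpa [Lab.dom] using h.src_typed none
  have hlab := elim_comp_splitAt hl
  have hlab' : (fun x : Option U.V => x.elim VLab.star U.vertexLabel) ∘ some = U.vertexLabel := rfl
  have hsi : ∀ {x : U.V} {l : List U.V}, x ∈ l → splitAt v x ∈ l.map (splitAt v) :=
    fun hx => List.mem_map_of_mem hx
  have hsi' : ∀ {x : U.V} {l : List U.V}, splitAt v x ∈ l.map (splitAt v) → x ∈ l :=
    fun hx => (List.mem_map_of_injective (splitAt_injective v)).1 hx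
  have hso : ∀ {x : U.V} {l : List U.V}, x ∈ l → some x ∈ l.map some :=
    fun hx => List.mem_map_of_mem hx
  have hso' : ∀ {x : U.V} {l : List U.V}, some x ∈ l.map some → x ∈ l :=
    fun hx => (List.mem_map_of_injective (Option.some_injective _)).1 hx
  refine ⟨⟨@Finite.of_injective U.V (Option U.V) h₁ some (Option.some_injective _),
    @Finite.of_injective U.E (Option U.E) h₂ some (Option.some_injective _),
    ?_, ?_, ?_, ?_, ?_, ?_, ?_, ?_, ?_, ?_, ?_⟩, hl⟩
  · exact fun e => (h.src_nodup (some e)).of_map _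
  · exact fun e => (h.tgt_nodup (some e)).of_map _
  · exact fun x e e' he he' => Option.some.inj
      (h.src_unique (splitAt v x) (some e) (some e') (hsi he) (hsi he'))
  · exact fun x e e' he he' => Option.some.inj
      (h.tgt_unique (some x) (some e) (some e') (hso he) (hso he'))
  · intro e
    have := h.src_typed (some e)
    simpa only [Option.elim_some, List.map_map, hlab] using this
  · intro e
    have := h.tgt_typed (some e)
    simpa only [Option.elim_some, List.map_map, hlab'] using this
  · exact h.ins_nodup.of_map _
  · exact h.outs_nodup.of_map _
  · intro x
    have := h.mem_ins (some x)
    simp only [Option.forall] at this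
    simpa using this
  · intro x
    constructor
    · exact fun ho e he => (h.mem_outs (splitAt v x)).1 (hsi ho) (some e) (hsi he)
    · intro he
      refine hsi' ((h.mem_outs (splitAt v x)).2 ?_)
      rintro (_ | e) he'
      · simp only [Option.elim_none, List.mem_singleton] at he'
        by_cases hx : x = v
        · simp [hx] at he'
        · rw [splitAt_of_ne hx] at he'
          exact hx (Option.some.inj he')
      · exact he e (hsi' he')
  · intro x hi ho
    by_cases hxv : x = v
    · subst hxv
      exact hx ⟨hi, ho⟩
    · exact h.ins_outs (some x) (hso hi) (splitAt_of_ne hxv ▸ hsi ho)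

theorem HGraph.HasType.of_insertToken {U : Net 𝕆} {v : U.V} {t : Tok} {I O : List VLab}
    (h : (U.insertToken v t).HasType I O) (hl : U.vertexLabel v = .star) : U.HasType I O := by
  have hlab := elim_comp_splitAt hl
  have hlab' : (fun x : Option U.V => x.elim VLab.star U.vertexLabel) ∘ some = U.vertexLabel := rfl
  have h₁ := h.1
  have h₂ := h.2
  simp only [List.map_map, hlab, hlab'] at h₁ h₂
  exact ⟨h₁, h₂⟩

theorem HGraph.HasType.insertToken {U : Net 𝕆} {v : U.V} {I O : List VLab}
    (h : U.HasType I O) (hl : U.vertexLabel v = .star) (t : Tok) :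
    (U.insertToken v t).HasType I O := by
  have hlab := elim_comp_splitAt hl
  have hlab' : (fun x : Option U.V => x.elim VLab.star U.vertexLabel) ∘ some = U.vertexLabel := rfl
  constructor
  · simp only [List.map_map, hlab', h.1]
  · simp only [List.map_map, hlab, h.2]

/-- The token of `U.insertToken v t`. -/
noncomputable def HGraph.FocusFree.token {U : Net 𝕆} (h : U.FocusFree) {v : U.V}
    (hv : v ∈ U.ins → v ∉ U.outs) (t : Tok) : Token (U.insertToken v t) where
  edge := none
  lab := t
  s := some v
  t := none
  edgeLabel_eq := rfl
  src_eq := rfl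
  tgt_eq := rfl
  unique := by
    rintro (_ | e) he
    · exact absurd rfl he
    · exact ⟨fun o => h.elim ⟨e, o⟩⟩
  acyclic := by simp
  not_exposed := by
    rintro ⟨h₁, h₂⟩
    exact hv (by simpa using h₁) (none_mem_map_splitAt.1 h₂)

/-- Focus-free nets without holes, of type `⋆ ⇒ ε`. -/
structure IsPlain (W : Net 𝕆) : Prop where
  wf : W.WF
  holeFree : W.HoleFree
  focusFree : W.FocusFree
  type : W.HasType [.star] []

theorem IsPlain.isState {W : Net 𝕆} (hW : IsPlain W) {v : W.V} (hl : W.vertexLabel v = .star)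
    (t : Tok) : IsState (W.insertToken v t).cls := by
  refine ⟨_, rfl, ⟨hW.wf.1.insertToken hl t, ?_⟩, ?_, ⟨hW.focusFree.token (hW.wf.1.ins_outs v) t⟩,
    hW.type.insertToken hl t⟩
  · rintro (_ | e)
    · exact .token t
    · exact hW.wf.2 e
  · refine ⟨?_⟩
    rintro ⟨_ | e, o⟩
    · cases o with
      | here h => simp [Lab.IsHole] at h
    · exact hW.holeFree.elim ⟨e, o⟩

/-- Some representative of the class has a token with all the properties required of one. Its image
can only be the inserted edge, since every other edge is free of tokens; so `W` is focus-free, and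
non-exposure of the token transfers to `v`. -/
theorem IsPlain.of_isState {W : Net 𝕆} {v : W.V} {t : Tok}
    (h : IsState (W.insertToken v t).cls) : IsPlain W ∧ W.vertexLabel v = .star := by
  obtain ⟨G, hG, hwf, hh, ⟨τ⟩, hty⟩ := h
  have hi := HGraph.cls_eq_iff.1 hG
  have hwf' := hwf.of_iso hi
  have hh' := hi.isEmpty_occ Lab.IsHole.of_iso hh
  obtain ⟨i, hi⟩ := hi
  have hty' := hty.of_shapeIso i
  have hτ : (W.insertToken v t).edgeLabel (i.onE τ.edge) = .token τ.lab :=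
    (hi τ.edge).eq_of_forall_ne_box (by simp [τ.edgeLabel_eq]) |>.trans τ.edgeLabel_eq
  have hun : ∀ e, e ≠ i.onE τ.edge →
      IsEmpty (((W.insertToken v t).edgeLabel e).Occ Lab.IsToken) := by
    intro e he
    obtain ⟨e, rfl⟩ := i.onE.surjective e
    exact (hi e).isEmpty_occ Lab.IsToken.of_iso (τ.unique e fun h => he (h ▸ rfl))
  have hnone : i.onE τ.edge = none := by
    by_contra h
    exact (hun none (Ne.symm h)).elim (.here ⟨t, rfl⟩)
  have hs : i.onV τ.s = some v := by
    have := i.src τ.edge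
    rw [hnone, τ.src_eq] at this
    simpa using this.symm
  have ht : i.onV τ.t = none := by
    have := i.tgt τ.edge
    rw [hnone, τ.tgt_eq] at this
    simpa using this.symm
  have hx : ¬ (v ∈ W.ins ∧ v ∈ W.outs) := by
    rintro ⟨h₁, h₂⟩
    have h₁' : some v ∈ (W.insertToken v t).ins := by simpa using h₁
    have h₂' : none ∈ (W.insertToken v t).outs := none_mem_map_splitAt.2 h₂
    rw [← hs, i.ins, List.mem_map_of_injective i.onV.injective] at h₁'
    rw [← ht, i.outs, List.mem_map_of_injective i.onV.injective] at h₂'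
    exact τ.not_exposed ⟨h₁', h₂'⟩
  obtain ⟨hp, hl⟩ := hwf'.1.of_insertToken hx
  refine ⟨⟨⟨hp, fun e => hwf'.2 (some e)⟩, ⟨fun o => hh'.elim ⟨some o.1, o.2⟩⟩, ?_,
    hty'.of_insertToken hl⟩, hl⟩
  exact ⟨fun o => (hun (some o.1) (by simp [hnone])).elim o.2⟩

theorem IsPlain.of_state {W : Net 𝕆} {v : W.V} {t : Tok} {N : State 𝕆}
    (h : N.1 = (W.insertToken v t).cls) : IsPlain W ∧ W.vertexLabel v = .star :=
  IsPlain.of_isState (h ▸ N.2)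

theorem IsPlain.exists_ins {W : Net 𝕆} (hW : IsPlain W) :
    ∃ r, W.ins = [r] ∧ W.vertexLabel r = .star := by
  have := hW.type.1
  obtain ⟨r, hr, h⟩ := List.map_eq_singleton_iff.1 this
  exact ⟨r, hr, h⟩

/-- By cancellation, the underlying net of any representative is isomorphic to `W`, and this
isomorphism respects the unique input. Restarting the token is thus inserting it at the input of
`W`, whichever representative is used. -/
theorem Token.cls_attach_underlying {W : Net 𝕆} {v r : W.V} {t : Tok} {G : Net 𝕆} (τ : Token G)
    (hG : (W.insertToken v t).cls = G.cls) (hW : IsPlain W) (hl : W.vertexLabel v = .star)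
    (hr : W.ins = [r]) (t' : Tok) :
    (HGraph.attach t' τ.underlying).cls = (W.insertToken r t').cls := by
  have hG' := HGraph.cls_eq_iff.1 hG
  have hGp : G.Proper := by
    obtain ⟨i, hi⟩ := hG'
    exact (hW.wf.1.insertToken hl t).of_iso i hi
  obtain ⟨-, i, hi, -⟩ := HGraph.insertToken_cancel
    ((τ.iso_insertToken hGp).symm.trans hG'.symm) hW.focusFree
  obtain ⟨r', rfl⟩ := i.onV.surjective r
  have hr' : τ.underlying.ins = [r'] := by
    have := i.ins
    rw [hr] at this
    obtain ⟨x, hx, hx'⟩ := List.map_eq_singleton_iff.1 this.symm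
    rw [hx, i.onV.injective hx']
  have hUp : τ.underlying.Proper := hW.wf.1.of_iso i.symm fun e => by
    have := (hi (i.onE.symm e)).symm
    rwa [Equiv.apply_symm_apply] at this
  have hlr : τ.underlying.vertexLabel r' = .star := by
    have := hW.type.1
    rw [hr] at this
    rw [← i.vertexLabel]
    simpa using this
  have hmem : r' ∈ τ.underlying.ins := by simp [hr']
  have hatt := HGraph.attach_iso_insertToken hr' ((hUp.mem_ins _).1 hmem) hlr t'
  exact (HGraph.cls_eq_iff.2 hatt).symm.trans
    (HGraph.cls_eq_iff.2 (HGraph.insertToken_congr i hi r' t'))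

theorem State.isRestart_iff {W : Net 𝕆} {v r : W.V} {t t' : Tok} {N M : State 𝕆}
    (hN : N.1 = (W.insertToken v t).cls) (hr : W.ins = [r]) :
    State.IsRestart t' N M ↔ M.1 = (W.insertToken r t').cls := by
  obtain ⟨hW, hl⟩ := IsPlain.of_state hN
  constructor
  · rintro ⟨G, τ, hG, hM⟩
    rw [hM, τ.cls_attach_underlying (hN.symm.trans hG.symm) hW hl hr]
  · intro hM
    let τ := hW.focusFree.token (hW.wf.1.ins_outs v) t
    exact ⟨_, τ, hN.symm, hM.trans (τ.cls_attach_underlying rfl hW hl hr t').symm⟩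

/-- If inserting at `v` and inserting at the input give isomorphic nets, cancellation yields an
automorphism of `W` that sends `v` to the input; as isomorphisms preserve inputs, `v` is the input
itself. -/
theorem State.isFinal_iff {W : Net 𝕆} {v : W.V} {t : Tok} {N : State 𝕆}
    (hN : N.1 = (W.insertToken v t).cls) : N.IsFinal ↔ t = .value ∧ v ∈ W.ins := by
  obtain ⟨hW, hl⟩ := IsPlain.of_state hN
  obtain ⟨r, hr, -⟩ := hW.exists_ins
  rw [State.IsFinal, State.isRestart_iff hN hr, hN, HGraph.cls_eq_iff]
  constructor
  · intro h
    obtain ⟨rfl, i, hi, rfl⟩ := HGraph.insertToken_cancel h hW.focusFree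
    refine ⟨rfl, ?_⟩
    rw [← List.mem_map_of_injective i.onV.injective, ← i.ins, hr]
    simp
  · rintro ⟨rfl, h⟩
    obtain rfl : v = r := by simpa [hr] using h
    exact HGraph.cls_eq_iff.1 rfl

theorem State.token_eq {W : Net 𝕆} {v : W.V} {t t' : Tok} {N : State 𝕆}
    (hN : N.1 = (W.insertToken v t).cls) {G : Net 𝕆} (hG : G.cls = N.1) {e : G.E}
    (he : G.edgeLabel e = .token t') : t = t' := by
  obtain ⟨hW, hl⟩ := IsPlain.of_state hN
  obtain ⟨i, hi⟩ := HGraph.cls_eq_iff.1 (hG.trans hN)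
  have h : (W.insertToken v t).edgeLabel (i.onE e) = .token t' :=
    ((hi e).eq_of_forall_ne_box (by simp [he])).trans he
  rcases hx : i.onE e with _ | x
  · rw [hx] at h
    exact Lab.token.inj h
  · rw [hx] at h
    exact absurd h (hW.focusFree.edgeLabel_ne x t')

/-! ### Search transitions as moves of the token on a fixed net -/

/-- `Move W e v t v' t'`: interaction with the edge `e` moves a `t`-token at the vertex `v` to the
vertex `v'`, where it becomes a `t'`-token. -/
inductive Move (W : Net 𝕆) (e : W.E) : W.V → Tok → W.V → Tok → Prop
  | contr {v : W.V} (he : W.edgeLabel e = .contr .star) (hv : v ∈ W.src e) :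
      Move W e v .search v .rewrite
  | inst {v : W.V} (he : W.edgeLabel e = .inst) (hv : v ∈ W.src e) :
      Move W e v .search v .value
  | first {v v' : W.V} (φ : 𝕆.Op) (he : W.edgeLabel e = .op φ) (hv : v ∈ W.src e)
      (hv' : (W.tgt e)[0]? = some v') (h : 0 < 𝕆.eager φ) : Move W e v .search v' .search
  | next {v v' : W.V} (φ : 𝕆.Op) (j : ℕ) (he : W.edgeLabel e = .op φ)
      (hv : (W.tgt e)[j]? = some v) (hv' : (W.tgt e)[j + 1]? = some v')
      (h : j + 1 < 𝕆.eager φ) : Move W e v .value v' .search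
  | last {v v' : W.V} (φ : 𝕆.Op) (j : ℕ) (he : W.edgeLabel e = .op φ)
      (hv : (W.tgt e)[j]? = some v) (hv' : v' ∈ W.src e) (h : j + 1 = 𝕆.eager φ) :
      Move W e v .value v' (𝕆.result φ)
  | nullary {v : W.V} (φ : 𝕆.Op) (he : W.edgeLabel e = .op φ) (hv : v ∈ W.src e)
      (h : 𝕆.eager φ = 0) : Move W e v .search v (𝕆.result φ)

/-- Labels need not agree at boxes and holes, since no move interacts with them. This lets the lemma
apply both to isomorphisms, which change box contents, and to plugging, which fills them. -/
theorem Move.map {W W' : Net 𝕆} {e : W.E} {v v' : W.V} {t t' : Tok} (h : Move W e v t v' t')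
    (f : W.V → W'.V) (e' : W'.E) (hs : W'.src e' = (W.src e).map f)
    (ht : W'.tgt e' = (W.tgt e).map f)
    (hl : (∀ b k n G, W.edgeLabel e ≠ .box b k n G) → (∀ χ, W.edgeLabel e ≠ .hole χ) →
      W'.edgeLabel e' = W.edgeLabel e) :
    Move W' e' (f v) t (f v') t' := by
  have hmem : ∀ {x}, x ∈ W.src e → f x ∈ W'.src e' := fun hx => hs ▸ List.mem_map_of_mem hx
  have hget : ∀ {j : ℕ} {x}, (W.tgt e)[j]? = some x → (W'.tgt e')[j]? = some (f x) := fun hx => by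
    simp [ht, hx]
  have hl' : ∀ l, W.edgeLabel e = l → (∀ b k n G, l ≠ .box b k n G) → (∀ χ, l ≠ .hole χ) →
      W'.edgeLabel e' = l := by
    rintro l rfl h₁ h₂
    exact hl h₁ h₂
  cases h with
  | contr he hv => exact .contr (hl' _ he (by simp) (by simp)) (hmem hv)
  | inst he hv => exact .inst (hl' _ he (by simp) (by simp)) (hmem hv)
  | first φ he hv hv' h =>
    exact .first φ (hl' _ he (by simp) (by simp)) (hmem hv) (hget hv') h
  | next φ j he hv hv' h =>
    exact .next φ j (hl' _ he (by simp) (by simp)) (hget hv) (hget hv') h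
  | last φ j he hv hv' h =>
    exact .last φ j (hl' _ he (by simp) (by simp)) (hget hv) (hmem hv') h
  | nullary φ he hv h => exact .nullary φ (hl' _ he (by simp) (by simp)) (hmem hv) h

theorem OpSet.cod_getElem? {φ : 𝕆.Op} {j : ℕ} (h : j < 𝕆.eager φ) :
    (𝕆.cod φ)[j]? = some .star := by
  rw [OpSet.cod, List.getElem?_append_left (by simpa using h)]
  simp [h]

theorem tokOp_hasType (φ : 𝕆.Op) (t : Tok) :
    (tokOp φ t).HasType [.star] (𝕆.cod φ) := by
  unfold tokOp
  refine ⟨rfl, ?_⟩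
  refine List.ext_getElem (by simp) fun k h₁ h₂ => ?_
  simp

theorem opTok_hasType (φ : 𝕆.Op) (j : Fin (𝕆.cod φ).length) (t : Tok) :
    (opTok φ j t).HasType [.star] (𝕆.cod φ) := by
  unfold opTok
  refine ⟨rfl, ?_⟩
  refine List.ext_getElem (by simp) fun k h₁ h₂ => ?_
  simp

theorem tokInst_hasType (t : Tok) : (tokInst t : Net 𝕆).HasType [.star] [.diamond] := ⟨rfl, rfl⟩

theorem tokContr_hasType (left : Bool) (t : Tok) :
    (tokContr left t : Net 𝕆).HasType [.star, .star] [.star] := by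
  cases left <;> exact ⟨rfl, rfl⟩

theorem IsSimpleContext.vertexLabel_tgt {C K : Net 𝕆} {e : C.E} {χ : HoleLab}
    (hC : IsSimpleContext C e χ) {φ : 𝕆.Op} (hK : K.HasType χ.dom χ.cod)
    (hK' : K.HasType [.star] (𝕆.cod φ)) {j : ℕ} (hj : j < 𝕆.eager φ) :
    ∃ v, (C.tgt e)[j]? = some v ∧ C.vertexLabel v = .star := by
  have h := hC.isContext.1.1.tgt_typed e
  rw [hC.edgeLabel_eq] at h
  have h' := congrArg (fun l => l[j]?) (h.trans (hK.2.symm.trans hK'.2))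
  simp only [List.getElem?_map, OpSet.cod_getElem? hj, Option.map_eq_some_iff] at h'
  exact h'

/-- The result of an interaction rule is a move of the token on the net where the edge of the rule
replaces the hole. -/
theorem Interaction.exists_move {G G' C : Net 𝕆} {e : C.E} {χ : HoleLab} (h : Interaction G G')
    (hC : IsSimpleContext C e χ) (hG : G.HasType χ.dom χ.cod) (hG' : G'.HasType χ.dom χ.cod) :
    ∃ (l : Lab 𝕆) (v v' : C.V) (t t' : Tok), Move (C.relabel e l) e v t v' t' ∧
      (C.fill fun _ => some G).Iso ((C.relabel e l).insertToken v t) ∧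
      (C.fill fun _ => some G').Iso ((C.relabel e l).insertToken v' t') := by
  have hlen := hC.length_src hG
  have hget : ∀ i, i < G.ins.length → ∃ v, (C.src e)[i]? = some v := fun i hi =>
    ⟨_, List.getElem?_eq_getElem (hlen ▸ hi)⟩
  cases h with
  | contr left =>
    obtain ⟨v, hv⟩ := hget (if left then 0 else 1) (by cases left <;> exact Nat.lt_of_sub_eq_succ rfl)
    exact ⟨_, v, v, _, _, .contr (HGraph.relabel_edgeLabel_self ..) (List.mem_of_getElem? hv),
      HGraph.fill_tokContr_iso hC hG hv, HGraph.fill_tokContr_iso hC hG' hv⟩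
  | inst =>
    obtain ⟨v, hv⟩ := hget 0 Nat.one_pos
    exact ⟨_, v, v, _, _, .inst (HGraph.relabel_edgeLabel_self ..) (List.mem_of_getElem? hv),
      HGraph.fill_tokInst_iso hC hG hv, HGraph.fill_tokInst_iso hC hG' hv⟩
  | first φ j h0 h =>
    obtain ⟨v, hv⟩ := hget 0 Nat.one_pos
    obtain ⟨v', hv', hl'⟩ := hC.vertexLabel_tgt hG (tokOp_hasType φ _) h
    exact ⟨_, v, v', _, _, .first φ (HGraph.relabel_edgeLabel_self ..) (List.mem_of_getElem? hv)
      hv' h, HGraph.fill_tokOp_iso hC hG hv, HGraph.fill_opTok_iso hC hG' (by rwa [h0]) hl'⟩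
  | next φ j j' h h' =>
    obtain ⟨v, hv, hl⟩ := hC.vertexLabel_tgt (j := j.1) hG (opTok_hasType φ _ _) (by omega)
    obtain ⟨v', hv', hl'⟩ := hC.vertexLabel_tgt hG (opTok_hasType φ _ _) h'
    exact ⟨_, v, v', _, _, .next φ j (HGraph.relabel_edgeLabel_self ..) hv (h ▸ hv') (h ▸ h'),
      HGraph.fill_opTok_iso hC hG hv hl, HGraph.fill_opTok_iso hC hG' hv' hl'⟩
  | last φ j h =>
    obtain ⟨v', hv'⟩ := hget 0 Nat.one_pos
    obtain ⟨v, hv, hl⟩ := hC.vertexLabel_tgt (j := j.1) hG (opTok_hasType φ _ _) (by omega)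
    exact ⟨_, v, v', _, _, .last φ j (HGraph.relabel_edgeLabel_self ..) hv
      (List.mem_of_getElem? hv') h,
      HGraph.fill_opTok_iso hC hG hv hl, HGraph.fill_tokOp_iso hC hG' hv'⟩
  | nullary φ h =>
    obtain ⟨v, hv⟩ := hget 0 Nat.one_pos
    exact ⟨_, v, v, _, _, .nullary φ (HGraph.relabel_edgeLabel_self ..) (List.mem_of_getElem? hv) h,
      HGraph.fill_tokOp_iso hC hG hv, HGraph.fill_tokOp_iso hC hG' hv⟩

/-- The rule exhibits the state through some net built from its own context. Cancellation carries
the move from that net to the given presentation on `W`. -/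
theorem SearchStep.exists_move {W : Net 𝕆} {v : W.V} {t : Tok} {N N' : State 𝕆}
    (hN : N.1 = (W.insertToken v t).cls) (h : SearchStep N N') :
    ∃ e v' t', Move W e v t v' t' ∧ N'.1 = (W.insertToken v' t').cls := by
  obtain ⟨hW, -⟩ := IsPlain.of_state hN
  obtain ⟨G, G', C, e, χ, hr, hC, -, -, hG, hG', hN₁, hN₁'⟩ := h
  obtain ⟨l, v₀, v₀', t₀, t₀', hm, hi, hi'⟩ := hr.exists_move hC hG hG'
  have h₁ := hi.symm.trans (HGraph.cls_eq_iff.1 (hN₁.symm.trans hN))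
  obtain ⟨rfl, i, hil, rfl⟩ := HGraph.insertToken_cancel h₁ hW.focusFree
  refine ⟨i.onE e, i.onV v₀', t₀', hm.map i.onV _ (i.src e) (i.tgt e) fun hb _ =>
    (hil e).eq_of_forall_ne_box hb, ?_⟩
  rw [hN₁', HGraph.cls_eq_iff.2 hi']
  exact HGraph.cls_eq_iff.2 (HGraph.insertToken_congr i hil v₀' t₀')

/-! ### From moves back to search transitions -/

theorem Lab.subsingleton_occ_hole {P : Lab 𝕆 → Prop} {l : Lab 𝕆} {χ : HoleLab}
    (h : l = .hole χ) : Subsingleton (l.Occ P) := by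
  subst h
  constructor
  rintro ⟨⟩ ⟨⟩
  rfl

theorem Lab.Occ.nonempty_mono {P P' : Lab 𝕆 → Prop} (h : ∀ l, P l → P' l) {l : Lab 𝕆}
    (o : l.Occ P) : Nonempty (l.Occ P') := by
  induction o with
  | here hp => exact ⟨.here (h _ hp)⟩
  | deep e _ ih =>
    obtain ⟨o⟩ := ih
    exact ⟨.deep e o⟩

/-- An edge of a net without holes replaced by a hole. -/
theorem IsPlain.isSimpleContext {W : Net 𝕆} (hW : IsPlain W) {e : W.E} {χ : HoleLab}
    (hdom : χ.dom = (W.edgeLabel e).dom) (hcod : χ.cod = (W.edgeLabel e).cod) :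
    IsSimpleContext (W.relabel e (.hole χ)) e χ := by
  have hsub : ∀ P : Lab 𝕆 → Prop, (∀ l, P l → l.IsHole) →
      Subsingleton ((W.relabel e (.hole χ)).Occ P) := by
    intro P hP
    have he : ∀ e', Nonempty (((W.relabel e (.hole χ)).edgeLabel e').Occ P) → e = e' := by
      refine HGraph.relabel_cases W e (.hole χ) (P := fun e' l => Nonempty (l.Occ P) → e = e')
        (fun _ => rfl) ?_
      rintro e' - ⟨o⟩
      obtain ⟨o'⟩ := o.nonempty_mono hP
      exact (hW.holeFree.elim ⟨e', o'⟩)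
    have := Lab.subsingleton_occ_hole (P := P) (HGraph.relabel_edgeLabel_self W e (.hole χ))
    constructor
    rintro ⟨e₁, o₁⟩ ⟨e₂, o₂⟩
    obtain rfl := he e₁ ⟨o₁⟩
    obtain rfl := he e₂ ⟨o₂⟩
    rw [this.elim o₁ o₂]
  have hP := hW.wf.1
  refine ⟨⟨⟨⟨hP.finite_V, hP.finite_E, hP.src_nodup, hP.tgt_nodup, hP.src_unique, hP.tgt_unique,
    ?_, ?_, hP.ins_nodup, hP.outs_nodup, hP.mem_ins, hP.mem_outs, hP.ins_outs⟩, ?_⟩, ?_⟩,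
    HGraph.relabel_edgeLabel_self .., hsub _ fun _ => id⟩
  · exact HGraph.relabel_cases W e (.hole χ) (P := fun e' l => (W.src e').map W.vertexLabel = l.dom)
      ((hP.src_typed e).trans hdom.symm) fun e' _ => hP.src_typed e'
  · exact HGraph.relabel_cases W e (.hole χ) (P := fun e' l => (W.tgt e').map W.vertexLabel = l.cod)
      ((hP.tgt_typed e).trans hcod.symm) fun e' _ => hP.tgt_typed e'
  · exact HGraph.relabel_cases W e (.hole χ) (P := fun _ l => l.WF) (.hole χ) fun e' _ => hW.wf.2 e'
  · exact fun χ => hsub _ fun l hl => ⟨χ, hl⟩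

theorem IsPlain.focusFree_relabel_hole {W : Net 𝕆} (hW : IsPlain W) (e : W.E) (χ : HoleLab) :
    (W.relabel e (.hole χ)).FocusFree := by
  refine HGraph.isEmpty_occ_iff.2 (HGraph.relabel_cases W e (.hole χ)
    (P := fun _ l => IsEmpty (l.Occ Lab.IsToken)) ⟨?_⟩ fun e' _ => ⟨fun o => ?_⟩)
  · rintro (⟨_, h⟩)
    cases h
  · exact hW.focusFree.elim ⟨e', o⟩

theorem HGraph.relabel_relabel_insertToken_iso (W : Net 𝕆) (e : W.E) (l l' : Lab 𝕆)
    (h : W.edgeLabel e = l') (v : W.V) (t : Tok) :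
    (((W.relabel e l).relabel e l').insertToken v t).Iso (W.insertToken v t) := by
  subst h
  let i : ((W.relabel e l).relabel e (W.edgeLabel e)).ShapeIso W :=
    ⟨Equiv.refl _, Equiv.refl _, fun _ => rfl, fun _ => (List.map_id _).symm,
      fun _ => (List.map_id _).symm, (List.map_id _).symm, (List.map_id _).symm⟩
  refine HGraph.insertToken_congr i ?_ v t
  intro e'
  have : ((W.relabel e l).relabel e (W.edgeLabel e)).edgeLabel e' = W.edgeLabel e' := by simp
  rw [this]
  exact .refl _

theorem Move.searchStep {W : Net 𝕆} {e : W.E} {v v' : W.V} {t t' : Tok} {N N' : State 𝕆}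
    (h : Move W e v t v' t') (hN : N.1 = (W.insertToken v t).cls)
    (hN' : N'.1 = (W.insertToken v' t').cls) : SearchStep N N' := by
  obtain ⟨hW, hl⟩ := IsPlain.of_state hN
  obtain ⟨-, hl'⟩ := IsPlain.of_state hN'
  have hlen : (W.src e).length = (W.edgeLabel e).dom.length := by
    simpa using congrArg List.length (hW.wf.1.src_typed e)
  have hlen' : (W.tgt e).length = (W.edgeLabel e).cod.length := by
    simpa using congrArg List.length (hW.wf.1.tgt_typed e)
  -- The name `0` is arbitrary: `W` has no holes with which it could clash.
  obtain ⟨χ, hdom, hcod⟩ : ∃ χ : HoleLab, χ.dom = (W.edgeLabel e).dom ∧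
    χ.cod = (W.edgeLabel e).cod := ⟨⟨0, _, _⟩, rfl, rfl⟩
  have hC := hW.isSimpleContext hdom hcod
  have hsingle : ∀ {x}, x ∈ W.src e → (W.edgeLabel e).dom.length = 1 →
      (W.src e)[0]? = some x := by
    intro x hx h1
    obtain ⟨y, hy⟩ := List.length_eq_one_iff.1 (hlen.trans h1)
    rw [hy] at hx ⊢
    simpa [eq_comm] using hx
  have key : ∀ (G G' : Net 𝕆) (l : Lab 𝕆), Interaction G G' → W.edgeLabel e = l →
      G.HasType l.dom l.cod → G'.HasType l.dom l.cod →
      (G.HasType χ.dom χ.cod → ((W.relabel e (.hole χ)).fill fun _ => some G).Iso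
        (((W.relabel e (.hole χ)).relabel e l).insertToken v t)) →
      (G'.HasType χ.dom χ.cod → ((W.relabel e (.hole χ)).fill fun _ => some G').Iso
        (((W.relabel e (.hole χ)).relabel e l).insertToken v' t')) → SearchStep N N' := by
    intro G G' l hI he hG hG' hi hi'
    rw [← he, ← hdom, ← hcod] at hG hG'
    exact ⟨G, G', W.relabel e (.hole χ), e, χ, hI, hC, hW.focusFree_relabel_hole e χ, hW.type, hG,
      hG', hN.trans (HGraph.cls_eq_iff.2 ((hi hG).trans
        (W.relabel_relabel_insertToken_iso e _ l he v t))).symm,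
      hN'.trans (HGraph.cls_eq_iff.2 ((hi' hG').trans
        (W.relabel_relabel_insertToken_iso e _ l he v' t'))).symm⟩
  cases h with
  | contr he hv =>
    obtain ⟨i, hi, hv⟩ := List.getElem_of_mem hv
    have hi' : i < 2 := by
      rw [he] at hlen
      exact lt_of_lt_of_eq hi hlen
    obtain ⟨left, hv'⟩ : ∃ left : Bool, (W.src e)[if left then 0 else 1]? = some v := by
      obtain rfl | rfl : i = 0 ∨ i = 1 := by omega
      · exact ⟨true, List.getElem?_eq_some_iff.2 ⟨hi, hv⟩⟩
      · exact ⟨false, List.getElem?_eq_some_iff.2 ⟨hi, hv⟩⟩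
    exact key _ _ _ (.contr left) he (tokContr_hasType _ _) (tokContr_hasType _ _)
      (fun hT => HGraph.fill_tokContr_iso hC hT hv') fun hT => HGraph.fill_tokContr_iso hC hT hv'
  | inst he hv =>
    have hv' := hsingle hv (by rw [he]; rfl)
    exact key _ _ _ .inst he (tokInst_hasType _) (tokInst_hasType _)
      (fun hT => HGraph.fill_tokInst_iso hC hT hv') fun hT => HGraph.fill_tokInst_iso hC hT hv'
  | first φ he hv hv' h =>
    have hv₀ := hsingle hv (by rw [he]; rfl)
    have hlt : 0 < (𝕆.cod φ).length := by
      rw [he] at hlen'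
      exact hlen' ▸ (List.getElem?_eq_some_iff.1 hv').1
    exact key _ _ _ (.first φ ⟨0, hlt⟩ rfl h) he (tokOp_hasType _ _) (opTok_hasType _ _ _)
      (fun hT => HGraph.fill_tokOp_iso hC hT hv₀) fun hT => HGraph.fill_opTok_iso hC hT hv' hl'
  | next φ j he hv hv' h =>
    have hlt : j + 1 < (𝕆.cod φ).length := by
      rw [he] at hlen'
      exact hlen' ▸ (List.getElem?_eq_some_iff.1 hv').1
    exact key _ _ _ (.next φ ⟨j, by omega⟩ ⟨j + 1, hlt⟩ rfl h) he (opTok_hasType _ _ _)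
      (opTok_hasType _ _ _) (fun hT => HGraph.fill_opTok_iso hC hT hv hl)
      fun hT => HGraph.fill_opTok_iso hC hT hv' hl'
  | last φ j he hv hv' h =>
    have hv₀ := hsingle hv' (by rw [he]; rfl)
    have hlt : j < (𝕆.cod φ).length := by
      rw [he] at hlen'
      exact hlen' ▸ (List.getElem?_eq_some_iff.1 hv).1
    exact key _ _ _ (.last φ ⟨j, hlt⟩ h) he (opTok_hasType _ _ _)
      (tokOp_hasType _ _) (fun hT => HGraph.fill_opTok_iso hC hT hv hl)
      fun hT => HGraph.fill_tokOp_iso hC hT hv₀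
  | nullary φ he hv h =>
    have hv₀ := hsingle hv (by rw [he]; rfl)
    exact key _ _ _ (.nullary φ h) he (tokOp_hasType _ _)
      (tokOp_hasType _ _) (fun hT => HGraph.fill_tokOp_iso hC hT hv₀)
      fun hT => HGraph.fill_tokOp_iso hC hT hv₀

/-! ### Rooted states -/

/-- Moves only climb up and down operation edges. When the token sits on a target of `e`, the path
is not empty, as `r` is an input; its last edge must be `e`, the only edge with this target. So the
path passes through the single source of `e`, and from there it can be continued to the next target
or simply cut. -/
theorem Move.opPath {W : Net 𝕆} {e : W.E} {v v' r : W.V} {t t' : Tok} (h : Move W e v t v' t')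
    (hW : W.Proper) (hr : r ∈ W.ins) (hp : Relation.ReflTransGen (W.Adj Lab.IsOp) r v) :
    Relation.ReflTransGen (W.Adj Lab.IsOp) r v' := by
  have hback : ∀ {x φ}, W.edgeLabel e = .op φ → x ∈ W.tgt e →
      Relation.ReflTransGen (W.Adj Lab.IsOp) r x →
      ∃ y, y ∈ W.src e ∧ Relation.ReflTransGen (W.Adj Lab.IsOp) r y := by
    intro x φ he hx hp
    cases hp with
    | refl => exact absurd hx ((hW.mem_ins r).1 hr e)
    | tail hp ha =>
      obtain ⟨e', -, hy, hx'⟩ := ha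
      obtain rfl := hW.tgt_unique _ _ _ hx hx'
      exact ⟨_, hy, hp⟩
  cases h with
  | contr | inst | nullary => exact hp
  | first φ he hv hv' => exact hp.tail ⟨e, ⟨φ, he⟩, hv, List.mem_of_getElem? hv'⟩
  | next φ j he hv hv' =>
    obtain ⟨y, hy, hp'⟩ := hback he (List.mem_of_getElem? hv) hp
    exact hp'.tail ⟨e, ⟨φ, he⟩, hy, List.mem_of_getElem? hv'⟩
  | last φ j he hv hv' =>
    obtain ⟨y, hy, hp'⟩ := hback he (List.mem_of_getElem? hv) hp
    have hs := hW.src_typed e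
    rw [he] at hs
    obtain ⟨z, hz, -⟩ := List.map_eq_singleton_iff.1 hs
    rw [hz] at hy hv'
    obtain rfl : y = z := by simpa using hy
    obtain rfl : v' = y := by simpa using hv'
    exact hp'

/-- In a rooted state, there is an operation path from the input to the token. -/
theorem State.Rooted.opPath {W : Net 𝕆} {v : W.V} {t : Tok} {N : State 𝕆}
    (h : N.Rooted) (hN : N.1 = (W.insertToken v t).cls) :
    ∃ r ∈ W.ins, Relation.ReflTransGen (W.Adj Lab.IsOp) r v := by
  obtain ⟨hW, -⟩ := IsPlain.of_state hN
  obtain ⟨r, hr, -⟩ := hW.exists_ins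
  have hr' : r ∈ W.ins := by simp [hr]
  obtain ⟨M, hM, hs⟩ := h
  rw [State.isRestart_iff hN hr] at hM
  have key : ∃ v' t', N.1 = (W.insertToken v' t').cls ∧
      Relation.ReflTransGen (W.Adj Lab.IsOp) r v' := by
    clear hN
    induction hs with
    | refl => exact ⟨r, _, hM, .refl⟩
    | tail _ hstep ih =>
      obtain ⟨v', t', hv', hp⟩ := ih
      obtain ⟨e, v'', t'', hm, h''⟩ := hstep.exists_move hv'
      exact ⟨v'', t'', h'', hm.opPath hW.wf.1 hr' hp⟩
  obtain ⟨v', t', hv', hp⟩ := key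
  -- The vertex tracked along the transitions may differ from `v` by an automorphism of `W`; the
  -- path is transported along it.
  obtain ⟨-, i, hi, rfl⟩ := HGraph.insertToken_cancel (HGraph.cls_eq_iff.1 (hv'.symm.trans hN))
    hW.focusFree
  refine ⟨i.onV r, ?_, hp.lift i.onV ?_⟩
  · rw [i.ins]
    exact List.mem_map_of_mem hr'
  · rintro a b ⟨e, ⟨φ, he⟩, ha, hb⟩
    refine ⟨i.onE e, ⟨φ, ((hi e).eq_of_forall_ne_box (by simp [he])).trans he⟩, ?_, ?_⟩
    · rw [i.src]
      exact List.mem_map_of_mem ha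
    · rw [i.tgt]
      exact List.mem_map_of_mem hb

/-! ### Rewrite transitions have rewrite tokens -/

theorem Move.ne_rewrite {W : Net 𝕆} {e : W.E} {v v' : W.V} {t t' : Tok}
    (h : Move W e v t v' t') : t ≠ .rewrite := by
  cases h <;> simp

theorem HGraph.exists_fill_edgeLabel {C K : Net 𝕆} {e : C.E} {χ : HoleLab}
    (he : C.edgeLabel e = .hole χ) (k : K.E) :
    ∃ e', (C.fill fun _ => some K).edgeLabel e' = K.edgeLabel k := by
  have hp : (C.edgeLabel e).slot (fun _ => some K) = some K := by simp [he, Lab.slot]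
  let D : Net 𝕆 := { C with edgeLabel := fun e => (C.edgeLabel e).fill fun _ => some K }
  let x : D.Slot fun e => (C.edgeLabel e).slot fun _ => some K := ⟨e, by simp [hp]⟩
  have hx : x.net = K := by simp [x, HGraph.Slot.net, hp]
  have : ∃ k' : x.net.E, x.net.edgeLabel k' = K.edgeLabel k := by
    rw [hx]
    exact ⟨k, rfl⟩
  obtain ⟨k', hk'⟩ := this
  exact ⟨.inr ⟨x, k'⟩, hk'⟩

theorem CopyStep.token_eq {W : Net 𝕆} {v : W.V} {t : Tok} {N N' : State 𝕆}
    (hN : N.1 = (W.insertToken v t).cls) (h : CopyStep N N') : t = .rewrite := by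
  obtain ⟨G, G', C, e, χ, hr, hC, -, -, -, -, hN₁, -⟩ := h
  obtain ⟨n, p, q, T, H, -, -, -⟩ := hr
  -- The token edge of the rule remains an edge of the plugged net, and the state has no other
  -- token.
  obtain ⟨e', he'⟩ := HGraph.exists_fill_edgeLabel (K := copyLhs n p q T H) hC.edgeLabel_eq
    (.inl ⟨CopyLE.tok, rfl⟩)
  exact State.token_eq hN hN₁.symm he'

theorem RewriteStep.token_eq {B : Behaviour 𝕆} {W : Net 𝕆} {v : W.V} {t : Tok} {N N' : State 𝕆}
    (hN : N.1 = (W.insertToken v t).cls) (h : RewriteStep B N N') : t = .rewrite := by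
  rcases h with h | h
  · exact h.token_eq hN
  · obtain ⟨G, τ, e, φ, hG, hτ, -⟩ := B.source _ _ h
    exact State.token_eq hN hG (τ.edgeLabel_eq.trans (by rw [hτ]))

/-! ### Operation paths through plugged nets -/

/-- Going back along an operation path that arrives at a vertex of a plugged net, one stays in this
net until one reaches one of its inputs. -/
theorem HGraph.exists_ins_of_opPath {G : Net 𝕆} {p : G.E → Option (Net 𝕆)}
    (hW : (G.plug p).Proper) (x : G.Slot p) (hH : HGraph.Proper x.net) {r y : (G.plug p).V}
    (hr : r ∈ (G.plug p).ins) (h : Relation.ReflTransGen ((G.plug p).Adj Lab.IsOp) r y) :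
    ∀ w : x.net.V, y = G.plugMap p x w →
      ∃ z ∈ x.net.ins, Relation.ReflTransGen (HGraph.Adj Lab.IsOp x.net) z w := by
  have hmem : ∀ {w : x.net.V} {k : x.net.E}, w ∈ x.net.tgt k →
      G.plugMap p x w ∈ (G.plug p).tgt (.inr ⟨x, k⟩) := fun hw => List.mem_map_of_mem hw
  induction h with
  | refl =>
    intro w hw
    by_cases hi : w ∈ x.net.ins
    · exact ⟨w, hi, .refl⟩
    · rw [hH.mem_ins] at hi
      push Not at hi
      obtain ⟨k, hk⟩ := hi
      -- The path starts at an input of the whole net, which is the target of no edge, in particular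
      -- of no edge of the plugged net.
      exact absurd (hw ▸ hmem hk) ((hW.mem_ins _).1 hr _)
  | tail _ ha ih =>
    intro w hw
    by_cases hi : w ∈ x.net.ins
    · exact ⟨w, hi, .refl⟩
    · rw [hH.mem_ins] at hi
      push Not at hi
      obtain ⟨k, hk⟩ := hi
      obtain ⟨e, he, hs, ht⟩ := ha
      -- The last edge of the path has the same target as the inner edge `k`, so it is `k`, and the
      -- path stays inside one step further back.
      obtain rfl := hW.tgt_unique _ _ _ ht (hw ▸ hmem hk)
      obtain ⟨w', hw', rfl⟩ := List.mem_map.1 hs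
      obtain ⟨z, hz, hp⟩ := ih w' rfl
      exact ⟨z, hz, hp.tail ⟨k, he, hw', hk⟩⟩

/-- A path that arrives at a target of the hole has come through `H`, from one of its inputs to the
corresponding output. The part inside `H` is not empty because no input is an output, and it starts
at type `⋆` because the source of an operation has this type. -/
theorem HGraph.not_oneWay_of_opPath {U : Net 𝕆} {σ : HoleLab → Option (Net 𝕆)} (hU : U.Proper)
    (hW : (U.fill σ).Proper) {e : U.E} {χ : HoleLab} {H : Net 𝕆} (he : U.edgeLabel e = .hole χ)
    (hσ : σ χ = some H) (hH : H.Proper) (hty : H.HasType χ.dom χ.cod) {v : U.V}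
    (hv : v ∈ U.tgt e) (hl : U.vertexLabel v = .star) {r : (U.fill σ).V}
    (hr : r ∈ (U.fill σ).ins)
    (hp : Relation.ReflTransGen ((U.fill σ).Adj Lab.IsOp) r (.inl v)) : ¬ H.OneWay := by
  have hp' : (U.edgeLabel e).slot σ = some H := by rw [he]; exact hσ
  let D : Net 𝕆 := { U with edgeLabel := fun e => (U.edgeLabel e).fill σ }
  let x : D.Slot fun e => (U.edgeLabel e).slot σ := ⟨e, by simp [hp']⟩
  have hx : x.net = H := by simp [x, HGraph.Slot.net, hp']
  have htyped := hU.tgt_typed e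
  rw [he] at htyped
  rw [← hx] at hH hty ⊢
  have hlab : x.net.outs.map x.net.vertexLabel = (U.tgt e).map U.vertexLabel :=
    hty.2.trans htyped.symm
  have hout := HGraph.map_glue_outs (H := x.net) (s := U.src e) (t := U.tgt e) hH.outs_nodup
    (fun w ho hi => hH.ins_outs w hi ho) (by simpa using (congrArg List.length hlab).symm)
  obtain ⟨i, hi, rfl⟩ := List.getElem_of_mem hv
  have hi' : i < x.net.outs.length := by
    have := congrArg List.length hlab
    simp only [List.length_map] at this
    rwa [this]
  have hglue : x.net.glue (U.src e) (U.tgt e) x.net.outs[i] = some (U.tgt e)[i] := by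
    have := congrArg (fun l => l[i]?) hout
    simpa [hi, hi'] using this
  have hstar : x.net.vertexLabel x.net.outs[i] = .star := by
    have := congrArg (fun l => l[i]?) hlab
    simp only [List.getElem?_map, List.getElem?_eq_getElem hi, List.getElem?_eq_getElem hi',
      Option.map_some, Option.some.injEq] at this
    rw [this, hl]
  obtain ⟨z, hz, hpath⟩ := HGraph.exists_ins_of_opPath hW x hH hr hp x.net.outs[i]
    (HGraph.plugMap_of_some (x := x) hglue).symm
  intro hone
  have hmem : x.net.outs[i] ∈ x.net.outs := List.getElem_mem hi'
  rcases Relation.reflTransGen_iff_eq_or_transGen.1 hpath with h | h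
  · exact hH.ins_outs z hz (h ▸ hmem)
  · obtain ⟨b, ⟨k, ⟨φ, hk⟩, hzk, -⟩, -⟩ := Relation.TransGen.head'_iff.1 h
    have hs := hH.src_typed k
    rw [hk] at hs
    obtain ⟨z', hz', hlz⟩ := List.map_eq_singleton_iff.1 hs
    obtain rfl : z = z' := by simpa [hz'] using hzk
    exact hone z hz _ hmem hlz hstar h

/-! ### Moves and plugging -/

theorem Move.mem_src {W : Net 𝕆} {e : W.E} {v v' : W.V} {t' : Tok}
    (h : Move W e v .search v' t') : v ∈ W.src e := by
  cases h <;> assumption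

theorem Move.mem_tgt {W : Net 𝕆} {e : W.E} {v v' : W.V} {t' : Tok}
    (h : Move W e v .value v' t') : v ∈ W.tgt e := by
  cases h <;> exact List.mem_of_getElem? (by assumption)

theorem Lab.eq_of_fill_eq {σ : HoleLab → Option (Net 𝕆)} {l l' : Lab 𝕆} (h : l.fill σ = l')
    (hl' : ∀ b k n G, l' ≠ .box b k n G) : l = l' := by
  subst h
  cases l with
  | box b k n G => exact absurd rfl (hl' _ _ _ _)
  | _ => rfl

theorem Lab.fill_eq_self {σ : HoleLab → Option (Net 𝕆)} {l : Lab 𝕆}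
    (hl : ∀ b k n G, l ≠ .box b k n G) : l.fill σ = l := by
  cases l with
  | box b k n G => exact absurd rfl (hl _ _ _ _)
  | _ => rfl

theorem Lab.slot_eq_none {σ : HoleLab → Option (Net 𝕆)} {l : Lab 𝕆} (h : ¬ l.IsHole) :
    l.slot σ = none := by
  cases l with
  | hole χ => exact absurd ⟨χ, rfl⟩ h
  | _ => rfl

theorem Move.fill {U : Net 𝕆} {e : U.E} {v v' : U.V} {t t' : Tok} (h : Move U e v t v' t')
    {σ : HoleLab → Option (Net 𝕆)} (he : (U.edgeLabel e).slot σ = none) :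
    Move (U.fill σ) (.inl ⟨e, he⟩) (.inl v) t (.inl v') t' :=
  h.map (W' := U.fill σ) Sum.inl _ rfl rfl fun hb _ => Lab.fill_eq_self hb

/-- An edge kept from the context has only context vertices as its ends, so the token cannot leave
the context and the move already exists before plugging. -/
theorem Move.of_fill {U : Net 𝕆} {e : U.E} {v : U.V} {t t' : Tok} {σ : HoleLab → Option (Net 𝕆)}
    {he : (U.edgeLabel e).slot σ = none} {v' : (U.fill σ).V}
    (h : Move (U.fill σ) (.inl ⟨e, he⟩) (.inl v) t v' t') :
    ∃ v₀, v' = .inl v₀ ∧ Move U e v t v₀ t' := by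
  have hmem : ∀ {y : (U.fill σ).V}, y ∈ (U.fill σ).src (.inl ⟨e, he⟩) →
      ∃ x, y = .inl x ∧ x ∈ U.src e := fun hy => by
    obtain ⟨x, hx, rfl⟩ := List.mem_map.1 hy
    exact ⟨x, rfl, hx⟩
  have hget : ∀ {y : (U.fill σ).V} {j : ℕ}, ((U.fill σ).tgt (.inl ⟨e, he⟩))[j]? = some y →
      ∃ x, y = .inl x ∧ (U.tgt e)[j]? = some x := fun {y j} hy => by
    have hy' : ((U.tgt e).map Sum.inl)[j]? = some y := hy
    obtain ⟨x, hx, rfl⟩ := Option.map_eq_some_iff.1 (List.getElem?_map.symm.trans hy')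
    exact ⟨x, rfl, hx⟩
  have hlab : ∀ {l}, (U.fill σ).edgeLabel (.inl ⟨e, he⟩) = l → (∀ b k n G, l ≠ .box b k n G) →
      U.edgeLabel e = l := fun h => Lab.eq_of_fill_eq (σ := σ) h
  -- Case analysis on the move requires its initial vertex to be a variable.
  generalize hy : (Sum.inl v : (U.fill σ).V) = y at h
  cases h with
  | contr hl hv =>
    obtain ⟨x, hx, hv⟩ := hmem hv
    obtain rfl : v = x := Sum.inl.inj (hy.trans hx)
    exact ⟨v, hy.symm, .contr (hlab hl (by simp)) hv⟩
  | inst hl hv =>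
    obtain ⟨x, hx, hv⟩ := hmem hv
    obtain rfl : v = x := Sum.inl.inj (hy.trans hx)
    exact ⟨v, hy.symm, .inst (hlab hl (by simp)) hv⟩
  | first φ hl hv hv' h =>
    obtain ⟨x, hx, hv⟩ := hmem hv
    obtain rfl : v = x := Sum.inl.inj (hy.trans hx)
    obtain ⟨x', hx', hv'⟩ := hget hv'
    exact ⟨x', hx', .first φ (hlab hl (by simp)) hv hv' h⟩
  | next φ j hl hv hv' h =>
    obtain ⟨x, hx, hv⟩ := hget hv
    obtain rfl : v = x := Sum.inl.inj (hy.trans hx)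
    obtain ⟨x', hx', hv'⟩ := hget hv'
    exact ⟨x', hx', .next φ j (hlab hl (by simp)) hv hv' h⟩
  | last φ j hl hv hv' h =>
    obtain ⟨x, hx, hv⟩ := hget hv
    obtain rfl : v = x := Sum.inl.inj (hy.trans hx)
    obtain ⟨x', hx', hv'⟩ := hmem hv'
    exact ⟨x', hx', .last φ j (hlab hl (by simp)) hv hv' h⟩
  | nullary φ hl hv h =>
    obtain ⟨x, hx, hv⟩ := hmem hv
    obtain rfl : v = x := Sum.inl.inj (hy.trans hx)
    exact ⟨v, hy.symm, .nullary φ (hlab hl (by simp)) hv h⟩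

/-! ### Specimens -/

section Specimen

variable {𝒞 : Set (Hypernet 𝕆)} {R : Hypernet 𝕆 → Hypernet 𝕆 → Prop}

/-- The underlying context of a specimen. -/
noncomputable abbrev Specimen.base (S : Specimen 𝒞 R) : Net 𝕆 := S.tok.underlying

/-- The position of the token in the underlying context. -/
noncomputable abbrev Specimen.pos (S : Specimen 𝒞 R) : S.base.V := ⟨S.tok.s, S.tok.acyclic⟩

theorem Specimen.hasHole_of_edgeLabel (S : Specimen 𝒞 R) {e : S.base.E} {χ : HoleLab}
    (h : S.base.edgeLabel e = .hole χ) : S.ctx.HasHole χ :=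
  ⟨⟨e.1, .here h⟩⟩

theorem Specimen.proper_of_slot_eq (S : Specimen 𝒞 R) (hR : IsPreTemplate R) (e : S.base.E)
    (H : Net 𝕆) :
    ((S.base.edgeLabel e).slot (fun χ => some (S.H₁ χ)) = some H → H.Proper) ∧
      ((S.base.edgeLabel e).slot (fun χ => some (S.H₂ χ)) = some H → H.Proper) := by
  rcases h : S.base.edgeLabel e with _ | _ | _ | _ | _ | _ | χ | _ <;>
    simp only [Lab.slot, reduceCtorEq, false_implies, true_and, Option.some.injEq]
  obtain ⟨h₁, h₂, -⟩ := hR _ _ (S.rel χ (S.hasHole_of_edgeLabel h))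
  exact ⟨fun h => h ▸ h₁.1.1, fun h => h ▸ h₂.1.1⟩

/-- Together with `Specimen.state₂_eq`, this places the token of both states at the same vertex of
the common context `S.base`; every comparison of the two states rests on it. -/
theorem Specimen.state₁_eq (S : Specimen 𝒞 R) (hR : IsPreTemplate R) :
    S.state₁.1 =
      ((S.base.fill fun χ => some (S.H₁ χ)).insertToken (.inl S.pos) S.tok.lab).cls := by
  obtain ⟨i, hi⟩ := S.tok.exists_shapeIso S.isContext.1.1
  exact HGraph.cls_eq_iff.2 ((HGraph.fill_iso_fill i hi _).trans
    (HGraph.fill_insertToken_iso _ _ _ _ fun e H => (S.proper_of_slot_eq hR e H).1))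

theorem Specimen.state₂_eq (S : Specimen 𝒞 R) (hR : IsPreTemplate R) :
    S.state₂.1 =
      ((S.base.fill fun χ => some (S.H₂ χ)).insertToken (.inl S.pos) S.tok.lab).cls := by
  obtain ⟨i, hi⟩ := S.tok.exists_shapeIso S.isContext.1.1
  exact HGraph.cls_eq_iff.2 ((HGraph.fill_iso_fill i hi _).trans
    (HGraph.fill_insertToken_iso _ _ _ _ fun e H => (S.proper_of_slot_eq hR e H).2))

theorem Specimen.base_proper (S : Specimen 𝒞 R) :
    S.base.Proper ∧ S.base.vertexLabel S.pos = .star := by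
  obtain ⟨i, hi⟩ := S.tok.exists_shapeIso S.isContext.1.1
  have hp : (S.base.insertToken S.pos S.tok.lab).Proper :=
    S.isContext.1.1.of_iso i fun e => hi e ▸ .refl _
  have hτ : i.onE S.tok.edge = none := by
    have h := hi S.tok.edge
    rw [S.tok.edgeLabel_eq] at h
    rcases hx : i.onE S.tok.edge with _ | e
    · rfl
    · rw [hx] at h
      exact ((S.tok.unique e.1 e.2).elim (.here ⟨_, h⟩))
  have hs : i.onV S.tok.s = some S.pos := by
    have := i.src S.tok.edge
    rw [hτ, S.tok.src_eq] at this
    exact (List.singleton_inj.1 this).symm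
  have ht : i.onV S.tok.t = none := by
    have := i.tgt S.tok.edge
    rw [hτ, S.tok.tgt_eq] at this
    exact (List.singleton_inj.1 this).symm
  refine hp.of_insertToken (t := S.tok.lab) ?_
  rintro ⟨h₁, h₂⟩
  have h₁' : some S.pos ∈ (S.base.insertToken S.pos S.tok.lab).ins := List.mem_map_of_mem h₁
  have h₂' : none ∈ (S.base.insertToken S.pos S.tok.lab).outs := none_mem_map_splitAt.2 h₂
  rw [← hs, i.ins, List.mem_map_of_injective i.onV.injective] at h₁'
  rw [← ht, i.outs, List.mem_map_of_injective i.onV.injective] at h₂'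
  exact S.tok.not_exposed ⟨h₁', h₂'⟩

/-- `S.pos` stands for both ends of the token. A source of an edge other than the token cannot be
the source of the token, so it must be its target. -/
theorem Specimen.entering_of_mem_src (S : Specimen 𝒞 R) {e : S.base.E}
    (he : (S.base.edgeLabel e).IsHole) (hv : S.pos ∈ S.base.src e) : S.tok.Entering := by
  obtain ⟨x, hx, hxs⟩ := List.mem_map.1 hv
  by_cases h : x = S.tok.t
  · exact ⟨e.1, he, h ▸ hx⟩
  · have hm : S.tok.merge x = ⟨x, h⟩ := dif_neg h
    rw [hm] at hxs
    obtain rfl : x = S.tok.s := congrArg Subtype.val hxs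
    exact absurd (S.isContext.1.1.src_unique _ _ _ hx (by simp [S.tok.src_eq])) e.2

theorem Specimen.base_focusFree (S : Specimen 𝒞 R) : S.base.FocusFree :=
  ⟨fun o => (S.tok.unique o.1.1 o.1.2).elim o.2⟩

/-- Relocate the token of a specimen. -/
theorem Specimen.exists_relocate (S : Specimen 𝒞 R) (hR : IsPreTemplate R) {v : S.base.V}
    (hl : S.base.vertexLabel v = .star) (t : Tok) :
    ∃ S' : Specimen 𝒞 R, S'.tok.lab = t ∧
      S'.state₁.1 = ((S.base.fill fun χ => some (S.H₁ χ)).insertToken (.inl v) t).cls ∧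
      S'.state₂.1 = ((S.base.fill fun χ => some (S.H₂ χ)).insertToken (.inl v) t).cls ∧
      (S'.tok.Entering → ∃ e, (S.base.edgeLabel e).IsHole ∧ v ∈ S.base.src e) := by
  obtain ⟨hP, -⟩ := S.base_proper
  have hF := S.base_focusFree
  have h₁ := HGraph.cls_eq_iff.2 (HGraph.fill_insertToken_iso S.base v t _
    fun e H => (S.proper_of_slot_eq hR e H).1)
  have h₂ := HGraph.cls_eq_iff.2 (HGraph.fill_insertToken_iso S.base v t _
    fun e H => (S.proper_of_slot_eq hR e H).2)
  have hocc : ∀ {χ} {e : Option S.base.E},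
      ((S.base.insertToken v t).edgeLabel e).Occ (· = .hole χ) → ∃ e', e = some e' := by
    rintro χ (_ | e) o
    · cases o with
      | here h => cases h
    · exact ⟨e, rfl⟩
  have hhole : ∀ {χ}, (S.base.insertToken v t).HasHole χ → S.ctx.HasHole χ := by
    rintro χ ⟨⟨e, o⟩⟩
    obtain ⟨e, rfl⟩ := hocc o
    exact ⟨⟨e.1, o⟩⟩
  let τ : Token (S.base.insertToken v t) := hF.token (hP.ins_outs v) t
  have hτp : (S.base.insertToken v t).Proper := hP.insertToken hl t
  refine ⟨⟨S.base.insertToken v t, S.H₁, S.H₂, ⟨⟨hτp, ?_⟩, ?_⟩, τ, ?_, fun χ h => S.type₁ χ (hhole h),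
    fun χ h => S.type₂ χ (hhole h), fun χ h => S.rel χ (hhole h), ?_, ?_⟩, rfl, h₁, h₂, ?_⟩
  · rintro (_ | e)
    · exact .token t
    · exact S.isContext.1.2 e.1
  · intro χ
    constructor
    rintro ⟨e₁, o₁⟩ ⟨e₂, o₂⟩
    obtain ⟨e₁, rfl⟩ := hocc o₁
    obtain ⟨e₂, rfl⟩ := hocc o₂
    have h := (S.isContext.2 χ).elim ⟨e₁.1, o₁⟩ ⟨e₂.1, o₂⟩
    obtain ⟨e₁, he₁⟩ := e₁
    obtain ⟨e₂, he₂⟩ := e₂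
    obtain rfl : e₁ = e₂ := congrArg Sigma.fst h
    obtain rfl : o₁ = o₂ := eq_of_heq (Sigma.mk.inj h).2
    rfl
  -- Removing the relocated token gives back `S.base` up to isomorphism, and `𝒞` consists of
  -- isomorphism classes.
  · obtain ⟨-, i, hi, -⟩ := HGraph.insertToken_cancel (τ.iso_insertToken hτp).symm hF
    rw [HGraph.cls_eq_iff.2 ⟨i, hi⟩]
    exact S.mem
  · have hS := IsPlain.of_state (S.state₁_eq hR)
    rw [h₁]
    exact IsPlain.isState (v := (Sum.inl v : (S.base.fill fun χ => some (S.H₁ χ)).V)) hS.1 hl t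
  · have hS := IsPlain.of_state (S.state₂_eq hR)
    rw [h₂]
    exact IsPlain.isState (v := (Sum.inl v : (S.base.fill fun χ => some (S.H₂ χ)).V)) hS.1 hl t
  · rintro ⟨_ | e, ⟨χ, he⟩, hs⟩
    · cases he
    · exact ⟨e, ⟨χ, he⟩, none_mem_map_splitAt.1 hs⟩

/-- Exchange the two lists of nets of a specimen. -/
noncomputable def Specimen.swap (S : Specimen 𝒞 R) : Specimen 𝒞 (flip R) where
  ctx := S.ctx
  H₁ := S.H₂
  H₂ := S.H₁
  isContext := S.isContext
  tok := S.tok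
  mem := S.mem
  type₁ := S.type₂
  type₂ := S.type₁
  rel := S.rel
  isState₁ := S.isState₂
  isState₂ := S.isState₁

end Specimen

/-- A rewrite token only arises in front of the edge that was interacted with. If this edge is not a
hole, the token is not entering, since a vertex is a source of at most one edge. -/
theorem Move.remote_target {W : Net 𝕆} {e : W.E} {v v' : W.V} {t t' : Tok}
    (h : Move W e v t v' t') :
    t' = .search ∨ t' = .value ∨ v' ∈ W.src e := by
  cases h with
  | contr he hv => exact .inr (.inr hv)
  | inst => exact .inr (.inl rfl)
  | first => exact .inl rfl
  | next => exact .inl rfl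
  | last φ j he hv hv' => exact .inr (.inr hv')
  | nullary φ he hv => exact .inr (.inr hv)

/-! ### Transitions of the two states of a specimen -/

section

variable {𝒞 : Set (Hypernet 𝕆)} {R : Hypernet 𝕆 → Hypernet 𝕆 → Prop} {B : Behaviour 𝕆}

theorem Specimen.searchStep_of_step (S : Specimen 𝒞 R) (hR : IsPreTemplate R)
    (ht : S.tok.lab ≠ .rewrite) {N : State 𝕆} (h : Step B S.state₁ N) : SearchStep S.state₁ N :=
  h.resolve_right fun h => ht (h.token_eq (S.state₁_eq hR))

theorem Specimen.rewriteStep_of_step (S : Specimen 𝒞 R) (hR : IsPreTemplate R)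
    (ht : S.tok.lab = .rewrite) {N : State 𝕆} (h : Step B S.state₁ N) :
    RewriteStep B S.state₁ N := by
  refine h.resolve_left fun h => ?_
  obtain ⟨e, v', t', hm, -⟩ := h.exists_move (S.state₁_eq hR)
  exact hm.ne_rewrite ht

/-- Being final means a value token at the input, and both the position of the token and the inputs
belong to the context. -/
theorem Specimen.isFinal_iff (S : Specimen 𝒞 R) (hR : IsPreTemplate R) :
    S.state₁.IsFinal ↔ S.state₂.IsFinal := by
  have hinj : ∀ σ : HoleLab → Option (Net 𝕆), (Sum.inl S.pos : (S.base.fill σ).V) ∈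
      (S.base.fill σ).ins ↔ S.pos ∈ S.base.ins := fun σ =>
    List.mem_map_of_injective Sum.inl_injective
  rw [State.isFinal_iff (S.state₁_eq hR), State.isFinal_iff (S.state₂_eq hR)]
  exact and_congr_right fun _ => (hinj _).trans (hinj _).symm

/-- The token is not on an output of a hole, if both states are rooted. -/
theorem Specimen.not_isHole_of_mem_tgt (S : Specimen 𝒞 R) (hR : IsPreTemplate R)
    (hO : OutputClosed R) (hr₁ : S.state₁.Rooted) (hr₂ : S.state₂.Rooted) {e : S.base.E}
    (he : S.pos ∈ S.base.tgt e) : ¬ (S.base.edgeLabel e).IsHole := by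
  rintro ⟨χ, hχ⟩
  obtain ⟨hP, hl⟩ := S.base_proper
  have hhole := S.hasHole_of_edgeLabel hχ
  obtain ⟨hH₁, hH₂, -⟩ := hR _ _ (S.rel χ hhole)
  obtain ⟨r₁, hr₁, hp₁⟩ := hr₁.opPath (S.state₁_eq hR)
  obtain ⟨r₂, hr₂, hp₂⟩ := hr₂.opPath (S.state₂_eq hR)
  have hW₁ := (IsPlain.of_state (S.state₁_eq hR)).1.wf.1
  have hW₂ := (IsPlain.of_state (S.state₂_eq hR)).1.wf.1
  -- Output-closure does not tell which of the two nets is one-way, so rootedness is needed on both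
  -- sides.
  rcases hO _ _ (S.rel χ hhole) with h | h
  · exact HGraph.not_oneWay_of_opPath hP hW₁ hχ rfl hH₁.1.1 (S.type₁ χ hhole) he hl hr₁ hp₁ h
  · exact HGraph.not_oneWay_of_opPath hP hW₂ hχ rfl hH₂.1.1 (S.type₂ χ hhole) he hl hr₂ hp₂ h

/-- A transition of a specimen whose token interacts with the context happens in the context. -/
theorem Specimen.exists_step (S : Specimen 𝒞 R) (hR : IsPreTemplate R) (hO : OutputClosed R)
    (hr₁ : S.state₁.Rooted) (hr₂ : S.state₂.Rooted)
    (ht : S.tok.lab = .value ∨ S.tok.lab = .search ∧ ¬ S.tok.Entering) {N : State 𝕆}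
    (h : Step B S.state₁ N) :
    ∃ S' : Specimen 𝒞 R, S'.tok.Remote ∧ Step B S.state₁ S'.state₁ ∧
      Step B S.state₂ S'.state₂ := by
  obtain ⟨hP, hl⟩ := S.base_proper
  have hst := S.searchStep_of_step hR (by rcases ht with h | h <;> simp [h]) h
  have hW := (IsPlain.of_state (S.state₁_eq hR)).1
  obtain ⟨e, v', t', hm, hN⟩ := hst.exists_move (S.state₁_eq hR)
  -- A value token interacts with the edge that has its position as a target, a search token with
  -- the edge that has it as a source. In either case this edge belongs to the context and is not a
  -- hole.
  have key : ∃ (e₁ : S.base.E) (h₁ : (S.base.edgeLabel e₁).slot (fun χ => some (S.H₁ χ)) = none),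
      ¬ (S.base.edgeLabel e₁).IsHole ∧ e = .inl ⟨e₁, h₁⟩ := by
    rcases ht with ht | ⟨ht, hne⟩
    · rw [ht] at hm
      have hnin : S.pos ∉ S.base.ins := fun hi =>
        (hW.wf.1.mem_ins (.inl S.pos)).1 (List.mem_map_of_mem hi) e hm.mem_tgt
      rw [hP.mem_ins] at hnin
      push Not at hnin
      obtain ⟨e₁, he₁⟩ := hnin
      have hh := S.not_isHole_of_mem_tgt hR hO hr₁ hr₂ he₁
      refine ⟨e₁, Lab.slot_eq_none hh, hh, hW.wf.1.tgt_unique _ _ _ hm.mem_tgt ?_⟩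
      exact List.mem_map_of_mem he₁
    · rw [ht] at hm
      have hnout : S.pos ∉ S.base.outs := fun hi =>
        (hW.wf.1.mem_outs (.inl S.pos)).1 (List.mem_map_of_mem hi) e hm.mem_src
      rw [hP.mem_outs] at hnout
      push Not at hnout
      obtain ⟨e₁, he₁⟩ := hnout
      have hh : ¬ (S.base.edgeLabel e₁).IsHole := fun hh => hne (S.entering_of_mem_src hh he₁)
      refine ⟨e₁, Lab.slot_eq_none hh, hh, hW.wf.1.src_unique _ _ _ hm.mem_src ?_⟩
      exact List.mem_map_of_mem he₁
  obtain ⟨e₁, h₁, hh, rfl⟩ := key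
  obtain ⟨v₀, rfl, hm₀⟩ := hm.of_fill
  have hl₀ : S.base.vertexLabel v₀ = .star := (IsPlain.of_state hN).2
  obtain ⟨S', hlab, hs₁, hs₂, hent⟩ := S.exists_relocate hR hl₀ t'
  refine ⟨S', ?_, .inl (hm.searchStep (S.state₁_eq hR) hs₁),
    .inl ((hm₀.fill (Lab.slot_eq_none hh)).searchStep (S.state₂_eq hR) hs₂)⟩
  rw [Token.Remote, hlab]
  rcases hm₀.remote_target with h | h | hsrc
  · exact .inl h
  · exact .inr (.inl h)
  · refine .inr (.inr fun hE => ?_)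
    obtain ⟨e', he', hv'⟩ := hent hE
    exact hh (hP.src_unique _ _ _ hv' hsrc ▸ he')

end

/-! ### Simulation -/

section

variable {B : Behaviour 𝕆}

theorem Step.stepN {N M : State 𝕆} (h : Step B N M) : StepN B 1 N M := ⟨M, h, rfl⟩

theorem StepN.trans {a b : ℕ} {N M L : State 𝕆} (h : StepN B a N M) (h' : StepN B b M L) :
    StepN B (a + b) N L := by
  induction a generalizing N with
  | zero => obtain rfl : N = M := h; rwa [Nat.zero_add]
  | succ a ih =>
    obtain ⟨N', hN, h⟩ := h
    rw [Nat.add_right_comm]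
    exact ⟨N', hN, ih h⟩

theorem StepN.rooted (hfoc : Refocusing B) {k : ℕ} {N M : State 𝕆} (h : StepN B k N M)
    (hN : N.Rooted) : M.Rooted := by
  induction k generalizing N with
  | zero => obtain rfl : N = M := h; exact hN
  | succ k ih =>
    obtain ⟨N', hs, h⟩ := h
    exact ih h (hfoc _ _ hs hN)

theorem Deterministic.stepN (hdet : Deterministic B) {k : ℕ} {N N' M : State 𝕆}
    (hN : Step B N N') (h : StepN B (1 + k) N M) : StepN B k N' M := by
  rw [Nat.add_comm] at h
  obtain ⟨L, hL, h⟩ := h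
  rwa [hdet _ _ _ hN hL]

/-- `N` has a transition, so it is not the stuck state; the run is not empty and must pass through
`N'`. -/
theorem Deterministic.steps_stuck (hdet : Deterministic B) {N N' M : State 𝕆}
    (hN : Step B N N') (hM : M.IsStuck B) (h : Steps B N M) : Steps B N' M := by
  obtain ⟨_ | k, h⟩ := h
  · obtain rfl : N = M := h
    exact (hM.2 _ hN).elim
  · exact ⟨k, hdet.stepN hN (Nat.add_comm 1 k ▸ h)⟩

theorem StateRefines.refl {Q : ℕ → ℕ → Prop} (hQ : IsPreorderRel Q) (N : State 𝕆) :
    StateRefines B Q N N := fun k M hM h => ⟨k, M, hM, hQ.1 k, h⟩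

theorem StateRefines.mono {Q Q' : ℕ → ℕ → Prop} (hQ : ∀ a b, Q a b → Q' a b) {N M : State 𝕆}
    (h : StateRefines B Q N M) : StateRefines B Q' N M := fun k L hL hN =>
  let ⟨k', L', hL', hq, hM⟩ := h k L hL hN
  ⟨k', L', hL', hQ _ _ hq, hM⟩

/-- The second clause in the definition of simulations, for a transition to `G₁'` from a state
related to `G₂`. -/
def Simulates (B : Behaviour 𝕆) (Q Q' Q'' : ℕ → ℕ → Prop) (R : State 𝕆 → State 𝕆 → Prop)
    (G₁' G₂ : State 𝕆) : Prop :=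
  (∃ M : State 𝕆, M.IsStuck B ∧ Steps B G₁' M) ∨
    ∃ (H₁ H₂ : State 𝕆) (k₁ k₂ : ℕ),
      (∃ K₁ K₂, StateRefines B Q' H₁ K₁ ∧ R K₁ K₂ ∧ StateRefines B Q'' K₂ H₂) ∧
      Q (1 + k₁) k₂ ∧ StepN B k₁ G₁' H₁ ∧ StepN B k₂ G₂ H₂

variable {𝒞 : Set (Hypernet 𝕆)} {R : Hypernet 𝕆 → Hypernet 𝕆 → Prop} {Q Q' Q'' : ℕ → ℕ → Prop}

theorem IsPreTemplate.flip (hR : IsPreTemplate R) : IsPreTemplate (flip R) := fun _ _ h =>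
  let ⟨h₁, h₂, I, O, hI, hO⟩ := hR _ _ h
  ⟨h₂, h₁, I, O, hO, hI⟩

theorem OutputClosed.flip (hO : OutputClosed R) : OutputClosed (flip R) := fun _ _ h =>
  (hO _ _ h).symm

theorem Token.remote_of_ne_rewrite {G : Net 𝕆} {τ : Token G} (h : τ.lab ≠ .rewrite) :
    τ.Remote := by
  unfold Token.Remote
  cases ht : τ.lab with
  | search => exact .inl rfl
  | value => exact .inr (.inl rfl)
  | rewrite => exact (h ht).elim

/-- A specimen reached on both sides witnesses the simulation. -/
theorem Specimen.simulates (hQ : Reasonable Q Q' Q'') (S : Specimen 𝒞 R) (hS : S.tok.Remote)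
    {G₁ G₂ : State 𝕆} {k₁ k₂ : ℕ} (hr₁ : S.state₁.Rooted) (hr₂ : S.state₂.Rooted)
    (hk : Q (1 + k₁) k₂) (h₁ : StepN B k₁ G₁ S.state₁) (h₂ : StepN B k₂ G₂ S.state₂) :
    Simulates B Q Q' Q'' (Lifting 𝒞 R) G₁ G₂ :=
  .inr ⟨_, _, k₁, k₂, ⟨_, _, .refl hQ.preorder' _, ⟨S, hS, rfl, rfl, hr₁, hr₂⟩,
    .refl hQ.preorder'' _⟩, hk, h₁, h₂⟩

/-- A quasi-specimen reached on both sides witnesses the simulation. -/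
theorem QuasiSpecimen.simulates {t : Tok} {N₁ N₂ G₁ G₂ : State 𝕆}
    (h : QuasiSpecimen 𝒞 R (StateRefines B Q') (StateRefines B Q'') t N₁ N₂) (ht : t ≠ .rewrite)
    {k₁ k₂ : ℕ} (hr₁ : N₁.Rooted) (hr₂ : N₂.Rooted)
    (hk : Q (1 + k₁) k₂) (h₁ : StepN B k₁ G₁ N₁) (h₂ : StepN B k₂ G₂ N₂) :
    Simulates B Q Q' Q'' (Lifting 𝒞 R) G₁ G₂ := by
  obtain ⟨S, hS, -, -, hN⟩ := h
  obtain ⟨hs₁, hs₂, hA, hA'⟩ := hN hr₁ hr₂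
  exact .inr ⟨N₁, N₂, k₁, k₂, ⟨_, _, hA,
    ⟨S, Token.remote_of_ne_rewrite (hS ▸ ht), rfl, rfl, hs₁, hs₂⟩, hA'⟩, hk, h₁, h₂⟩

/-- A transition whose token does not enter a hole is simulated one to one. -/
theorem Specimen.simulates_of_step (hdet : Deterministic B) (hfoc : Refocusing B)
    (hQ : Reasonable Q Q' Q'') (hR : IsPreTemplate R) (hO : OutputClosed R)
    (S : Specimen 𝒞 R) (hr₁ : S.state₁.Rooted) (hr₂ : S.state₂.Rooted)
    (ht : S.tok.lab ≠ .rewrite) (hE : S.tok.lab = .search → ¬ S.tok.Entering) {N G₂ : State 𝕆}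
    {k : ℕ} (hk : Q 0 k) (hG : StepN B k G₂ S.state₂) (h : Step B S.state₁ N) :
    Simulates B Q Q' Q'' (Lifting 𝒞 R) N G₂ := by
  have ht' : S.tok.lab = .value ∨ S.tok.lab = .search ∧ ¬ S.tok.Entering := by
    cases h : S.tok.lab with
    | search => exact .inr ⟨rfl, hE h⟩
    | value => exact .inl rfl
    | rewrite => exact (ht h).elim
  obtain ⟨S', hS', h₁, h₂⟩ := S.exists_step hR hO hr₁ hr₂ ht' h
  obtain rfl := hdet _ _ _ h h₁
  exact S'.simulates hQ hS' (k₁ := 0) (hfoc _ _ h₁ hr₁) (hfoc _ _ h₂ hr₂)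
    -- One step on the left answers `k + 1` on the right: `Q 0 k` and `Q 1 1` are added. The `k`
    -- steps are the delay already spent before reaching the specimen.
    (Nat.add_comm 0 1 ▸ hQ.add _ _ _ _ hk (hQ.preorder.1 1)) rfl (hG.trans h₂.stepN)

/-- The contextual lifting is a simulation as soon as the transitions of search tokens entering a
hole are simulated. -/
theorem Robust.isSimulation (hdet : Deterministic B) (hfoc : Refocusing B)
    (hQ : Reasonable Q Q' Q'') (hR : IsPreTemplate R) (hO : OutputClosed R)
    (hrob : Robust B 𝒞 Q Q' Q'' R)
    (hin : ∀ S : Specimen 𝒞 R, S.tok.lab = .search → S.tok.Entering → S.state₁.Rooted →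
      S.state₂.Rooted → ∀ G, Step B S.state₁ G →
        Simulates B Q Q' Q'' (Lifting 𝒞 R) G S.state₂) :
    IsSimulation B Q Q' Q'' (Lifting 𝒞 R) := by
  rintro _ _ ⟨S, hS, rfl, rfl, hr₁, hr₂⟩
  refine ⟨(S.isFinal_iff hR).1, fun G hG => ?_⟩
  by_cases ht : S.tok.lab = .rewrite
  -- Remoteness says nothing for search and value tokens; for a rewrite token it is exactly the
  -- condition under which robustness applies.
  · have hE : ¬ S.tok.Entering := by
      rcases hS with h | h | h
      · simp [ht] at h
      · simp [ht] at h
      · exact h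
    rcases hrob _ _ (S.rewriteStep_of_step hR ht hG) S rfl ht hE with
      h | h | ⟨N₁, N₂, t, k₁, k₂, ht, hq, hk, h₁, h₂⟩
    · exact h.elim (absurd hr₁) (absurd hr₂)
    · exact .inl h
    · exact hq.simulates ht (h₁.rooted hfoc (hfoc _ _ hG hr₁)) (h₂.rooted hfoc hr₂) hk h₁ h₂
  · by_cases hE : S.tok.lab = .search ∧ S.tok.Entering
    · exact hin S hE.1 hE.2 hr₁ hr₂ G hG
    · exact S.simulates_of_step hdet hfoc hQ hR hO hr₁ hr₂ ht (fun h h' => hE ⟨h, h'⟩)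
        (hQ.preorder.1 0) rfl hG

/-- The cases of input-safety yield the disjuncts of the simulation after dropping the first
transition of the left run, which determinism identifies with the given one. In the third,
equivalence up to `Q'` gives refinement up to `Q'` on the left and, as `Q'` is contained in `Q''`,
up to `Q''` on the right. -/
theorem IsTemplate.isSimulation (hdet : Deterministic B) (hfoc : Refocusing B)
    (hQ : Reasonable Q Q' Q'') (hR : IsPreTemplate R) (hT : IsTemplate B 𝒞 Q Q' R)
    (hrob : Robust B 𝒞 Q Q' Q'' R) : IsSimulation B Q Q' Q'' (Lifting 𝒞 R) := by
  refine hrob.isSimulation hdet hfoc hQ hR hT.2 fun S ht hE hr₁ hr₂ G hG => ?_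
  rcases hT.1 S ht hE with ⟨N, -, hN, -, h, -⟩ | ⟨S', k₁, k₂, ht', -, hk, h₁, h₂⟩ |
    ⟨N₁, N₂, t, k₁, k₂, ht', ⟨S', hl, ht₁, ht₂, hq⟩, hk, h₁, h₂⟩
  · exact .inl ⟨N, hN, hdet.steps_stuck hG hN h⟩
  · exact S'.simulates hQ (Token.remote_of_ne_rewrite ht') (h₁.rooted hfoc hr₁)
      (h₂.rooted hfoc hr₂) hk (hdet.stepN hG h₁) h₂
  · refine QuasiSpecimen.simulates ⟨S', hl, ht₁, ht₂, fun r₁ r₂ => ?_⟩ ht' (h₁.rooted hfoc hr₁)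
      (h₂.rooted hfoc hr₂) hk (hdet.stepN hG h₁) h₂
    obtain ⟨s₁, s₂, hA, hA'⟩ := hq r₁ r₂
    exact ⟨s₁, s₂, hA.1, hA'.1.mono hQ.le_snd⟩

/-- The template now plays the given transition on its second side. In the second case of
input-safety the run on this side may be empty, so it need not absorb the transition; this is why
that case demands a token that is neither a rewrite token nor entering. -/
theorem IsTemplate.isSimulation_flip (hdet : Deterministic B) (hfoc : Refocusing B)
    (hQ : Reasonable Q Q' Q'') (hR : IsPreTemplate R) (hT : IsTemplate B 𝒞 (flip Q) Q' R)
    (hrob : Robust B 𝒞 Q Q' Q'' (flip R)) :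
    IsSimulation B Q Q' Q'' (Lifting 𝒞 (flip R)) := by
  refine hrob.isSimulation hdet hfoc hQ hR.flip hT.2.flip fun S ht hE hr₁ hr₂ G hG => ?_
  rcases hT.1 S.swap ht hE with ⟨-, N, -, hN, -, h⟩ | ⟨S', k₁, k₂, ht', hE', hk, h₁, h₂⟩ |
    ⟨N₁, N₂, t, k₁, k₂, ht', ⟨S', hl, ht₁, ht₂, hq⟩, hk, h₁, h₂⟩
  · exact .inl ⟨N, hN, hdet.steps_stuck hG hN h⟩
  · have r₁ := h₁.rooted hfoc hr₂
    have r₂ := h₂.rooted hfoc hr₁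
    cases k₂ with
    -- The state to be simulated is already that of the new specimen, and `hk` says `Q 0 (1 + k₁)`.
    -- The given transition is a transition of this specimen inside its context, and the other side
    -- answers with one more step.
    | zero =>
      have h₂ : S.state₁ = S'.swap.state₁ := h₂
      exact S'.swap.simulates_of_step hdet hfoc hQ hR.flip hT.2.flip r₂ r₁ ht' (fun _ => hE') hk
        h₁ (h₂ ▸ hG)
    | succ k =>
      rw [Nat.add_comm k 1] at h₂ hk
      exact S'.swap.simulates hQ (Token.remote_of_ne_rewrite ht') r₂ r₁ hk (hdet.stepN hG h₂) h₁
  · refine QuasiSpecimen.simulates ⟨S'.swap, hl, ht₂, ht₁, fun r₂ r₁ => ?_⟩ ht'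
      (h₂.rooted hfoc hr₁) (h₁.rooted hfoc hr₂) hk (hdet.stepN hG h₂) h₁
    obtain ⟨s₁, s₂, hA, hA'⟩ := hq r₁ r₂
    -- Exchanging the sides reverses both comparisons with the specimen. It is here that templates
    -- need equivalences instead of refinements in one direction.
    exact ⟨s₂, s₁, hA'.2, hA.2.mono hQ.le_snd⟩

end

end Spartan

theorem mainTheorem2 (𝕆 : Spartan.OpSet.{u}) (B : Spartan.Behaviour 𝕆)
    (hdet : Spartan.Deterministic B) (hfoc : Spartan.Refocusing B)
    (𝒞 : Set (Spartan.Hypernet 𝕆)) (hctx : Spartan.IsContextSet 𝒞)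
    (hplug : Spartan.ClosedUnderPlugging 𝒞)
    (Q Q' Q'' : ℕ → ℕ → Prop) (hQ : Spartan.Reasonable Q Q' Q'')
    (R : Spartan.Hypernet 𝕆 → Spartan.Hypernet 𝕆 → Prop) (hR : Spartan.IsPreTemplate R) :
    (Spartan.IsTemplate B 𝒞 Q Q' R → Spartan.Robust B 𝒞 Q Q' Q'' R →
      Spartan.IsSimulation B Q Q' Q'' (Spartan.Lifting 𝒞 R)) ∧
    (Spartan.IsTemplate B 𝒞 (flip Q) Q' R → Spartan.Robust B 𝒞 Q Q' Q'' (flip R) →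
      Spartan.IsSimulation B Q Q' Q'' (Spartan.Lifting 𝒞 (flip R))) := by
  exact ⟨Spartan.IsTemplate.isSimulation hdet hfoc hQ hR,
    Spartan.IsTemplate.isSimulation_flip hdet hfoc hQ hR⟩
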